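/- Let $S$ be a complex manifold and let $\mathcal V\to S$ be a variation of graded-polarized mixed Hodge structure: a $\mathbb Q$-local system $\mathcal V_{\mathbb Q}$ of finite rank with a finite increasing filtration $\mathcal W$ by sub-local systems, a finite decreasing filtration $\mathcal F$ of $\mathcal V_{\mathbb Q}\otimes\mathcal O_S$ by holomorphic subbundles with $\nabla\mathcal F^p\subseteq\Omega^1_S\otimes\mathcal F^{p-1}$ for the Gauss–Manin connection $\nabla$, and flat rational nondegenerate bilinear forms $\mathcal S_k$ of parity $(-1)^k$ on $Gr^{\mathcal W}_k$, such that $(Gr^{\mathcal W}_k,\mathcal F Gr^{\mathcal W}_k,\mathcal S_k)$ is a variation of pure polarized Hodge structure of weight $k$ for every $k$. Let $E$ be the $C^\infty$ complex vector bundle underlying $\mathcal V$, with its flat connection $\nabla=\nabla^{1,0}+\nabla^{0,1}$. Each fibre $(\mathcal F_s,\mathcal W_s)$ has a unique Deligne bigrading, that is, a decomposition $E_s=\bigoplus_{p,q}I^{p,q}_s$ with $\mathcal F^p_s=\bigoplus_{r\ge p,\,t}I^{r,t}_s$, $\mathcal W_{k,s}\otimes\mathbb C=\bigoplus_{r+t\le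 k}I^{r,t}_s$ and $I^{p,q}_s\equiv\overline{I^{q,p}_s}$ modulo $\bigoplus_{r<p,\,t<q}I^{r,t}_s$. Put $\mathcal U^p_s=\bigoplus_q I^{p,q}_s$. Then: 1. The $\mathcal U^p$ are $C^\infty$ subbundles, $E=\bigoplus_p\mathcal U^p$, and $(E,\nabla,\{\mathcal U^p\})$ is a complex variation of Hodge structure: $$\nabla:\mathcal E^0(\mathcal U^p)\to\mathcal E^{0,1}(\mathcal U^{p+1})\oplus\mathcal E^{0,1}(\mathcal U^p)\oplus\mathcal E^{1,0}(\mathcal U^p)\oplus\mathcal E^{1,0}(\mathcal U^{p-1}).$$ 2. Write accordingly $\nabla=\tau+\bar\partial+\partial+\theta$, where on $\mathcal U^p$ the terms $\tau,\bar\partial,\partial,\theta$ take values in $\mathcal E^{0,1}(\mathcal U^{p+1})$, $\mathcal E^{0,1}(\mathcal U^p)$, $\mathcal E^{1,0}(\mathcal U^p)$, $\mathcal E^{1,0}(\mathcal U^{p-1})$ respectively. Then $(E,\bar\partial+\theta)$ is a Higgs bundle: $(E,\bar\partial)$ is a holomorphic vector bundle and $\theta$ is an $\mathrm{End}(E)$-valued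 $(1,0)$-form with $\bar\partial\theta=0$ and $\theta\wedge\theta=0$. 3. This Higgs bundle is a fixed point of the $\mathbb C^*$-action $(E,\bar\partial+\theta)\mapsto(E,\bar\partial+\lambda\theta)$: for every $\lambda\in\mathbb C^*$ there is an isomorphism of Higgs bundles $(E,\bar\partial+\theta)\cong(E,\bar\partial+\lambda\theta)$. -/

import Mathlib

open scoped Manifold ContDiff TensorProduct Topology

noncomputable section

namespace MHS

universe u w

/-! ### Hodge theory on a single rational vector space -/

section LinearAlgebra

variable {H : Type*} [AddCommGroup H] [Module ℚ H]

/-- Complex conjugation on `ℂ ⊗ H`, for a rational vector space `H`: `z ⊗ h ↦ z̄ ⊗ h`. -/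
def conjC (H : Type*) [AddCommGroup H] [Module ℚ H] :
    (ℂ ⊗[ℚ] H) →ₗ⋆[ℂ] (ℂ ⊗[ℚ] H) where
  toFun := LinearMap.rTensor H (Complex.conjAe.toLinearMap.restrictScalars ℚ)
  map_add' := map_add _
  map_smul' c v := by
    induction v using TensorProduct.induction_on with
    | zero => simp
    | tmul z h => simp [TensorProduct.smul_tmul']
    | add a b ha hb => rw [smul_add, map_add, ha, hb, map_add, smul_add]

/-- The complex conjugate of a complex subspace of `ℂ ⊗ H`. -/
def conjSub (A : Submodule ℂ (ℂ ⊗[ℚ] H)) : Submodule ℂ (ℂ ⊗[ℚ] H) := A.map (conjC H)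

/-- A pure Hodge structure of weight `k` on `H`: a finite decreasing filtration `F` of `ℂ ⊗ H`
which is `k`-opposed to its complex conjugate. -/
structure IsPureHodge (k : ℤ) (F : ℤ → Submodule ℂ (ℂ ⊗[ℚ] H)) : Prop where
  antitone : Antitone F
  exhaustive : ∃ p, F p = ⊤
  separated : ∃ p, F p = ⊥
  opposed : ∀ p, IsCompl (F p) (conjSub (F (k + 1 - p)))

/-- `Q` is a polarization of the weight `k` Hodge structure `F`: it is nondegenerate, of parity
`(-1)^k`, and satisfies the two Riemann bilinear relations. The Hodge components are
`H^{p,q} = F^p ∩ conj F^q`, `p + q = k`. -/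
structure IsPolarization (k : ℤ) (F : ℤ → Submodule ℂ (ℂ ⊗[ℚ] H))
    (Q : LinearMap.BilinForm ℚ H) : Prop where
  nondegenerate : Q.Nondegenerate
  parity : ∀ a b, Q a b = (-1 : ℚ) ^ k * Q b a
  isotropic : ∀ p, ∀ a ∈ F p, ∀ b ∈ F (k - p + 1), Q.baseChange ℂ a b = 0
  positive : ∀ p, ∀ a ∈ F p ⊓ conjSub (F (k - p)), a ≠ 0 →
    0 < (Complex.I ^ (p - (k - p)) * Q.baseChange ℂ a (conjC H a)).re ∧
      (Complex.I ^ (p - (k - p)) * Q.baseChange ℂ a (conjC H a)).im = 0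

/-- The graded piece `W_k / W_{k-1}` of a filtration `W` of `H`. -/
abbrev Gr (W : ℤ → Submodule ℚ H) (k : ℤ) : Type _ :=
  W k ⧸ (W (k - 1)).submoduleOf (W k)

/-- The inclusion `ℂ ⊗ W_k → ℂ ⊗ H`. -/
def inclC (W : ℤ → Submodule ℚ H) (k : ℤ) : (ℂ ⊗[ℚ] W k) →ₗ[ℂ] (ℂ ⊗[ℚ] H) :=
  (W k).subtype.baseChange ℂ

/-- The projection `ℂ ⊗ W_k → ℂ ⊗ (W_k / W_{k-1})`. -/
def projC (W : ℤ → Submodule ℚ H) (k : ℤ) : (ℂ ⊗[ℚ] W k) →ₗ[ℂ] (ℂ ⊗[ℚ] Gr W k) :=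
  ((W (k - 1)).submoduleOf (W k)).mkQ.baseChange ℂ

/-- The filtration `F^p Gr_k`, the image of `F^p ∩ W_k` in `Gr_k`. -/
def grF (F : ℤ → Submodule ℂ (ℂ ⊗[ℚ] H)) (W : ℤ → Submodule ℚ H) (k p : ℤ) :
    Submodule ℂ (ℂ ⊗[ℚ] Gr W k) :=
  ((F p).comap (inclC W k)).map (projC W k)

/-- A mixed Hodge structure `(F, W)` on `H`. -/
structure IsMixedHodge (F : ℤ → Submodule ℂ (ℂ ⊗[ℚ] H)) (W : ℤ → Submodule ℚ H) : Prop where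
  W_monotone : Monotone W
  W_exhaustive : ∃ k, W k = ⊤
  W_separated : ∃ k, W k = ⊥
  F_antitone : Antitone F
  F_exhaustive : ∃ p, F p = ⊤
  F_separated : ∃ p, F p = ⊥
  pure_gr : ∀ k, IsPureHodge k (grF F W k)

/-- `I` is the Deligne bigrading of `(F, W)`: `ℂ ⊗ H = ⨁ I^{p,q}`, `F^p = ⨁_{r ≥ p, s} I^{r,s}`,
`ℂ ⊗ W_k = ⨁_{r + s ≤ k} I^{r,s}`, and `I^{p,q} = conj I^{q,p}` modulo
`⨁_{r < p, s < q} I^{r,s}`. -/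
structure IsDeligneBigrading (F : ℤ → Submodule ℂ (ℂ ⊗[ℚ] H)) (W : ℤ → Submodule ℚ H)
    (I : ℤ → ℤ → Submodule ℂ (ℂ ⊗[ℚ] H)) : Prop where
  directSum : DirectSum.IsInternal (fun a : ℤ × ℤ => I a.1 a.2)
  F_eq : ∀ p, F p = ⨆ (r : ℤ) (_ : p ≤ r) (s : ℤ), I r s
  W_eq : ∀ k, (W k).baseChange ℂ = ⨆ (r : ℤ) (s : ℤ) (_ : r + s ≤ k), I r s
  conj_eq : ∀ p q,
    I p q ⊔ (⨆ (r : ℤ) (_ : r < p) (s : ℤ) (_ : s < q), I r s) =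
      conjSub (I q p) ⊔ (⨆ (r : ℤ) (_ : r < p) (s : ℤ) (_ : s < q), I r s)

end LinearAlgebra

/-! ### Local systems and their smooth bundles -/

/-- A local system of finite-dimensional `K`-vector spaces on `S`, presented by local
trivializations with locally constant transition functions. There is one trivialization
`triv x` centred at each point `x`; it is an isomorphism over the open set `baseSet x ∋ x`
(its values elsewhere are irrelevant). -/
structure LocalSystem (K : Type*) [Field K] (S : Type u) [TopologicalSpace S] where
  Fiber : S → Type w
  [addCommGroup : ∀ s, AddCommGroup (Fiber s)]
  [module : ∀ s, Module K (Fiber s)]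
  baseSet : S → Set S
  isOpen_baseSet : ∀ x, IsOpen (baseSet x)
  mem_baseSet : ∀ x, x ∈ baseSet x
  rank : S → ℕ
  triv : ∀ x y, Fiber y →ₗ[K] (Fin (rank x) → K)
  triv_bijective : ∀ x, ∀ y ∈ baseSet x, Function.Bijective (triv x y)
  transition : ∀ x x', ∀ y ∈ baseSet x ∩ baseSet x',
    ∃ A : (Fin (rank x) → K) →ₗ[K] (Fin (rank x') → K),
      ∀ᶠ z in 𝓝 y, triv x' z = A ∘ₗ triv x z

attribute [instance] LocalSystem.addCommGroup LocalSystem.module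

/-- The complexification `V ⊗ ℂ` of a rational local system. -/
def LocalSystem.complexify {S : Type u} [TopologicalSpace S] (V : LocalSystem.{u, w} ℚ S) :
    LocalSystem.{u, w} ℂ S where
  Fiber s := ℂ ⊗[ℚ] V.Fiber s
  baseSet := V.baseSet
  isOpen_baseSet := V.isOpen_baseSet
  mem_baseSet := V.mem_baseSet
  rank := V.rank
  triv x y := (TensorProduct.piScalarRight ℚ ℂ ℂ (Fin (V.rank x))).toLinearMap ∘ₗ
    (V.triv x y).baseChange ℂ
  triv_bijective x y hy := by
    have h := ((LinearEquiv.ofBijective (V.triv x y)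
      (V.triv_bijective x y hy)).baseChange ℚ ℂ _ _).bijective
    exact (TensorProduct.piScalarRight ℚ ℂ ℂ (Fin (V.rank x))).bijective.comp h
  transition x x' y hy := by
    obtain ⟨A, hA⟩ := V.transition x x' y hy
    refine ⟨(TensorProduct.piScalarRight ℚ ℂ ℂ (Fin (V.rank x'))).toLinearMap ∘ₗ
      A.baseChange ℂ ∘ₗ
      (TensorProduct.piScalarRight ℚ ℂ ℂ (Fin (V.rank x))).symm.toLinearMap, ?_⟩
    filter_upwards [hA] with z hz
    rw [hz, LinearMap.baseChange_comp]
    refine LinearMap.ext fun t => ?_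
    simp only [LinearMap.comp_apply, LinearEquiv.coe_coe, LinearEquiv.symm_apply_apply]

/-- The type `(1,0)` (complex-linear) part of a real-linear map on a complex vector space. -/
def part10 {E M : Type*} [AddCommGroup E] [Module ℂ E] [AddCommGroup M] [Module ℂ M]
    (A : E →ₗ[ℝ] M) : E →ₗ[ℂ] M where
  toFun v := (2⁻¹ : ℂ) • (A v - Complex.I • A (Complex.I • v))
  map_add' u v := by simp only [smul_add, map_add]; module
  map_smul' c v := by
    have h : ∀ (c : ℂ) (v : E), A (c • v) = (c.re : ℂ) • A v + (c.im : ℂ) • A (Complex.I • v) := by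
      intro c v
      conv_lhs => rw [← Complex.re_add_im c, add_smul, mul_smul, map_add]
      rw [Complex.coe_smul, Complex.coe_smul, map_smul, map_smul, Complex.coe_smul,
        Complex.coe_smul]
    have h2 : A (Complex.I • c • v) = (-c.im : ℂ) • A v + (c.re : ℂ) • A (Complex.I • v) := by
      rw [← mul_smul, h]; simp
    rw [h2, h c v]
    obtain ⟨a, b⟩ := c
    have e : (⟨a, b⟩ : ℂ) = (a : ℂ) + b * Complex.I := by
      apply Complex.ext <;> simp
    simp only [RingHom.id_apply, e]
    match_scalars <;> (ring_nf; try (simp; try ring))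

/-- The type `(0,1)` (antilinear) part of a real-linear map on a complex vector space. -/
def part01 {E M : Type*} [AddCommGroup E] [Module ℂ E] [AddCommGroup M] [Module ℂ M]
    (A : E →ₗ[ℝ] M) : E →ₗ⋆[ℂ] M where
  toFun v := (2⁻¹ : ℂ) • (A v + Complex.I • A (Complex.I • v))
  map_add' u v := by simp only [smul_add, map_add]; module
  map_smul' c v := by
    have h : ∀ (c : ℂ) (v : E), A (c • v) = (c.re : ℂ) • A v + (c.im : ℂ) • A (Complex.I • v) := by
      intro c v
      conv_lhs => rw [← Complex.re_add_im c, add_smul, mul_smul, map_add]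
      rw [Complex.coe_smul, Complex.coe_smul, map_smul, map_smul, Complex.coe_smul,
        Complex.coe_smul]
    have h2 : A (Complex.I • c • v) = (-c.im : ℂ) • A v + (c.re : ℂ) • A (Complex.I • v) := by
      rw [← mul_smul, h]; simp
    rw [h2, h c v]
    obtain ⟨a, b⟩ := c
    have e : (⟨a, b⟩ : ℂ) = (a : ℂ) + b * Complex.I := by
      apply Complex.ext <;> simp
    simp only [e, map_add, map_mul, Complex.conj_ofReal, Complex.conj_I]
    match_scalars <;> (ring_nf; try (simp; try ring))

section Bundle

/- `S` is a complex manifold modelled on the finite-dimensional complex vector space `E`.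
The holomorphic tangent space at `x` is `TangentSpace 𝓘(ℂ, E) x`, which by definition is `E`
(identified through the chart at `x`); we write tangent vectors as elements of `E`. The
underlying smooth manifold of `S` uses the same charts with the model `𝓘(ℝ, E)`. -/
variable (E : Type*) [NormedAddCommGroup E] [NormedSpace ℂ E]
  {S : Type u} [TopologicalSpace S] [ChartedSpace E S]

/-- A complex function is smooth on a neighbourhood of `x`. -/
def FunSmoothNear (g : S → ℂ) (x : S) : Prop :=
  ∀ᶠ y in 𝓝 x, ContMDiffAt 𝓘(ℝ, E) 𝓘(ℝ, ℂ) ∞ g y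

/-- The type `(0,1)` part `∂̄g` of the differential of a smooth function at `x`. -/
def dbarFun (g : S → ℂ) (x : S) : E →ₗ⋆[ℂ] ℂ :=
  part01 (E := E) (M := ℂ) (mfderiv 𝓘(ℝ, E) 𝓘(ℝ, ℂ) g x).toLinearMap

/-- The holomorphic coordinate vector field `∂_v` of the chart at `x`, for `v ∈ E`: its value at
a point `y` near `x` is the tangent vector at `y` which is represented by `v` in the chart
at `x`. -/
def coordField [IsManifold 𝓘(ℂ, E) ω S] (x : S) (v : E) (y : S) : E :=
  tangentCoordChange 𝓘(ℂ, E) x y y v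

variable (L : LocalSystem.{u, w} ℂ S)

/-- A (not necessarily continuous) section of `L`. -/
abbrev LocalSystem.Sec : Type _ := ∀ s : S, L.Fiber s

variable {L}

/-- The components of a section in the flat trivialization centred at `x`. -/
def LocalSystem.coord (x : S) (σ : L.Sec) (y : S) : Fin (L.rank x) → ℂ := L.triv x y (σ y)

/-- `σ` restricts to a smooth section of (the smooth bundle of) `L` on a neighbourhood of `x`. -/
def SmoothNear (σ : L.Sec) (x : S) : Prop :=
  ∀ᶠ y in 𝓝 x, ContMDiffAt 𝓘(ℝ, E) 𝓘(ℝ, Fin (L.rank x) → ℂ) ∞ (LocalSystem.coord x σ) y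

variable {E} in
theorem SmoothNear.const_smul {σ : L.Sec} {x : S} (h : SmoothNear E σ x) (c : ℂ) :
    SmoothNear E (fun y => c • σ y) x := by
  filter_upwards [h] with y hy
  have e : LocalSystem.coord x (fun y => c • σ y) =
      (((c • ContinuousLinearMap.id ℂ (Fin (L.rank x) → ℂ)).restrictScalars ℝ :
        (Fin (L.rank x) → ℂ) →L[ℝ] (Fin (L.rank x) → ℂ))) ∘ LocalSystem.coord x σ := by
    ext z i
    simp [LocalSystem.coord]
  rw [e]
  exact (ContinuousLinearMap.contMDiff _).contMDiffAt.comp y hy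

/-- `σ` restricts to a holomorphic section of `L ⊗ 𝒪_S` on a neighbourhood of `x`. -/
def HolNear (σ : L.Sec) (x : S) : Prop :=
  ∀ᶠ y in 𝓝 x, ContMDiffAt 𝓘(ℂ, E) 𝓘(ℂ, Fin (L.rank x) → ℂ) ω (LocalSystem.coord x σ) y

/-- `A` is a smooth subbundle of the smooth bundle of `L`: it has local smooth frames. -/
def IsSmoothSubbundle (A : ∀ s, Submodule ℂ (L.Fiber s)) : Prop :=
  ∀ x, ∃ (m : ℕ) (f : Fin m → L.Sec), (∀ j, SmoothNear E (f j) x) ∧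
    ∀ᶠ y in 𝓝 x, LinearIndependent ℂ (fun j => f j y) ∧
      Submodule.span ℂ (Set.range fun j => f j y) = A y

/-- `A` is a holomorphic subbundle of `L ⊗ 𝒪_S`: it has local holomorphic frames. -/
def IsHolSubbundle (A : ∀ s, Submodule ℂ (L.Fiber s)) : Prop :=
  ∀ x, ∃ (m : ℕ) (f : Fin m → L.Sec), (∀ j, HolNear E (f j) x) ∧
    ∀ᶠ y in 𝓝 x, LinearIndependent ℂ (fun j => f j y) ∧
      Submodule.span ℂ (Set.range fun j => f j y) = A y

/-- The Gauss--Manin connection of `L`: the exterior derivative in flat trivializations. The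
value at `x` of `∇σ` is a real-linear map from the tangent space to the fibre. -/
def nabla (σ : L.Sec) (x : S) : E →ₗ[ℝ] L.Fiber x :=
  ((LinearEquiv.ofBijective (L.triv x x)
      (L.triv_bijective x x (L.mem_baseSet x))).symm.toLinearMap.restrictScalars ℝ) ∘ₗ
    (mfderiv 𝓘(ℝ, E) 𝓘(ℝ, Fin (L.rank x) → ℂ) (LocalSystem.coord x σ) x).toLinearMap

/-- The type `(1,0)` part of the Gauss--Manin connection. -/
def nabla10 (σ : L.Sec) (x : S) : E →ₗ[ℂ] L.Fiber x := part10 (nabla E σ x)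

/-- The type `(0,1)` part of the Gauss--Manin connection. -/
def nabla01 (σ : L.Sec) (x : S) : E →ₗ⋆[ℂ] L.Fiber x := part01 (nabla E σ x)

variable (L)

/-- A complex variation of Hodge structure on the flat bundle of `L`: a decomposition
`L = ⨁_p U^p` into smooth subbundles satisfying Griffiths' horizontality
`∇ : ℰ⁰(U^p) → ℰ^{0,1}(U^{p+1}) ⊕ ℰ^{0,1}(U^p) ⊕ ℰ^{1,0}(U^p) ⊕ ℰ^{1,0}(U^{p-1})`. -/
structure ComplexVHS where
  U : ℤ → ∀ s, Submodule ℂ (L.Fiber s)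
  smooth : ∀ p, IsSmoothSubbundle E (U p)
  directSum : ∀ s, DirectSum.IsInternal (fun p => U p s)
  horizontal : ∀ (p : ℤ) (x : S) (σ : L.Sec), SmoothNear E σ x → (∀ᶠ y in 𝓝 x, σ y ∈ U p y) →
    ∀ v : E, nabla01 E σ x v ∈ U (p + 1) x ⊔ U p x ∧ nabla10 E σ x v ∈ U p x ⊔ U (p - 1) x

variable [IsManifold 𝓘(ℂ, E) ω S]

/-- A Higgs bundle structure `∂̄ + θ` on the smooth vector bundle underlying `L`.

* `dbar` is the operator `∂̄ : ℰ⁰ → ℰ^{0,1}` of a holomorphic structure: it is additive and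
  satisfies the Leibniz rule on smooth sections, and near every point there is a smooth frame
  annihilated by `∂̄` (a holomorphic frame). The Leibniz rule makes `dbar σ x` depend only on
  the germ of the smooth section `σ` at `x`; values on non-smooth sections are irrelevant.
* `theta` is a smooth `End`-valued form of type `(1,0)`.
* `dbar_theta` says that `∂̄θ = 0`, evaluated on a holomorphic coordinate vector field `∂_v` and
  an antiholomorphic direction `w`; `theta_theta` says that `θ ∧ θ = 0`. -/
structure HiggsStructure where
  dbar : L.Sec → ∀ x : S, E →ₗ⋆[ℂ] L.Fiber x
  theta : ∀ x : S, E →ₗ[ℂ] Module.End ℂ (L.Fiber x)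
  dbar_add : ∀ (σ σ' : L.Sec) (x : S), SmoothNear E σ x → SmoothNear E σ' x →
    dbar (σ + σ') x = dbar σ x + dbar σ' x
  dbar_leibniz : ∀ (g : S → ℂ) (σ : L.Sec) (x : S), FunSmoothNear E g x → SmoothNear E σ x →
    ∀ w : E, dbar (fun y => g y • σ y) x w = dbarFun E g x w • σ x + g x • dbar σ x w
  holomorphic_frame : ∀ x : S, ∃ (m : ℕ) (f : Fin m → L.Sec), (∀ j, SmoothNear E (f j) x) ∧
    ∀ᶠ y in 𝓝 x, LinearIndependent ℂ (fun j => f j y) ∧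
      Submodule.span ℂ (Set.range fun j => f j y) = ⊤ ∧ ∀ j, dbar (f j) y = 0
  theta_smooth : ∀ (x : S) (v : E) (σ : L.Sec), SmoothNear E σ x →
    SmoothNear E (fun y => theta y (coordField E x v y) (σ y)) x
  dbar_theta : ∀ (x : S) (v w : E) (σ : L.Sec), SmoothNear E σ x →
    dbar (fun y => theta y (coordField E x v y) (σ y)) x w = theta x v (dbar σ x w)
  theta_theta : ∀ (x : S) (u v : E), theta x u ∘ₗ theta x v = theta x v ∘ₗ theta x u

variable {E L}

/-- The action of `ℂ^*` on Higgs bundle structures, `∂̄ + θ ↦ ∂̄ + cθ`. -/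
def HiggsStructure.act (c : ℂˣ) (B : HiggsStructure E L) : HiggsStructure E L where
  dbar := B.dbar
  theta x := (c : ℂ) • B.theta x
  dbar_add := B.dbar_add
  dbar_leibniz := B.dbar_leibniz
  holomorphic_frame := B.holomorphic_frame
  theta_smooth x v σ h := (B.theta_smooth x v σ h).const_smul (c : ℂ)
  dbar_theta x v w σ h := by
    have h1 := B.dbar_leibniz (fun _ => (c : ℂ)) _ x
      (Filter.Eventually.of_forall fun y => contMDiffAt_const) (B.theta_smooth x v σ h) w
    have h0 : dbarFun E (fun _ : S => (c : ℂ)) x w = 0 := by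
      simp only [dbarFun, mfderiv_const]
      change (2⁻¹ : ℂ) • ((0 : ℂ) + Complex.I • (0 : ℂ)) = 0
      simp
    rw [h0, zero_smul, zero_add, B.dbar_theta x v w σ h] at h1
    exact h1
  theta_theta x u v := by
    have h1 := B.theta_theta x u v
    ext z
    have h2 := LinearMap.congr_fun h1 z
    simp only [LinearMap.comp_apply] at h2
    simp [h2]

/-- An isomorphism of Higgs bundles between two Higgs bundle structures on the smooth bundle of
`L`: a smooth bundle automorphism intertwining the operators `∂̄` and the Higgs fields. -/
structure HiggsIso (B B' : HiggsStructure E L) where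
  map : ∀ s, L.Fiber s ≃ₗ[ℂ] L.Fiber s
  smooth : ∀ (σ : L.Sec) (x : S), SmoothNear E (fun s => map s (σ s)) x ↔ SmoothNear E σ x
  map_dbar : ∀ (σ : L.Sec) (x : S), SmoothNear E σ x →
    ∀ w : E, B'.dbar (fun s => map s (σ s)) x w = map x (B.dbar σ x w)
  map_theta : ∀ (x : S) (v : E) (a : L.Fiber x),
    B'.theta x v (map x a) = map x (B.theta x v a)

/-- The Higgs bundle structure `∂̄ + θ` is the one obtained from the complex variation `C`: in the
decomposition `∇ = τ + ∂̄ + ∂ + θ`, on sections of `U^p` the operators `∂̄` and `∂` take values in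
`U^p`, while `τ = ∇^{0,1} - ∂̄` takes values in `U^{p+1}` and `θ = ∇^{1,0} - ∂` in `U^{p-1}`. -/
structure ComplexVHS.Induces (C : ComplexVHS E L) (B : HiggsStructure E L) : Prop where
  dbar_mem : ∀ (p : ℤ) (x : S) (σ : L.Sec), SmoothNear E σ x → (∀ᶠ y in 𝓝 x, σ y ∈ C.U p y) →
    ∀ w : E, B.dbar σ x w ∈ C.U p x
  tau_mem : ∀ (p : ℤ) (x : S) (σ : L.Sec), SmoothNear E σ x → (∀ᶠ y in 𝓝 x, σ y ∈ C.U p y) →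
    ∀ w : E, nabla01 E σ x w - B.dbar σ x w ∈ C.U (p + 1) x
  theta_mem : ∀ (p : ℤ) (x : S), ∀ a ∈ C.U p x, ∀ v : E, B.theta x v a ∈ C.U (p - 1) x
  del_mem : ∀ (p : ℤ) (x : S) (σ : L.Sec), SmoothNear E σ x → (∀ᶠ y in 𝓝 x, σ y ∈ C.U p y) →
    ∀ v : E, nabla10 E σ x v - B.theta x v (σ x) ∈ C.U p x

end Bundle

/-! ### Variations of graded-polarized mixed Hodge structure -/

/-- A variation of graded-polarized mixed Hodge structure over the complex manifold `S`. -/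
structure VGPMHS (E : Type*) [NormedAddCommGroup E] [NormedSpace ℂ E]
    (S : Type u) [TopologicalSpace S] [ChartedSpace E S] where
  /-- The rational local system. -/
  V : LocalSystem.{u, w} ℚ S
  /-- The weight filtration. -/
  W : ∀ s, ℤ → Submodule ℚ (V.Fiber s)
  /-- The Hodge filtration. -/
  F : ∀ s, ℤ → Submodule ℂ (ℂ ⊗[ℚ] V.Fiber s)
  /-- The graded polarizations. -/
  Q : ∀ s (k : ℤ), LinearMap.BilinForm ℚ (Gr (W s) k)
  /-- Each `W_k` is a local subsystem. -/
  W_flat : ∀ (x : S) (k : ℤ), ∀ᶠ y in 𝓝 x,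
    (W y k).map (V.triv x y) = (W x k).map (V.triv x x)
  /-- Each `F^p` is a holomorphic subbundle. -/
  F_hol : ∀ p : ℤ, IsHolSubbundle E (L := V.complexify) (fun s => F s p)
  /-- Each polarization is flat, that is, constant on pairs of flat local sections of `W_k`. -/
  Q_flat : ∀ (k : ℤ) (x : S) (a b : ∀ s, W s k),
    (∀ᶠ y in 𝓝 x, V.triv x y (a y) = V.triv x x (a x)) →
    (∀ᶠ y in 𝓝 x, V.triv x y (b y) = V.triv x x (b x)) →
    ∀ᶠ y in 𝓝 x, Q y k (Submodule.Quotient.mk (a y)) (Submodule.Quotient.mk (b y)) =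
      Q x k (Submodule.Quotient.mk (a x)) (Submodule.Quotient.mk (b x))
  /-- Griffiths transversality `∇ F^p ⊆ Ω¹ ⊗ F^{p-1}`; it passes to the graded pieces. -/
  transversal : ∀ (p : ℤ) (x : S) (σ : V.complexify.Sec), HolNear E σ x →
    (∀ᶠ y in 𝓝 x, σ y ∈ F y p) → ∀ v : E, nabla E σ x v ∈ F x (p - 1)
  /-- Each fibre is a mixed Hodge structure. -/
  mixed : ∀ s, IsMixedHodge (F s) (W s)
  /-- The pure Hodge structure on each graded piece is polarized. -/
  polarized : ∀ s (k : ℤ), IsPolarization k (grF (F s) (W s) k) (Q s k)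
  /-- `F^p Gr_k` is a holomorphic subbundle of `Gr_k ⊗ 𝒪`: it has local frames which are the
  classes of holomorphic sections of `W_k ⊗ 𝒪`. -/
  grF_hol : ∀ (k p : ℤ) (x : S), ∃ (m : ℕ) (f : Fin m → ∀ s, ℂ ⊗[ℚ] W s k),
    (∀ j, HolNear E (L := V.complexify) (fun s => inclC (W s) k (f j s)) x) ∧
    ∀ᶠ y in 𝓝 x, LinearIndependent ℂ (fun j => projC (W y) k (f j y)) ∧
      Submodule.span ℂ (Set.range fun j => projC (W y) k (f j y)) = grF (F y) (W y) k p

end MHS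

end

noncomputable section

namespace MHS

universe u w

/-! ### Bigradings from opposed filtrations -/

section Filtrations

variable {K V : Type*} [Field K] [AddCommGroup V] [Module K V]

/-! Fibrewise, everything rests on the filtration `oppF`, Φ_p = Σ_l W_l ∩ conj F^{l-p}. Opposedness
of F and conj F on each Gr^W_k gives, by induction on the weight, that F^{p+1} and Φ_p are
complementary (`IsMixedHodge.isCompl_oppF`). Deligne's formula `bigr` splits W on F^p ∩ Φ_p, so U^p
= ⨁_q I^{p,q} equals F^p ∩ Φ_p (`IsMixedHodge.deligneU_eq`), F^p = U^p ⊕ F^{p+1}, and F^p ∩ Φ_{p+1}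
⊆ U^p ⊕ U^{p+1}. Any other bigrading with Deligne's properties is contained in the one given by the
formula, hence equal to it.

In families, F^p is holomorphic and ∇^{1,0} lowers its index by one. W is flat and conjugation is
flat and exchanges types, so on W_l ∩ conj F^q the operator ∇^{1,0} preserves q and ∇^{0,1} lowers
it by one. Hence ∇^{1,0} preserves Φ_p and ∇^{0,1} sends it to Φ_{p+1}. For a section of U^p, the
(0,1)-derivative lies in F^p ∩ Φ_{p+1} and the (1,0)-derivative in F^{p-1} ∩ Φ_p, which is
horizontality (`VGPMHS.nabla_mem_U`). Smoothness follows from constancy of ranks: the ranks of F^q ∩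
W_k are locally constant because those of the F^q Gr_k are, and the ranks of Φ_p and U^p are then
determined by those of F.

For the Higgs bundle, let Y be the grading operator, equal to p on U^p. Horizontality says that
∇^{1,0}Y = θ and ∇^{0,1}Y = -τ, so that ∂̄ = ∇^{0,1} + ∇^{0,1}Y, and that [Y, ∇^{1,0}Y] = -∇^{1,0}Y
and [Y, ∇^{0,1}Y] = ∇^{0,1}Y. Since ∇ is flat, Y is locally a matrix function and its second
derivatives commute. Differentiating the two relations once more and comparing yields θ ∧ θ = 0 and
∂̄θ = 0 (`del_mul_del_comm`, `delbar_del_add_comm`).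

Holomorphic frames for ∂̄ come from F itself, with no integrability theorem: U^p is isomorphic to
F^p/F^{p+1}, and the projection to U^p of a holomorphic section of F^p is killed by ∂̄
(`VGPMHS.dbarOp_projOp_eq_zero`). Finally, multiplication by c^{-p} on U^p commutes with ∂̄ and
rescales θ, which has degree -1; this is the isomorphism for the ℂ^*-action. -/

theorem iSupIndep_of_disjoint_iSup_lt {ι κ : Type*} [LinearOrder κ] (key : ι → κ)
    (hkey : Function.Injective key) (B : ι → Submodule K V)
    (h : ∀ i, Disjoint (B i) (⨆ (j : ι) (_ : key j < key i), B j)) : iSupIndep B := by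
  rw [iSupIndep_iff_finsetSum_eq_zero_imp_eq_zero]
  intro s
  induction hn : s.card generalizing s with
  | zero =>
    rw [Finset.card_eq_zero] at hn
    subst hn
    simp
  | succ n ih =>
    classical
    intro v hv h0
    have hne : s.Nonempty := Finset.card_pos.mp (by omega)
    -- In a vanishing sum the term of largest key is minus a sum of terms of smaller key, so it is
    -- zero by hypothesis; remove it and induct on the number of terms.
    obtain ⟨i, hi, hmax⟩ := s.exists_max_image key hne
    have hsum : v i + ∑ j ∈ s.erase i, v j = 0 := by rw [Finset.add_sum_erase s v hi, h0]
    have hlt : ∑ j ∈ s.erase i, v j ∈ ⨆ (j : ι) (_ : key j < key i), B j := by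
      refine Submodule.sum_mem _ fun j hj => ?_
      have hj' := Finset.mem_erase.mp hj
      have hjlt : key j < key i := lt_of_le_of_ne (hmax j hj'.2) fun e => hj'.1 (hkey e)
      exact Submodule.mem_iSup_of_mem j (Submodule.mem_iSup_of_mem hjlt (hv j hj'.2))
    have hvi : v i = 0 := by
      refine Submodule.disjoint_def.mp (h i) _ (hv i hi) ?_
      rw [eq_neg_of_add_eq_zero_left hsum]
      exact Submodule.neg_mem _ hlt
    have hrest := ih (s.erase i) (by rw [Finset.card_erase_of_mem hi]; omega) v
      (fun j hj => hv j (Finset.mem_of_mem_erase hj)) (by simpa [hvi] using hsum)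
    intro j hj
    by_cases hji : j = i
    · rw [hji, hvi]
    · exact hrest j (Finset.mem_erase.mpr ⟨hji, hj⟩)

/-- Serves for induction on the weight: below some index the weight filtration vanishes, which is
the base case. -/
theorem int_le_induction_of_monotone {P : ℤ → Prop} {a : ℤ} (h0 : ∀ k ≤ a, P k)
    (hs : ∀ k, P (k - 1) → P k) (k : ℤ) : P k := by
  rcases le_total k a with h | h
  · exact h0 k h
  · exact Int.leInduction (h0 a le_rfl) (fun n _ hn => hs (n + 1) (by simpa using hn)) k h

theorem int_ge_induction_of_antitone {P : ℤ → Prop} {a : ℤ} (h0 : ∀ k ≥ a, P k)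
    (hs : ∀ k, P (k + 1) → P k) (k : ℤ) : P k := by
  rcases le_total a k with h | h
  · exact h0 k h
  · exact Int.leInductionDown (h0 a le_rfl)
      (fun n _ hn => hs (n - 1) (by simpa using hn)) k h

/-- Two finite decreasing filtrations `F`, `G` which induce on the graded pieces of an increasing
filtration `W` two opposed filtrations. -/
structure MixedOpposed (W F G : ℤ → Submodule K V) : Prop where
  W_mono : Monotone W
  W_top : ∃ k, W k = ⊤
  W_bot : ∃ k, W k = ⊥
  F_anti : Antitone F
  F_top : ∃ p, F p = ⊤
  F_bot : ∃ p, F p = ⊥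
  G_anti : Antitone G
  cover : ∀ k p, W k ≤ (F p ⊓ W k) ⊔ (G (k + 1 - p) ⊓ W k) ⊔ W (k - 1)
  inter : ∀ k p, ∀ a ∈ F p ⊓ W k, ∀ b ∈ G (k + 1 - p) ⊓ W k, a - b ∈ W (k - 1) → a ∈ W (k - 1)

/-- The increasing filtration in `p` given by the sum of the `W_l ∩ G^{l-p}`, `l ≤ k`. -/
def oppFil (W G : ℤ → Submodule K V) (k p : ℤ) : Submodule K V :=
  ⨆ (l : ℤ) (_ : l ≤ k), W l ⊓ G (l - p)

/-- Deligne's formula for the bigrading. -/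
def bigr (W F G : ℤ → Submodule K V) (p q : ℤ) : Submodule K V :=
  F p ⊓ W (p + q) ⊓ ((G q ⊓ W (p + q)) ⊔ oppFil W G (p + q - 2) (p - 1))

variable {W F G : ℤ → Submodule K V}

theorem le_oppFil {l k p : ℤ} (h : l ≤ k) : W l ⊓ G (l - p) ≤ oppFil W G k p :=
  le_iSup₂_of_le l h le_rfl

theorem oppFil_mono_left {k k' p : ℤ} (h : k ≤ k') : oppFil W G k p ≤ oppFil W G k' p :=
  iSup₂_le fun _ hl => le_oppFil (hl.trans h)

theorem oppFil_mono_right (hG : Antitone G) {k p p' : ℤ} (h : p ≤ p') :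
    oppFil W G k p ≤ oppFil W G k p' :=
  iSup₂_le fun l hl => le_trans (inf_le_inf_left _ (hG (by omega))) (le_oppFil (l := l) hl)

theorem oppFil_le (hW : Monotone W) (k p : ℤ) : oppFil W G k p ≤ W k :=
  iSup₂_le fun _ hl => inf_le_left.trans (hW hl)

theorem oppFil_succ (W G : ℤ → Submodule K V) (k p : ℤ) :
    oppFil W G k p = (W k ⊓ G (k - p)) ⊔ oppFil W G (k - 1) p := by
  refine le_antisymm (iSup₂_le fun l hl => ?_)
    (sup_le (le_oppFil le_rfl) (oppFil_mono_left (by omega)))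
  rcases eq_or_lt_of_le hl with rfl | h
  · exact le_sup_left
  · exact le_sup_of_le_right (le_oppFil (by omega))

/-! ### Splittings of F and W obtained from opposedness on the graded pieces -/

namespace MixedOpposed

/-- Induction on k. The covering property at index p + 1 involves G^{k+1-(p+1)} = G^{k-p}, which is
exactly the top summand l = k of `oppFil`; the remainder lies in W_{k-1}. -/
theorem sup_eq (h : MixedOpposed W F G) (p k : ℤ) :
    (F (p + 1) ⊓ W k) ⊔ oppFil W G k p = W k := by
  refine le_antisymm (sup_le inf_le_right (oppFil_le h.W_mono k p)) ?_
  obtain ⟨a, ha⟩ := h.W_bot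
  refine int_le_induction_of_monotone (a := a)
    (P := fun k => W k ≤ (F (p + 1) ⊓ W k) ⊔ oppFil W G k p) (fun k hk => ?_)
    (fun k ih => ?_) k
  · exact (h.W_mono hk).trans (ha.le.trans bot_le)
  · refine (h.cover k (p + 1)).trans (sup_le (sup_le le_sup_left ?_) (ih.trans ?_))
    · rw [inf_comm, show k + 1 - (p + 1) = k - p by ring]
      exact le_sup_of_le_right (le_oppFil le_rfl)
    · exact sup_le_sup (inf_le_inf_left _ (h.W_mono (by omega))) (oppFil_mono_left (by omega))

/-- A common element x agrees modulo W_{k-1} with some b in W_k ∩ G^{k-p}. Opposedness on Gr_k puts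
x, hence b, in W_{k-1}, and G^{k-p} ⊆ G^{k-1-p} makes b an admissible summand for k - 1. Descending
in k ends in zero. -/
theorem inf_eq (h : MixedOpposed W F G) (p k : ℤ) : F (p + 1) ⊓ oppFil W G k p = ⊥ := by
  rw [eq_bot_iff]
  obtain ⟨a, ha⟩ := h.W_bot
  refine int_le_induction_of_monotone (a := a)
    (P := fun k => F (p + 1) ⊓ oppFil W G k p ≤ ⊥) (fun k hk => ?_) (fun k ih => ?_) k
  · exact inf_le_right.trans ((oppFil_le h.W_mono k p).trans ((h.W_mono hk).trans ha.le))
  · refine le_trans ?_ ih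
    rintro x ⟨hxF, hxP⟩
    refine ⟨hxF, ?_⟩
    have hxW := oppFil_le h.W_mono k p hxP
    rw [oppFil_succ] at hxP
    obtain ⟨b, hb, c, hc, rfl⟩ := Submodule.mem_sup.mp hxP
    have hcW := oppFil_le h.W_mono (k - 1) p hc
    have hb' : b ∈ G (k + 1 - (p + 1)) ⊓ W k :=
      ⟨by rw [show k + 1 - (p + 1) = k - p by ring]; exact hb.2, hb.1⟩
    have hx1 : b + c ∈ W (k - 1) := h.inter k (p + 1) _ ⟨hxF, hxW⟩ b hb' (by simpa using hcW)
    have hb1 : b ∈ W (k - 1) := by simpa using Submodule.sub_mem _ hx1 hcW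
    exact Submodule.add_mem _ (le_oppFil (l := k - 1) le_rfl ⟨hb1, h.G_anti (by omega) hb.2⟩) hc

/-- Strictness with respect to W: an element of W_k splits along F^{p+1} and `oppFil` inside W_k,
and its F-component lies in F^{p+1} ∩ `oppFil W G k' p` = 0. -/
theorem oppFil_inf (h : MixedOpposed W F G) {k k' : ℤ} (hk : k ≤ k') (p : ℤ) :
    oppFil W G k' p ⊓ W k = oppFil W G k p := by
  refine le_antisymm ?_ (le_inf (oppFil_mono_left hk) (oppFil_le h.W_mono k p))
  rintro x ⟨hx, hxW⟩
  rw [SetLike.mem_coe, ← h.sup_eq p k] at hxW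
  obtain ⟨f, hf, g, hg, rfl⟩ := Submodule.mem_sup.mp hxW
  have hf' : f ∈ F (p + 1) ⊓ oppFil W G k' p :=
    ⟨hf.1, by simpa using Submodule.sub_mem _ hx (oppFil_mono_left hk hg)⟩
  rw [h.inf_eq, Submodule.mem_bot] at hf'
  simpa [hf'] using hg

theorem bigr_le_oppFil (h : MixedOpposed W F G) (p q : ℤ) :
    bigr W F G p q ≤ oppFil W G (p + q) p := by
  refine inf_le_right.trans (sup_le ?_ ?_)
  · rw [inf_comm]
    exact le_trans (by rw [show p + q - p = q by ring]) (le_oppFil (l := p + q) (p := p) le_rfl)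
  · exact (oppFil_mono_left (by omega)).trans (oppFil_mono_right h.G_anti (by omega))

/-- The shift p - 1 in the correction term of Deligne's formula is made for this. If the element has
weight at most p + q - 1, so does its leading part b in G^q, and q = (p + q - 1) - (p - 1). The
whole element then lies in `oppFil W G (p + q - 1) (p - 1)`, which meets F^p trivially. -/
theorem bigr_inf (h : MixedOpposed W F G) (p q : ℤ) :
    bigr W F G p q ⊓ W (p + q - 1) = ⊥ := by
  rw [eq_bot_iff, ← h.inf_eq (p - 1) (p + q - 1)]
  rintro x ⟨⟨⟨hxF, -⟩, hx⟩, hxW⟩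
  refine ⟨by simpa using hxF, ?_⟩
  obtain ⟨b, hb, c, hc, rfl⟩ := Submodule.mem_sup.mp hx
  have hcW := h.W_mono (by omega : p + q - 2 ≤ p + q - 1) (oppFil_le h.W_mono _ _ hc)
  have hb1 : b ∈ W (p + q - 1) := by simpa using Submodule.sub_mem _ hxW hcW
  refine Submodule.add_mem _ (le_oppFil (l := p + q - 1) le_rfl ⟨hb1, ?_⟩)
    (oppFil_mono_left (by omega) hc)
  rw [show p + q - 1 - (p - 1) = q by ring]
  exact hb.1

/-- So `bigr W F G p q` maps onto the weight p + q graded piece of F^p ∩ Φ_p. Given a = b + c with c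
of lower weight, split c = f + g along F^p and Φ_{p-1} in W_{p+q-1}. Subtracting f keeps a in F^p
and leaves b + g, which has the shape demanded by Deligne's formula. -/
theorem bigr_sup (h : MixedOpposed W F G) (p q : ℤ) :
    bigr W F G p q ⊔ (F p ⊓ oppFil W G (p + q - 1) p) = F p ⊓ oppFil W G (p + q) p := by
  refine le_antisymm (sup_le (le_inf (inf_le_left.trans inf_le_left) (h.bigr_le_oppFil p q))
    (inf_le_inf_left _ (oppFil_mono_left (by omega)))) ?_
  rintro a ⟨haF, ha⟩
  have haW := oppFil_le h.W_mono _ _ ha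
  have ha' := ha
  rw [SetLike.mem_coe, oppFil_succ] at ha'
  obtain ⟨b, hb, c, hc, hbc⟩ := Submodule.mem_sup.mp ha'
  have hcW := oppFil_le h.W_mono _ _ hc
  rw [← h.sup_eq (p - 1) (p + q - 1)] at hcW
  obtain ⟨f, hf, g, hg, hfg⟩ := Submodule.mem_sup.mp hcW
  rw [sub_add_cancel] at hf
  rw [oppFil_succ] at hg
  obtain ⟨g1, hg1, g2, hg2, hgg⟩ := Submodule.mem_sup.mp hg
  have hI : a - f ∈ bigr W F G p q := by
    refine ⟨⟨Submodule.sub_mem _ haF hf.1,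
      Submodule.sub_mem _ haW (h.W_mono (by omega) hf.2)⟩, ?_⟩
    have e : a - f = (b + g1) + g2 := by rw [← hbc, ← hfg, ← hgg]; abel
    -- The part g1 of g of weight p + q - 1 lies in G^q and joins b; only g2, of weight at most p +
    -- q - 2, is left for the correction term.
    rw [SetLike.mem_coe, e]
    refine Submodule.add_mem_sup (Submodule.add_mem _ ⟨?_, hb.1⟩ ⟨?_, ?_⟩) ?_
    · simpa using hb.2
    · have := hg1.2
      rwa [show p + q - 1 - (p - 1) = q by ring] at this
    · exact h.W_mono (by omega) hg1.1
    · rwa [show p + q - 1 - 1 = p + q - 2 by ring] at hg2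
  have hfP : f ∈ oppFil W G (p + q - 1) p := by
    rw [← h.oppFil_inf (show p + q - 1 ≤ p + q by omega)]
    refine ⟨?_, hf.2⟩
    simpa using Submodule.sub_mem _ ha (h.bigr_le_oppFil p q hI)
  have hfU : f ∈ F p ⊓ oppFil W G (p + q - 1) p := ⟨hf.1, hfP⟩
  simpa using Submodule.add_mem_sup hI hfU

theorem inf_oppFil_eq_iSup (h : MixedOpposed W F G) (p k : ℤ) :
    F p ⊓ oppFil W G k p = ⨆ (q : ℤ) (_ : p + q ≤ k), bigr W F G p q := by
  refine le_antisymm ?_ (iSup₂_le fun q hq => le_inf (inf_le_left.trans inf_le_left)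
    ((h.bigr_le_oppFil p q).trans (oppFil_mono_left hq)))
  obtain ⟨a, ha⟩ := h.W_bot
  refine int_le_induction_of_monotone (a := a)
    (P := fun k => F p ⊓ oppFil W G k p ≤ ⨆ (q : ℤ) (_ : p + q ≤ k), bigr W F G p q)
    (fun k hk => ?_) (fun k ih => ?_) k
  · exact inf_le_right.trans ((oppFil_le h.W_mono k p).trans
      ((h.W_mono hk).trans (ha.le.trans bot_le)))
  · have e := h.bigr_sup p (k - p)
    rw [show p + (k - p) = k by ring] at e
    rw [← e]
    refine sup_le (le_iSup₂_of_le (k - p) (by omega) le_rfl) (ih.trans ?_)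
    exact iSup₂_le fun q hq => le_iSup₂_of_le q (by omega) le_rfl

/-- The complement F^{p+1} of Φ_p is contained in F^p, so the splitting of W_k restricts to F^p by
the modular law. -/
theorem F_inf_W_succ (h : MixedOpposed W F G) (p k : ℤ) :
    F p ⊓ W k = (F p ⊓ oppFil W G k p) ⊔ (F (p + 1) ⊓ W k) := by
  have hF := h.F_anti (show p ≤ p + 1 by omega)
  refine le_antisymm ?_ (sup_le (inf_le_inf_left _ (oppFil_le h.W_mono k p))
    (inf_le_inf_right _ hF))
  rintro x ⟨hxF, hxW⟩
  rw [SetLike.mem_coe, ← h.sup_eq p k] at hxW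
  obtain ⟨f, hf, g, hg, rfl⟩ := Submodule.mem_sup.mp hxW
  have hgF : g ∈ F p := by simpa using Submodule.sub_mem _ hxF (hF hf.1)
  have hgU : g ∈ F p ⊓ oppFil W G k p := ⟨hgF, hg⟩
  exact Submodule.mem_sup.mpr ⟨g, hgU, f, hf, add_comm _ _⟩

theorem F_inf_W_eq_iSup (h : MixedOpposed W F G) (p k : ℤ) :
    F p ⊓ W k = ⨆ (r : ℤ) (_ : p ≤ r) (s : ℤ) (_ : r + s ≤ k), bigr W F G r s := by
  refine le_antisymm ?_ ?_
  · obtain ⟨b, hb⟩ := h.F_bot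
    refine int_ge_induction_of_antitone (a := b) (P := fun p => F p ⊓ W k ≤
      ⨆ (r : ℤ) (_ : p ≤ r) (s : ℤ) (_ : r + s ≤ k), bigr W F G r s)
      (fun p hp => ?_) (fun p ih => ?_) p
    · exact inf_le_left.trans ((h.F_anti hp).trans (hb.le.trans bot_le))
    · rw [h.F_inf_W_succ, h.inf_oppFil_eq_iSup]
      exact sup_le (le_iSup₂_of_le p le_rfl le_rfl)
        (ih.trans (iSup₂_le fun r hr => le_iSup₂_of_le r (by omega) le_rfl))
  · refine iSup₂_le fun r hr => iSup₂_le fun s hs => le_inf ?_ ?_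
    · exact (inf_le_left.trans inf_le_left).trans (h.F_anti hr)
    · exact (inf_le_left.trans inf_le_right).trans (h.W_mono hs)

theorem W_eq_iSup (h : MixedOpposed W F G) (k : ℤ) :
    W k = ⨆ (r : ℤ) (s : ℤ) (_ : r + s ≤ k), bigr W F G r s := by
  refine le_antisymm ?_ (iSup_le fun r => iSup₂_le fun s hs =>
    (inf_le_left.trans inf_le_right).trans (h.W_mono hs))
  obtain ⟨a, ha⟩ := h.F_top
  calc W k = F a ⊓ W k := by rw [ha, top_inf_eq]
    _ ≤ _ := by
      rw [h.F_inf_W_eq_iSup]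
      exact iSup_mono fun r => iSup_le fun _ => le_rfl

theorem F_eq_iSup (h : MixedOpposed W F G) (p : ℤ) :
    F p = ⨆ (r : ℤ) (_ : p ≤ r) (s : ℤ), bigr W F G r s := by
  refine le_antisymm ?_ (iSup₂_le fun r hr => iSup_le fun s =>
    (inf_le_left.trans inf_le_left).trans (h.F_anti hr))
  obtain ⟨a, ha⟩ := h.W_top
  calc F p = F p ⊓ W a := by rw [ha, inf_top_eq]
    _ ≤ _ := by
      rw [h.F_inf_W_eq_iSup]
      exact iSup₂_mono fun r _ => iSup_mono fun s => iSup_le fun _ => le_rfl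

/-- Order the indices lexicographically by (-p, q). The pieces preceding I^{p,q} lie in F^{p+1}, or
in F^p ∩ Φ_p with weight below p + q. If x in I^{p,q} equals f + u accordingly, then f lies in
F^{p+1} ∩ Φ_p = 0, and u lies in I^{p,q} ∩ W_{p+q-1} = 0. -/
theorem iSupIndep_bigr (h : MixedOpposed W F G) :
    iSupIndep fun a : ℤ × ℤ => bigr W F G a.1 a.2 := by
  refine iSupIndep_of_disjoint_iSup_lt (κ := ℤ ×ₗ ℤ) (fun a => toLex (-a.1, a.2))
    (fun a b hab => ?_) _ fun i => ?_
  · have := toLex.injective hab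
    simp only [Prod.mk.injEq, neg_inj] at this
    exact Prod.ext this.1 this.2
  · obtain ⟨p, q⟩ := i
    have hle : (⨆ (j : ℤ × ℤ) (_ : toLex (-j.1, j.2) < toLex (-p, q)), bigr W F G j.1 j.2) ≤
        F (p + 1) ⊔ (F p ⊓ oppFil W G (p + q - 1) p) := by
      refine iSup₂_le fun j hj => ?_
      rw [Prod.Lex.toLex_lt_toLex] at hj
      rcases hj with hj | ⟨h1, h2⟩
      · exact le_sup_of_le_left ((inf_le_left.trans inf_le_left).trans
          (h.F_anti (by dsimp at hj; omega)))
      · obtain ⟨r, s⟩ := j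
        have hr : r = p := by simpa using h1
        subst hr
        refine le_sup_of_le_right (le_inf (inf_le_left.trans inf_le_left)
          ((h.bigr_le_oppFil r s).trans (oppFil_mono_left ?_)))
        dsimp at h2
        omega
    refine Disjoint.mono_right hle (Submodule.disjoint_def.mpr fun x hx hx' => ?_)
    obtain ⟨f, hf, u, hu, rfl⟩ := Submodule.mem_sup.mp hx'
    have hf0 : f ∈ F (p + 1) ⊓ oppFil W G (p + q) p := by
      refine ⟨hf, ?_⟩
      simpa using Submodule.sub_mem _ (h.bigr_le_oppFil p q hx)
        (oppFil_mono_left (show p + q - 1 ≤ p + q by omega) hu.2)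
    rw [h.inf_eq, Submodule.mem_bot] at hf0
    rw [hf0, zero_add] at hx ⊢
    have : u ∈ bigr W F G p q ⊓ W (p + q - 1) := ⟨hx, oppFil_le h.W_mono _ _ hu.2⟩
    rwa [h.bigr_inf, Submodule.mem_bot] at this

theorem iSup_bigr (h : MixedOpposed W F G) :
    ⨆ a : ℤ × ℤ, bigr W F G a.1 a.2 = ⊤ := by
  obtain ⟨k, hk⟩ := h.W_top
  rw [eq_top_iff, ← hk, h.W_eq_iSup k]
  exact iSup_le fun r => iSup₂_le fun s _ => le_iSup_of_le (r, s) le_rfl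

theorem iSup_bigr_left (h : MixedOpposed W F G) {k : ℤ} (hk : W k = ⊤) (p : ℤ) :
    ⨆ q : ℤ, bigr W F G p q = F p ⊓ oppFil W G k p := by
  refine le_antisymm (iSup_le fun q => ?_) ?_
  · refine le_inf (inf_le_left.trans inf_le_left) ((h.bigr_le_oppFil p q).trans ?_)
    rcases le_total (p + q) k with hq | hq
    · exact oppFil_mono_left hq
    · rw [← h.oppFil_inf hq, hk, inf_top_eq]
  · rw [h.inf_oppFil_eq_iSup]
    exact iSup_mono fun q => iSup_le fun _ => le_rfl

end MixedOpposed

/-- Reduces uniqueness of the bigrading to termwise inclusion: a family that already spans leaves no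
room for a larger independent one. -/
theorem eq_of_le_of_iSupIndep {ι : Type*} {A B : ι → Submodule K V} (hAB : ∀ i, A i ≤ B i)
    (hA : ⨆ i, A i = ⊤) (hB : iSupIndep B) : A = B := by
  funext i
  refine le_antisymm (hAB i) ?_
  have h1 : (⊤ : Submodule K V) ≤ A i ⊔ ⨆ (j : ι) (_ : j ≠ i), B j := by
    rw [← hA]
    refine iSup_le fun j => ?_
    by_cases hj : j = i
    · subst hj
      exact le_sup_left
    · exact le_sup_of_le_right ((hAB j).trans (le_iSup₂_of_le j hj le_rfl))
  intro x hx
  obtain ⟨a, ha, b, hb, rfl⟩ := Submodule.mem_sup.mp (h1 (Submodule.mem_top (x := x)))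
  have hbi : b ∈ B i := by simpa using Submodule.sub_mem _ hx (hAB i ha)
  have hb0 := Submodule.disjoint_def.mp (hB i) b hbi hb
  simpa [hb0] using ha

end Filtrations

/-! ### The Deligne bigrading of a mixed Hodge structure -/

section Deligne

variable {H : Type*} [AddCommGroup H] [Module ℚ H]

@[simp]
theorem conjC_tmul (z : ℂ) (h : H) : conjC H (z ⊗ₜ[ℚ] h) = (starRingEnd ℂ z) ⊗ₜ[ℚ] h := rfl

@[simp]
theorem conjC_conjC (v : ℂ ⊗[ℚ] H) : conjC H (conjC H v) = v := by
  induction v using TensorProduct.induction_on with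
  | zero => simp
  | tmul z h => simp
  | add a b ha hb => rw [map_add, map_add, ha, hb]

theorem conjC_baseChange {H' : Type*} [AddCommGroup H'] [Module ℚ H'] (f : H →ₗ[ℚ] H')
    (v : ℂ ⊗[ℚ] H) : conjC H' (f.baseChange ℂ v) = f.baseChange ℂ (conjC H v) := by
  induction v using TensorProduct.induction_on with
  | zero => simp
  | tmul z h => simp
  | add a b ha hb => simp only [map_add, ha, hb]

theorem mem_conjSub {A : Submodule ℂ (ℂ ⊗[ℚ] H)} {v : ℂ ⊗[ℚ] H} :
    v ∈ conjSub A ↔ conjC H v ∈ A := by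
  constructor
  · rintro ⟨a, ha, rfl⟩
    simpa using ha
  · intro h
    exact ⟨_, h, conjC_conjC v⟩

theorem conjC_mem_conjSub {A : Submodule ℂ (ℂ ⊗[ℚ] H)} {v : ℂ ⊗[ℚ] H} :
    conjC H v ∈ conjSub A ↔ v ∈ A := by
  rw [mem_conjSub, conjC_conjC]

@[simp]
theorem conjSub_conjSub (A : Submodule ℂ (ℂ ⊗[ℚ] H)) : conjSub (conjSub A) = A := by
  ext v
  rw [mem_conjSub, mem_conjSub, conjC_conjC]

theorem conjSub_mono {A B : Submodule ℂ (ℂ ⊗[ℚ] H)} (h : A ≤ B) : conjSub A ≤ conjSub B :=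
  Submodule.map_mono h

theorem conjSub_inf (A B : Submodule ℂ (ℂ ⊗[ℚ] H)) :
    conjSub (A ⊓ B) = conjSub A ⊓ conjSub B := by
  ext v
  simp only [mem_conjSub, Submodule.mem_inf]

theorem conjSub_sup (A B : Submodule ℂ (ℂ ⊗[ℚ] H)) :
    conjSub (A ⊔ B) = conjSub A ⊔ conjSub B :=
  Submodule.map_sup _ _ _

theorem conjSub_iSup {ι : Sort*} (A : ι → Submodule ℂ (ℂ ⊗[ℚ] H)) :
    conjSub (⨆ i, A i) = ⨆ i, conjSub (A i) :=
  Submodule.map_iSup _ _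

theorem baseChange_eq_range (A : Submodule ℚ H) :
    A.baseChange ℂ = LinearMap.range (A.subtype.baseChange ℂ) := rfl

theorem conjSub_baseChange (A : Submodule ℚ H) :
    conjSub (A.baseChange ℂ) = A.baseChange ℂ := by
  have h : conjSub (A.baseChange ℂ) ≤ A.baseChange ℂ := by
    intro v hv
    rw [mem_conjSub, baseChange_eq_range] at hv
    obtain ⟨t, ht⟩ := hv
    rw [baseChange_eq_range, ← conjC_conjC v, ← ht, conjC_baseChange]
    exact LinearMap.mem_range_self _ _
  exact le_antisymm h (by simpa using conjSub_mono h)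

theorem range_inclC (W : ℤ → Submodule ℚ H) (k : ℤ) :
    LinearMap.range (inclC W k) = (W k).baseChange ℂ :=
  (baseChange_eq_range _).symm

theorem inclC_injective (W : ℤ → Submodule ℚ H) (k : ℤ) : Function.Injective (inclC W k) :=
  Module.Flat.lTensor_preserves_injective_linearMap (M := ℂ) _ (W k).injective_subtype

/-- Tensoring 0 → W_{k-1} → W_k → Gr_k → 0 with ℂ stays exact. This is how statements on Gr_k are
lifted to ℂ ⊗ H. -/
theorem projC_eq_zero_iff {W : ℤ → Submodule ℚ H} (hW : Monotone W) (k : ℤ) (t : ℂ ⊗[ℚ] W k) :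
    projC W k t = 0 ↔ inclC W k t ∈ (W (k - 1)).baseChange ℂ := by
  set N : Submodule ℚ (W k) := (W (k - 1)).submoduleOf (W k)
  have hex : Function.Exact (N.subtype.lTensor ℂ) (N.mkQ.lTensor ℂ) :=
    lTensor_exact ℂ (LinearMap.exact_subtype_mkQ N) (Submodule.mkQ_surjective _)
  have hk : W (k - 1) ≤ W k := hW (by omega)
  have h1 : projC W k t = 0 ↔ t ∈ Set.range (N.subtype.lTensor ℂ) := hex t
  rw [h1]
  constructor
  · rintro ⟨u, rfl⟩
    let g : N →ₗ[ℚ] W (k - 1) :=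
      LinearMap.codRestrict _ ((W k).subtype ∘ₗ N.subtype) fun n => n.2
    have e : (W k).subtype ∘ₗ N.subtype = (W (k - 1)).subtype ∘ₗ g := rfl
    rw [baseChange_eq_range]
    refine ⟨g.baseChange ℂ u, ?_⟩
    have h2 := congrArg (fun f : N →ₗ[ℚ] H => f.baseChange ℂ u) e
    simp only [LinearMap.baseChange_comp, LinearMap.comp_apply] at h2
    exact h2.symm
  · intro ht
    rw [baseChange_eq_range] at ht
    obtain ⟨u, hu⟩ := ht
    let g : W (k - 1) →ₗ[ℚ] N :=
      LinearMap.codRestrict _ (Submodule.inclusion hk) fun n => n.2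
    have e : (W k).subtype ∘ₗ N.subtype ∘ₗ g = (W (k - 1)).subtype := rfl
    refine ⟨g.lTensor ℂ u, inclC_injective W k ?_⟩
    rw [← hu, ← e, LinearMap.baseChange_comp, LinearMap.baseChange_comp]
    rfl

/-- The complexified weight filtration. -/
abbrev WC (W : ℤ → Submodule ℚ H) (k : ℤ) : Submodule ℂ (ℂ ⊗[ℚ] H) := (W k).baseChange ℂ

/-- The conjugate Hodge filtration. -/
abbrev conjF (F : ℤ → Submodule ℂ (ℂ ⊗[ℚ] H)) (p : ℤ) : Submodule ℂ (ℂ ⊗[ℚ] H) := conjSub (F p)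

variable {F : ℤ → Submodule ℂ (ℂ ⊗[ℚ] H)} {W : ℤ → Submodule ℚ H}

/-- Lifts the decomposition Gr_k = F^p ⊕ conj F^{k+1-p} to W_k modulo W_{k-1}. Conjugation commutes
with inclusion and projection because both are defined over ℚ. -/
theorem IsMixedHodge.mixedOpposed (h : IsMixedHodge F W) :
    MixedOpposed (WC W) F (conjF F) where
  W_mono k l hkl := Submodule.baseChange_mono _ (h.W_monotone hkl)
  W_top := by
    obtain ⟨k, hk⟩ := h.W_exhaustive
    exact ⟨k, by rw [WC, hk, Submodule.baseChange_top]⟩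
  W_bot := by
    obtain ⟨k, hk⟩ := h.W_separated
    exact ⟨k, by rw [WC, hk, Submodule.baseChange_bot]⟩
  F_anti := h.F_antitone
  F_top := h.F_exhaustive
  F_bot := h.F_separated
  G_anti p q hpq := conjSub_mono (h.F_antitone hpq)
  cover k p := by
    intro w hw
    rw [WC, ← range_inclC] at hw
    obtain ⟨t, rfl⟩ := hw
    have hc := (h.pure_gr k).opposed p
    have ht : projC W k t ∈ grF F W k p ⊔ conjSub (grF F W k (k + 1 - p)) := by
      rw [hc.sup_eq_top]
      trivial
    obtain ⟨u, hu, u', hu', e⟩ := Submodule.mem_sup.mp ht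
    obtain ⟨a, ha, rfl⟩ := hu
    rw [mem_conjSub] at hu'
    obtain ⟨b, hb, hbu⟩ := hu'
    have hbu' : u' = projC W k (conjC _ b) := by
      rw [← conjC_conjC u', ← hbu]
      exact conjC_baseChange _ _
    have h0 : projC W k (t - a - conjC _ b) = 0 := by
      rw [map_sub, map_sub, ← e, hbu']
      abel
    rw [projC_eq_zero_iff h.W_monotone] at h0
    have hmem : ∀ s, inclC W k s ∈ WC W k := fun s => by
      rw [WC, ← range_inclC]
      exact LinearMap.mem_range_self _ _
    have hb' : inclC W k (conjC _ b) ∈ conjF F (k + 1 - p) ⊓ WC W k := by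
      refine ⟨?_, hmem _⟩
      rw [SetLike.mem_coe, conjF, mem_conjSub]
      have : conjC H (inclC W k (conjC _ b)) = inclC W k b := by
        rw [inclC, conjC_baseChange, conjC_conjC]
      rw [this]
      exact hb
    have ha' : inclC W k a ∈ F p ⊓ WC W k := ⟨ha, hmem _⟩
    have := Submodule.add_mem_sup (Submodule.add_mem_sup ha' hb') h0
    rw [← map_add, ← map_add] at this
    convert this using 2
    abel
  inter k p := by
    rintro a ⟨haF, haW⟩ b ⟨hbF, hbW⟩ hab
    rw [SetLike.mem_coe, WC, ← range_inclC] at haW hbW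
    obtain ⟨s, rfl⟩ := haW
    obtain ⟨t, rfl⟩ := hbW
    rw [← map_sub, WC, ← projC_eq_zero_iff h.W_monotone, map_sub, sub_eq_zero] at hab
    rw [WC, ← projC_eq_zero_iff h.W_monotone]
    refine Submodule.disjoint_def.mp ((h.pure_gr k).opposed p).disjoint _ ⟨s, haF, rfl⟩ ?_
    rw [hab, mem_conjSub]
    refine ⟨conjC _ t, ?_, (conjC_baseChange _ _).symm⟩
    have : inclC W k (conjC _ t) = conjC H (inclC W k t) := (conjC_baseChange _ _).symm
    rw [SetLike.mem_coe, Submodule.mem_comap, this]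
    exact mem_conjSub.mp hbF

/-- The Deligne bigrading of a mixed Hodge structure, by Deligne's formula. -/
def deligne (F : ℤ → Submodule ℂ (ℂ ⊗[ℚ] H)) (W : ℤ → Submodule ℚ H) (p q : ℤ) :
    Submodule ℂ (ℂ ⊗[ℚ] H) :=
  bigr (WC W) F (conjF F) p q

theorem conjSub_oppFil_conj (k p : ℤ) :
    conjSub (oppFil (WC W) (conjF F) k p) = ⨆ (l : ℤ) (_ : l ≤ k), WC W l ⊓ F (l - p) := by
  simp only [oppFil, conjSub_iSup, conjSub_inf, WC, conjSub_baseChange, conjF, conjSub_conjSub]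

theorem conjSub_deligne (p q : ℤ) :
    conjSub (deligne F W q p) = conjF F q ⊓ WC W (p + q) ⊓
      ((F p ⊓ WC W (p + q)) ⊔ ⨆ (l : ℤ) (_ : l ≤ p + q - 2), WC W l ⊓ F (l - (q - 1))) := by
  rw [deligne, bigr, conjSub_inf, conjSub_sup, conjSub_oppFil_conj, conjSub_inf, conjSub_inf,
    conjSub_conjSub, conjSub_baseChange, add_comm q p]

/-- Conjugating the formula for I^{q,p} gives a correction term in the W_l ∩ F^{l-q+1}, a sum of
I^{r,s} with r + s ≤ l and r ≥ l - q + 1, hence s < q. The pieces with r ≥ p are absorbed in F^p ∩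
W_{p+q}; the others form the allowed error d. What remains, b - d, lies in F^p and has the shape of
the formula for I^{p,q}. -/
theorem IsMixedHodge.conjSub_deligne_le (h : IsMixedHodge F W) (p q : ℤ) :
    conjSub (deligne F W q p) ≤
      deligne F W p q ⊔ ⨆ (r : ℤ) (_ : r < p) (s : ℤ) (_ : s < q), deligne F W r s := by
  have hm := h.mixedOpposed
  rw [conjSub_deligne]
  have hle : (⨆ (l : ℤ) (_ : l ≤ p + q - 2), WC W l ⊓ F (l - (q - 1))) ≤
      (F p ⊓ WC W (p + q)) ⊔
        ⨆ (r : ℤ) (_ : r < p) (s : ℤ) (_ : s < q ∧ r + s ≤ p + q - 2), deligne F W r s := by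
    refine iSup₂_le fun l hl => ?_
    rw [inf_comm, hm.F_inf_W_eq_iSup]
    refine iSup₂_le fun r hr => iSup₂_le fun s hs => ?_
    by_cases hrp : r < p
    · exact le_sup_of_le_right (le_iSup₂_of_le r hrp (le_iSup₂_of_le s ⟨by omega, by omega⟩ le_rfl))
    · exact le_sup_of_le_left (le_inf ((inf_le_left.trans inf_le_left).trans
        (hm.F_anti (by omega))) ((inf_le_left.trans inf_le_right).trans (hm.W_mono (by omega))))
  rintro b ⟨⟨hbG, hbW⟩, hb⟩
  have hb2 := (sup_le le_sup_left hle :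
    (F p ⊓ WC W (p + q)) ⊔ (⨆ (l : ℤ) (_ : l ≤ p + q - 2), WC W l ⊓ F (l - (q - 1))) ≤ _) hb
  obtain ⟨a, ha, d, hd, rfl⟩ := Submodule.mem_sup.mp hb2
  have hL : (⨆ (r : ℤ) (_ : r < p) (s : ℤ) (_ : s < q ∧ r + s ≤ p + q - 2), deligne F W r s) ≤
      oppFil (WC W) (conjF F) (p + q - 2) (p - 1) :=
    iSup₂_le fun r hr => iSup₂_le fun s hs => (hm.bigr_le_oppFil r s).trans
      ((oppFil_mono_left hs.2).trans (oppFil_mono_right hm.G_anti (by omega)))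
  refine Submodule.add_mem_sup ⟨ha, ?_⟩ ?_
  · have hab : a = (a + d) + (-d) := by abel
    rw [SetLike.mem_coe, hab]
    exact Submodule.add_mem_sup ⟨hbG, hbW⟩ (Submodule.neg_mem _ (hL hd))
  · have hdL : (⨆ (r : ℤ) (_ : r < p) (s : ℤ) (_ : s < q ∧ r + s ≤ p + q - 2),
        deligne F W r s) ≤ ⨆ (r : ℤ) (_ : r < p) (s : ℤ) (_ : s < q), deligne F W r s :=
      iSup₂_mono fun r _ => iSup_mono fun s => iSup_le fun hs => le_iSup_of_le hs.1 le_rfl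
    exact hdL hd

theorem IsMixedHodge.isDeligneBigrading (h : IsMixedHodge F W) :
    IsDeligneBigrading F W (deligne F W) where
  directSum := (DirectSum.isInternal_submodule_iff_iSupIndep_and_iSup_eq_top _).mpr
    ⟨h.mixedOpposed.iSupIndep_bigr, h.mixedOpposed.iSup_bigr⟩
  F_eq := h.mixedOpposed.F_eq_iSup
  W_eq := h.mixedOpposed.W_eq_iSup
  conj_eq p q := by
    refine le_antisymm (sup_le ?_ le_sup_right) (sup_le (h.conjSub_deligne_le p q) le_sup_right)
    -- The reverse inclusion is the conjugate of the first with p and q exchanged. The conjugated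
    -- error terms are put back in the required range by the first inclusion again.
    have h1 := conjSub_mono (h.conjSub_deligne_le q p)
    rw [conjSub_conjSub, conjSub_sup] at h1
    refine h1.trans (sup_le_sup le_rfl ?_)
    simp only [conjSub_iSup]
    refine iSup₂_le fun r hr => iSup₂_le fun s hs => (h.conjSub_deligne_le s r).trans
      (sup_le ?_ ?_)
    · exact le_iSup₂_of_le s hs (le_iSup₂_of_le r hr le_rfl)
    · exact iSup₂_le fun s' hs' => iSup₂_le fun r' hr' =>
        le_iSup₂_of_le s' (hs'.trans hs) (le_iSup₂_of_le r' (hr'.trans hr) le_rfl)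

/-! ### Uniqueness of the Deligne bigrading -/

theorem IsDeligneBigrading.le_W {J : ℤ → ℤ → Submodule ℂ (ℂ ⊗[ℚ] H)}
    (hJ : IsDeligneBigrading F W J) (p q : ℤ) : J p q ≤ WC W (p + q) := by
  rw [WC, hJ.W_eq]
  exact le_iSup_of_le p (le_iSup₂_of_le q le_rfl le_rfl)

theorem IsDeligneBigrading.le_F {J : ℤ → ℤ → Submodule ℂ (ℂ ⊗[ℚ] H)}
    (hJ : IsDeligneBigrading F W J) (p q : ℤ) : J p q ≤ F p := by
  rw [hJ.F_eq]
  exact le_iSup₂_of_le p le_rfl (le_iSup_of_le q le_rfl)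

/-- The conjugation property puts J^{r,s} in conj F^s ∩ W_{r+s} plus terms J^{r',s'} with r' < r and
s' < s, hence of weight at most r + s - 2. Induction on the weight places each J^{r,s} in `oppFil`
at level r, so these error terms fit the correction term of Deligne's formula. -/
theorem IsMixedHodge.le_deligne (h : IsMixedHodge F W)
    {J : ℤ → ℤ → Submodule ℂ (ℂ ⊗[ℚ] H)} (hJ : IsDeligneBigrading F W J) (p q : ℤ) :
    J p q ≤ deligne F W p q := by
  have hm := h.mixedOpposed
  have hconj : ∀ r s, J r s ≤ (conjF F s ⊓ WC W (r + s)) ⊔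
      ⨆ (r' : ℤ) (_ : r' < r) (s' : ℤ) (_ : s' < s), J r' s' := by
    intro r s
    refine le_sup_left.trans ((hJ.conj_eq r s).le.trans (sup_le_sup (le_inf ?_ ?_) le_rfl))
    · exact conjSub_mono (hJ.le_F s r)
    · refine (conjSub_mono (hJ.le_W s r)).trans ?_
      rw [WC, conjSub_baseChange, add_comm]
  have hopp : ∀ k r s, r + s ≤ k → J r s ≤ oppFil (WC W) (conjF F) (r + s) r := by
    obtain ⟨a, ha⟩ := hm.W_bot
    refine int_le_induction_of_monotone (a := a)
      (P := fun k => ∀ r s, r + s ≤ k → J r s ≤ oppFil (WC W) (conjF F) (r + s) r)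
      (fun k hk r s hrs => ?_) (fun k ih r s hrs => ?_)
    · exact (hJ.le_W r s).trans ((hm.W_mono (hrs.trans hk)).trans (ha.le.trans bot_le))
    · refine (hconj r s).trans (sup_le ?_ ?_)
      · rw [inf_comm]
        refine le_trans ?_ (le_oppFil (l := r + s) le_rfl)
        rw [show r + s - r = s by ring]
      · exact iSup₂_le fun r' hr' => iSup₂_le fun s' hs' => (ih r' s' (by omega)).trans
          ((oppFil_mono_left (by omega)).trans (oppFil_mono_right hm.G_anti hr'.le))
  refine le_inf (le_inf (hJ.le_F p q) (hJ.le_W p q)) ((hconj p q).trans (sup_le_sup le_rfl ?_))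
  exact iSup₂_le fun r hr => iSup₂_le fun s hs => (hopp _ r s le_rfl).trans
    ((oppFil_mono_left (by omega)).trans (oppFil_mono_right hm.G_anti (by omega)))

theorem IsMixedHodge.eq_deligne (h : IsMixedHodge F W)
    {J : ℤ → ℤ → Submodule ℂ (ℂ ⊗[ℚ] H)} (hJ : IsDeligneBigrading F W J) :
    J = deligne F W := by
  have hJtop := ((DirectSum.isInternal_submodule_iff_iSupIndep_and_iSup_eq_top _).mp
    hJ.directSum).2
  have := eq_of_le_of_iSupIndep (fun a : ℤ × ℤ => h.le_deligne hJ a.1 a.2) hJtop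
    h.mixedOpposed.iSupIndep_bigr
  funext p q
  exact congrFun this (p, q)

/-- The components `U^p = ⨁_q I^{p,q}`. -/
def deligneU (F : ℤ → Submodule ℂ (ℂ ⊗[ℚ] H)) (W : ℤ → Submodule ℚ H) (p : ℤ) :
    Submodule ℂ (ℂ ⊗[ℚ] H) :=
  ⨆ q : ℤ, deligne F W p q

/-- The increasing filtration `⨁_{r ≤ p} U^r`, which is the sum of the `W_l ∩ conj F^{l-p}`. -/
def oppF (F : ℤ → Submodule ℂ (ℂ ⊗[ℚ] H)) (W : ℤ → Submodule ℚ H) (p : ℤ) :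
    Submodule ℂ (ℂ ⊗[ℚ] H) :=
  ⨆ l : ℤ, WC W l ⊓ conjF F (l - p)

theorem oppF_eq_oppFil (h : IsMixedHodge F W) {k : ℤ} (hk : WC W k = ⊤) (p : ℤ) :
    oppF F W p = oppFil (WC W) (conjF F) k p := by
  refine le_antisymm (iSup_le fun l => ?_) (iSup_mono fun l => iSup_le fun _ => le_rfl)
  rcases le_total l k with hl | hl
  · exact le_oppFil hl
  · refine le_trans (le_oppFil (k := l) le_rfl) ?_
    rw [← h.mixedOpposed.oppFil_inf hl, hk, inf_top_eq]

theorem IsMixedHodge.deligneU_eq (h : IsMixedHodge F W) (p : ℤ) :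
    deligneU F W p = F p ⊓ oppF F W p := by
  obtain ⟨k, hk⟩ := h.mixedOpposed.W_top
  rw [oppF_eq_oppFil h hk]
  exact h.mixedOpposed.iSup_bigr_left hk p

/-- The pivot of the whole argument: it yields U^p as a complement of F^{p+1} in F^p, and the rank
of Φ_p from that of F^{p+1}. -/
theorem IsMixedHodge.isCompl_oppF (h : IsMixedHodge F W) (p : ℤ) :
    IsCompl (F (p + 1)) (oppF F W p) := by
  obtain ⟨k, hk⟩ := h.mixedOpposed.W_top
  rw [oppF_eq_oppFil h hk]
  refine ⟨disjoint_iff.mpr (h.mixedOpposed.inf_eq p k), codisjoint_iff.mpr ?_⟩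
  have := h.mixedOpposed.sup_eq p k
  rwa [hk, inf_top_eq] at this

theorem IsMixedHodge.oppF_mono (h : IsMixedHodge F W) : Monotone (oppF F W) := fun p q hpq =>
  iSup_mono fun l => inf_le_inf_left _ (conjSub_mono (h.F_antitone (by omega)))

theorem IsMixedHodge.F_eq_sup (h : IsMixedHodge F W) (p : ℤ) :
    F p = deligneU F W p ⊔ F (p + 1) := by
  rw [h.deligneU_eq]
  have hF := h.F_antitone (show p ≤ p + 1 by omega)
  rw [inf_comm, sup_comm, ← sup_inf_assoc_of_le _ hF, (h.isCompl_oppF p).sup_eq_top, top_inf_eq]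

theorem IsMixedHodge.deligneU_inf_F (h : IsMixedHodge F W) (p : ℤ) :
    deligneU F W p ⊓ F (p + 1) = ⊥ := by
  rw [h.deligneU_eq, eq_bot_iff, ← (h.isCompl_oppF p).inf_eq_bot]
  exact le_inf inf_le_right (inf_le_left.trans inf_le_right)

/-- `F^p ∩ ⨁_{r ≤ p + 1} U^r = U^p ⊕ U^{p+1}`. -/
theorem IsMixedHodge.F_inf_oppF_succ (h : IsMixedHodge F W) (p : ℤ) :
    F p ⊓ oppF F W (p + 1) ≤ deligneU F W p ⊔ deligneU F W (p + 1) := by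
  rintro x ⟨hxF, hx⟩
  rw [SetLike.mem_coe, h.F_eq_sup] at hxF
  obtain ⟨u, hu, f, hf, rfl⟩ := Submodule.mem_sup.mp hxF
  refine Submodule.add_mem_sup hu ?_
  rw [h.deligneU_eq] at hu ⊢
  refine ⟨hf, ?_⟩
  simpa using Submodule.sub_mem _ hx (h.oppF_mono (show p ≤ p + 1 by omega) hu.2)

theorem IsMixedHodge.iSupIndep_deligneU (h : IsMixedHodge F W) :
    iSupIndep (deligneU F W) := by
  refine iSupIndep_of_disjoint_iSup_lt (κ := ℤ) (fun p => -p) neg_injective _ fun p => ?_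
  refine Disjoint.mono_right ?_ (disjoint_iff.mpr (h.deligneU_inf_F p))
  refine iSup₂_le fun r hr => ?_
  rw [h.deligneU_eq]
  exact inf_le_left.trans (h.F_antitone (by omega))

theorem IsMixedHodge.isInternal_deligneU (h : IsMixedHodge F W) :
    DirectSum.IsInternal (deligneU F W) := by
  refine (DirectSum.isInternal_submodule_iff_iSupIndep_and_iSup_eq_top _).mpr
    ⟨h.iSupIndep_deligneU, ?_⟩
  rw [eq_top_iff, ← h.mixedOpposed.iSup_bigr]
  exact iSup_le fun a => le_iSup_of_le a.1 (le_iSup (deligne F W a.1) a.2)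

end Deligne

/-! ### Germs of smooth functions with values in a normed space -/

section Germs

variable (E : Type*) [NormedAddCommGroup E] [NormedSpace ℂ E]
  {S : Type*} [TopologicalSpace S] [ChartedSpace E S]
  {M : Type*} [NormedAddCommGroup M] [NormedSpace ℝ M]
  {M' : Type*} [NormedAddCommGroup M'] [NormedSpace ℝ M']

/-- `g` is smooth on a neighbourhood of `x`. -/
def GermSmooth (g : S → M) (x : S) : Prop :=
  ∀ᶠ y in 𝓝 x, ContMDiffAt 𝓘(ℝ, E) 𝓘(ℝ, M) ∞ g y

/-- The differential of a function at `x`, as a real-linear map on `E`. -/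
def dAt (g : S → M) (x : S) : E →L[ℝ] M := mfderiv 𝓘(ℝ, E) 𝓘(ℝ, M) g x

/-- The expression of a function in the chart at `x`. -/
def inChart (E : Type*) [NormedAddCommGroup E] [ChartedSpace E S] {M : Type*} (x : S)
    (g : S → M) : E → M := g ∘ (chartAt E x).symm

variable {E}

theorem _root_.ContMDiffAt.hasFDerivAt_inChart {g : S → M} {x : S}
    (h : ContMDiffAt 𝓘(ℝ, E) 𝓘(ℝ, M) ∞ g x) :
    HasFDerivAt (inChart E x g) (dAt E g x) (chartAt E x x) := by
  have h1 := (h.mdifferentiableAt (by simp)).hasMFDerivAt.2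
  simp only [mfld_simps] at h1
  exact hasFDerivWithinAt_univ.mp h1

theorem dAt_eq_of_hasFDerivAt {g : S → M} {x : S}
    (h : ContMDiffAt 𝓘(ℝ, E) 𝓘(ℝ, M) ∞ g x) {A : E →L[ℝ] M}
    (hA : HasFDerivAt (inChart E x g) A (chartAt E x x)) : dAt E g x = A :=
  h.hasFDerivAt_inChart.unique hA

@[simp]
theorem inChart_self {E : Type*} [NormedAddCommGroup E] [ChartedSpace E S] {M : Type*} (x : S)
    (g : S → M) : inChart E x g (chartAt E x x) = g x := by
  simp [inChart]

namespace GermSmooth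

variable {g g' : S → M} {x : S}

theorem at_self (h : GermSmooth E g x) : ContMDiffAt 𝓘(ℝ, E) 𝓘(ℝ, M) ∞ g x := h.self_of_nhds

theorem eventually (h : GermSmooth E g x) : ∀ᶠ y in 𝓝 x, GermSmooth E g y :=
  eventually_eventually_nhds.mpr h

theorem congr (h : GermSmooth E g x) (hg : g' =ᶠ[𝓝 x] g) : GermSmooth E g' x := by
  filter_upwards [h, hg.eventuallyEq_nhds] with y hy hgy
  exact hy.congr_of_eventuallyEq hgy

theorem const (c : M) (x : S) : GermSmooth E (fun _ : S => c) x :=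
  Filter.Eventually.of_forall fun _ => contMDiffAt_const

theorem comp {φ : M → M'} (hφ : ContDiff ℝ ∞ φ) (h : GermSmooth E g x) :
    GermSmooth E (fun y => φ (g y)) x := by
  filter_upwards [h] with y hy
  exact hφ.contDiffAt.contMDiffAt.comp y hy

theorem prodMk {k : S → M'} (h : GermSmooth E g x) (hk : GermSmooth E k x) :
    GermSmooth E (fun y => (g y, k y)) x := by
  filter_upwards [h, hk] with y hy hky
  exact hy.prodMk_space hky

theorem add (h : GermSmooth E g x) (h' : GermSmooth E g' x) :
    GermSmooth E (fun y => g y + g' y) x :=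
  (h.prodMk h').comp (φ := fun p : M × M => p.1 + p.2) (contDiff_fst.add contDiff_snd)

theorem sub (h : GermSmooth E g x) (h' : GermSmooth E g' x) :
    GermSmooth E (fun y => g y - g' y) x :=
  (h.prodMk h').comp (φ := fun p : M × M => p.1 - p.2) (contDiff_fst.sub contDiff_snd)

theorem sum {ι : Type*} {s : Finset ι} {f : ι → S → M} (h : ∀ i ∈ s, GermSmooth E (f i) x) :
    GermSmooth E (fun y => ∑ i ∈ s, f i y) x := by
  classical
  induction s using Finset.induction_on with
  | empty => simpa using const (0 : M) x
  | insert a s ha ih =>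
    have e : (fun y => ∑ i ∈ insert a s, f i y) = fun y => f a y + ∑ i ∈ s, f i y := by
      funext y
      rw [Finset.sum_insert ha]
    rw [e]
    exact (h a (Finset.mem_insert_self a s)).add
      (ih fun i hi => h i (Finset.mem_insert_of_mem hi))

theorem continuousAt (h : GermSmooth E g x) : ContinuousAt g x := h.at_self.continuousAt

end GermSmooth

section Deriv

variable {g g' : S → M} {x : S}

theorem dAt_congr (h : g' =ᶠ[𝓝 x] g) : dAt E g' x = dAt E g x := h.mfderiv_eq

theorem dAt_const (c : M) (x : S) : dAt E (fun _ : S => c) x = 0 := mfderiv_const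

theorem dAt_comp (h : GermSmooth E g x) {φ : M → M'} (hφ : ContDiff ℝ ∞ φ) :
    dAt E (fun y => φ (g y)) x = (fderiv ℝ φ (g x)).comp (dAt E g x) := by
  refine dAt_eq_of_hasFDerivAt (h.comp hφ).at_self ?_
  have h1 : HasFDerivAt φ (fderiv ℝ φ (g x)) (inChart E x g (chartAt E x x)) := by
    rw [inChart_self]
    exact ((hφ.differentiable (by simp)) _).hasFDerivAt
  exact h1.comp _ h.at_self.hasFDerivAt_inChart

theorem dAt_clm_comp (h : GermSmooth E g x) (A : M →L[ℝ] M') :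
    dAt E (fun y => A (g y)) x = A.comp (dAt E g x) := by
  rw [dAt_comp h A.contDiff, ContinuousLinearMap.fderiv]

theorem dAt_add (h : GermSmooth E g x) (h' : GermSmooth E g' x) :
    dAt E (fun y => g y + g' y) x = dAt E g x + dAt E g' x :=
  dAt_eq_of_hasFDerivAt (h.add h').at_self
    (h.at_self.hasFDerivAt_inChart.add h'.at_self.hasFDerivAt_inChart)

theorem dAt_sub (h : GermSmooth E g x) (h' : GermSmooth E g' x) :
    dAt E (fun y => g y - g' y) x = dAt E g x - dAt E g' x :=
  dAt_eq_of_hasFDerivAt (h.sub h').at_self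
    (h.at_self.hasFDerivAt_inChart.sub h'.at_self.hasFDerivAt_inChart)

end Deriv

section Operators

variable {n n' n'' : ℕ} {x : S}

theorem GermSmooth.clm_apply {T : S → (Fin n → ℂ) →L[ℂ] (Fin n' → ℂ)} {g : S → Fin n → ℂ}
    (hT : GermSmooth E T x) (hg : GermSmooth E g x) : GermSmooth E (fun y => T y (g y)) x :=
  (hT.prodMk hg).comp (φ := fun p : ((Fin n → ℂ) →L[ℂ] (Fin n' → ℂ)) × (Fin n → ℂ) => p.1 p.2)
    ((isBoundedBilinearMap_apply (𝕜 := ℂ) (E := Fin n → ℂ) (F := Fin n' → ℂ)).contDiff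
      (n := ∞) |>.restrict_scalars ℝ)

theorem GermSmooth.clm_comp {T : S → (Fin n' → ℂ) →L[ℂ] (Fin n'' → ℂ)}
    {R : S → (Fin n → ℂ) →L[ℂ] (Fin n' → ℂ)}
    (hT : GermSmooth E T x) (hR : GermSmooth E R x) :
    GermSmooth E (fun y => (T y).comp (R y)) x :=
  (hT.prodMk hR).comp
    (φ := fun p : ((Fin n' → ℂ) →L[ℂ] (Fin n'' → ℂ)) × ((Fin n → ℂ) →L[ℂ] (Fin n' → ℂ)) =>
      p.1.comp p.2)
    ((isBoundedBilinearMap_comp (𝕜 := ℂ) (E := Fin n → ℂ) (F := Fin n' → ℂ)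
      (G := Fin n'' → ℂ)).contDiff (n := ∞) |>.restrict_scalars ℝ)

theorem GermSmooth.smul {c : S → ℂ} {g : S → Fin n → ℂ}
    (hc : GermSmooth E c x) (hg : GermSmooth E g x) : GermSmooth E (fun y => c y • g y) x :=
  (hc.prodMk hg).comp (φ := fun p : ℂ × (Fin n → ℂ) => p.1 • p.2)
    ((isBoundedBilinearMap_smul (𝕜 := ℂ) (A := ℂ) (E := Fin n → ℂ)).contDiff
      (n := ∞) |>.restrict_scalars ℝ)

theorem GermSmooth.ringInverse {T : S → (Fin n → ℂ) →L[ℂ] (Fin n → ℂ)}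
    (hT : GermSmooth E T x) (hu : IsUnit (T x)) : GermSmooth E (fun y => Ring.inverse (T y)) x := by
  have hU : ∀ᶠ y in 𝓝 x, IsUnit (T y) :=
    hT.continuousAt.eventually (Units.isOpen.mem_nhds hu)
  filter_upwards [hT, hU] with y hy hyu
  obtain ⟨u, hu⟩ := hyu
  have h1 : ContDiffAt ℝ ∞ Ring.inverse (T y) := by
    rw [← hu]
    exact (contDiffAt_ringInverse ℂ u).restrict_scalars ℝ
  exact h1.contMDiffAt.comp y hy

theorem dAt_clm_apply {T : S → (Fin n → ℂ) →L[ℂ] (Fin n' → ℂ)} {g : S → Fin n → ℂ}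
    (hT : GermSmooth E T x) (hg : GermSmooth E g x) (v : E) :
    dAt E (fun y => T y (g y)) x v = dAt E T x v (g x) + T x (dAt E g x v) := by
  have hb := (isBoundedBilinearMap_apply (𝕜 := ℂ) (E := Fin n → ℂ) (F := Fin n' → ℂ))
  have h1 := (hb.hasFDerivAt (T x, g x)).restrictScalars ℝ
  have h2 := (hT.prodMk hg).at_self.hasFDerivAt_inChart
  have h3 := hT.at_self.hasFDerivAt_inChart.prodMk hg.at_self.hasFDerivAt_inChart
  have h4 : HasFDerivAt (inChart E x fun y => T y (g y)) _ (chartAt E x x) :=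
    HasFDerivAt.comp (g := fun p : ((Fin n → ℂ) →L[ℂ] (Fin n' → ℂ)) × (Fin n → ℂ) => p.1 p.2)
      (chartAt E x x) (by simpa using h1) h3
  rw [dAt_eq_of_hasFDerivAt (hT.clm_apply hg).at_self h4]
  simp [add_comm]

theorem dAt_smul {c : S → ℂ} {g : S → Fin n → ℂ}
    (hc : GermSmooth E c x) (hg : GermSmooth E g x) (v : E) :
    dAt E (fun y => c y • g y) x v = dAt E c x v • g x + c x • dAt E g x v := by
  have h4 : HasFDerivAt (inChart E x fun y => c y • g y) _ (chartAt E x x) :=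
    hc.at_self.hasFDerivAt_inChart.smul hg.at_self.hasFDerivAt_inChart
  rw [dAt_eq_of_hasFDerivAt (hc.smul hg).at_self h4]
  simp [add_comm]

/-- The derivative of a function with values in a subspace lies in the subspace. -/
theorem dAt_mem {g : S → Fin n → ℂ} (hg : GermSmooth E g x) {A : Submodule ℂ (Fin n → ℂ)}
    (hA : ∀ᶠ y in 𝓝 x, g y ∈ A) (v : E) : dAt E g x v ∈ A := by
  -- Project onto a complement along A: membership in A becomes the vanishing of π, and the constant
  -- linear map π commutes with differentiation.
  obtain ⟨q, hq⟩ := Submodule.exists_isCompl A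
  set π : (Fin n → ℂ) →L[ℂ] (Fin n → ℂ) :=
    LinearMap.toContinuousLinearMap (q.subtype ∘ₗ q.projectionOnto A hq.symm)
  have hker : ∀ w, π w = 0 ↔ w ∈ A := fun w => by
    have : π w = q.subtype (q.projectionOnto A hq.symm w) := rfl
    rw [this]
    simp
  have h0 : (fun y => π.restrictScalars ℝ (g y)) =ᶠ[𝓝 x] fun _ => 0 := by
    filter_upwards [hA] with y hy
    exact (hker _).mpr hy
  have h1 := dAt_clm_comp hg (π.restrictScalars ℝ)
  rw [dAt_congr h0, dAt_const] at h1
  exact (hker _).mp (DFunLike.congr_fun h1 v).symm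

end Operators

end Germs

/-! ### Diagonal operators for a direct sum decomposition -/

section Diagonal

variable {ι V V' : Type*} [AddCommGroup V] [Module ℂ V] [AddCommGroup V'] [Module ℂ V']
  {A : ι → Submodule ℂ V}

theorem iSup_eq_top_of_isInternal [DecidableEq ι] (h : DirectSum.IsInternal A) :
    ⨆ i, A i = ⊤ :=
  ((DirectSum.isInternal_submodule_iff_iSupIndep_and_iSup_eq_top _).mp h).2

theorem linearMap_ext_of_isInternal [DecidableEq ι] (h : DirectSum.IsInternal A)
    {f g : V →ₗ[ℂ] V'} (hfg : ∀ i, ∀ a ∈ A i, f a = g a) : f = g := by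
  have h1 : ⨆ i, A i ≤ LinearMap.eqLocus f g := iSup_le fun i a ha => hfg i a ha
  rw [iSup_eq_top_of_isInternal h] at h1
  exact LinearMap.ext fun v => h1 (Submodule.mem_top (x := v))

/-- The operator which is multiplication by `c i` on the summand `A i`. -/
def diagOp [DecidableEq ι] (h : DirectSum.IsInternal A) (c : ι → ℂ) : Module.End ℂ V :=
  (DirectSum.toModule ℂ ι V fun i => c i • (A i).subtype) ∘ₗ
    (LinearEquiv.ofBijective (DirectSum.coeLinearMap A) h).symm.toLinearMap

theorem diagOp_apply [DecidableEq ι] (h : DirectSum.IsInternal A) (c : ι → ℂ) {i : ι} {a : V}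
    (ha : a ∈ A i) : diagOp h c a = c i • a := by
  have e : (LinearEquiv.ofBijective (DirectSum.coeLinearMap A) h).symm a =
      DirectSum.lof ℂ ι (fun i => A i) i ⟨a, ha⟩ := by
    rw [LinearEquiv.symm_apply_eq]
    exact (DirectSum.coeLinearMap_lof A i ⟨a, ha⟩).symm
  rw [diagOp, LinearMap.comp_apply, LinearEquiv.coe_coe, e, DirectSum.toModule_lof]
  rfl

theorem diagOp_comp [DecidableEq ι] (h : DirectSum.IsInternal A) (c d : ι → ℂ) :
    diagOp h c ∘ₗ diagOp h d = diagOp h (fun i => c i * d i) := by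
  refine linearMap_ext_of_isInternal h fun i a ha => ?_
  rw [LinearMap.comp_apply, diagOp_apply h d ha, map_smul, diagOp_apply h c ha,
    diagOp_apply h _ ha, smul_smul, mul_comm]

theorem diagOp_one [DecidableEq ι] (h : DirectSum.IsInternal A) :
    diagOp h (fun _ => 1) = LinearMap.id := by
  refine linearMap_ext_of_isInternal h fun i a ha => ?_
  rw [diagOp_apply h _ ha, one_smul, LinearMap.id_apply]

/-- The projection onto the summand `A i`. -/
def projOp [DecidableEq ι] (h : DirectSum.IsInternal A) (i : ι) : Module.End ℂ V :=
  diagOp h (Pi.single i 1)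

theorem projOp_of_mem [DecidableEq ι] (h : DirectSum.IsInternal A) {i : ι} {a : V}
    (ha : a ∈ A i) : projOp h i a = a := by
  rw [projOp, diagOp_apply h _ ha, Pi.single_eq_same, one_smul]

theorem projOp_of_mem_ne [DecidableEq ι] (h : DirectSum.IsInternal A) {i j : ι} (hij : j ≠ i)
    {a : V} (ha : a ∈ A j) : projOp h i a = 0 := by
  rw [projOp, diagOp_apply h _ ha, Pi.single_eq_of_ne hij, zero_smul]

theorem projOp_mem [DecidableEq ι] (h : DirectSum.IsInternal A) (i : ι) (v : V) :
    projOp h i v ∈ A i := by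
  have h1 : ⨆ j, A j ≤ (A i).comap (projOp h i) := by
    refine iSup_le fun j a ha => ?_
    rw [Submodule.mem_comap]
    by_cases hij : j = i
    · subst hij
      rwa [projOp_of_mem h ha]
    · rw [projOp_of_mem_ne h hij ha]
      exact Submodule.zero_mem _
  rw [iSup_eq_top_of_isInternal h] at h1
  exact h1 (Submodule.mem_top (x := v))

theorem exists_finset_sum_projOp [DecidableEq ι] [FiniteDimensional ℂ V]
    (h : DirectSum.IsInternal A) :
    ∃ J : Finset ι, (∀ i ∉ J, A i = ⊥) ∧ ∀ v, ∑ i ∈ J, projOp h i v = v := by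
  have hf : {i | A i ≠ ⊥}.Finite :=
    WellFoundedGT.finite_ne_bot_of_iSupIndep h.submodule_iSupIndep
  refine ⟨hf.toFinset, fun i hi => by simpa using hi, fun v => ?_⟩
  have e : ∑ i ∈ hf.toFinset, projOp h i = LinearMap.id := by
    refine linearMap_ext_of_isInternal h fun i a ha => ?_
    rw [LinearMap.sum_apply, LinearMap.id_apply]
    by_cases hi : A i = ⊥
    · rw [hi, Submodule.mem_bot] at ha
      simp [ha]
    · rw [Finset.sum_eq_single i, projOp_of_mem h ha]
      · exact fun j _ hj => projOp_of_mem_ne h (Ne.symm hj) ha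
      · intro hi'
        simp [hi] at hi'
  rw [← LinearMap.sum_apply, e, LinearMap.id_apply]

end Diagonal

/-! ### Smooth families of subspaces of a fixed vector space -/

section Families

variable (E : Type*) [NormedAddCommGroup E] [NormedSpace ℂ E]
  {S : Type*} [TopologicalSpace S] [ChartedSpace E S] {n : ℕ}

/-- The family `A` of subspaces of `ℂⁿ` is a smooth subbundle near `x`: vectors in `A x` extend
to smooth sections and the dimension is locally constant. -/
def SmoothFamily (A : S → Submodule ℂ (Fin n → ℂ)) (x : S) : Prop :=
  (∀ a ∈ A x, ∃ g : S → Fin n → ℂ, GermSmooth E g x ∧ g x = a ∧ ∀ᶠ y in 𝓝 x, g y ∈ A y) ∧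
    ∀ᶠ y in 𝓝 x, Module.finrank ℂ (A y) = Module.finrank ℂ (A x)

variable {E} {x : S}

theorem GermSmooth.eventually_isUnit {T : S → (Fin n → ℂ) →L[ℂ] (Fin n → ℂ)}
    (hT : GermSmooth E T x) (hx : T x = 1) : ∀ᶠ y in 𝓝 x, IsUnit (T y) :=
  hT.continuousAt.eventually (Units.isOpen.mem_nhds (by rw [hx]; exact isUnit_one))

theorem injective_of_isUnit {T : (Fin n → ℂ) →L[ℂ] (Fin n → ℂ)} (hT : IsUnit T) :
    Function.Injective T := by
  obtain ⟨u, rfl⟩ := hT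
  intro a b hab
  have h := congrArg (fun v => (↑u⁻¹ : (Fin n → ℂ) →L[ℂ] (Fin n → ℂ)) v) hab
  simpa [← mul_apply_eq_comp] using h

theorem ringInverse_apply_apply {T : (Fin n → ℂ) →L[ℂ] (Fin n → ℂ)} (hT : IsUnit T)
    (v : Fin n → ℂ) : Ring.inverse T (T v) = v := by
  rw [← mul_apply_eq_comp, Ring.inverse_mul_cancel T hT]
  rfl

theorem apply_ringInverse_apply {T : (Fin n → ℂ) →L[ℂ] (Fin n → ℂ)} (hT : IsUnit T)
    (v : Fin n → ℂ) : T (Ring.inverse T v) = v := by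
  rw [← mul_apply_eq_comp, Ring.mul_inverse_cancel T hT]
  rfl

theorem finrank_map_of_isUnit {T : (Fin n → ℂ) →L[ℂ] (Fin n → ℂ)} (hT : IsUnit T)
    (A : Submodule ℂ (Fin n → ℂ)) :
    Module.finrank ℂ (A.map T.toLinearMap) = Module.finrank ℂ A :=
  (Submodule.equivMapOfInjective T.toLinearMap (injective_of_isUnit hT) A).finrank_eq.symm

/-- T_y sends a basis of A x to its smooth extensions at y and is the identity on a complement of A
x. It is the identity at x, so invertible nearby, and it maps A x onto A y because the dimensions
agree. -/
theorem SmoothFamily.exists_trivialization {A : S → Submodule ℂ (Fin n → ℂ)}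
    (hA : SmoothFamily E A x) :
    ∃ T : S → (Fin n → ℂ) →L[ℂ] (Fin n → ℂ), GermSmooth E T x ∧ T x = 1 ∧
      ∀ᶠ y in 𝓝 x, IsUnit (T y) ∧ (A x).map (T y).toLinearMap = A y := by
  obtain ⟨q, hq⟩ := Submodule.exists_isCompl (A x)
  set b := Module.finBasis ℂ (A x)
  choose g hg hgx hgA using fun i => hA.1 (b i) (b i).2
  set π : (Fin n → ℂ) →ₗ[ℂ] A x := (A x).projectionOnto q hq
  set c : Fin (Module.finrank ℂ (A x)) → (Fin n → ℂ) →L[ℂ] ℂ := fun i =>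
    LinearMap.toContinuousLinearMap (b.coord i ∘ₗ π)
  set R : (Fin n → ℂ) →L[ℂ] (Fin n → ℂ) :=
    LinearMap.toContinuousLinearMap (LinearMap.id - (A x).subtype ∘ₗ π)
  let T : S → (Fin n → ℂ) →L[ℂ] (Fin n → ℂ) := fun y => R + ∑ i, (c i).smulRight (g i y)
  have hT : ∀ y v, T y v = (v - (π v : Fin n → ℂ)) + ∑ i, b.repr (π v) i • g i y := by
    intro y v
    simp only [T, add_apply, sum_apply,
      ContinuousLinearMap.smulRight_apply]
    rfl
  have hTs : GermSmooth E T x := by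
    refine (GermSmooth.const R x).add (GermSmooth.sum fun i _ => ?_)
    exact (hg i).comp (φ := fun w => (c i).smulRight w)
      ((ContinuousLinearMap.smulRightL ℂ (Fin n → ℂ) (Fin n → ℂ) (c i)).restrictScalars ℝ).contDiff
  have hTx : T x = 1 := by
    ext1 v
    rw [hT]
    have e : ∑ i, b.repr (π v) i • g i x = (π v : Fin n → ℂ) := by
      conv_rhs => rw [← b.sum_repr (π v), Submodule.coe_sum]
      exact Finset.sum_congr rfl fun i _ => by rw [hgx, Submodule.coe_smul]
    rw [e]
    simp
  refine ⟨T, hTs, hTx, ?_⟩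
  filter_upwards [hTs.eventually_isUnit hTx, hA.2, Filter.eventually_all.mpr hgA]
    with y hyu hyd hyA
  refine ⟨hyu, Submodule.eq_of_le_of_finrank_eq ?_ ?_⟩
  · rintro _ ⟨a, ha, rfl⟩
    change T y a ∈ A y
    rw [hT]
    have : (π a : Fin n → ℂ) = a := by
      rw [Submodule.projectionOnto_apply_of_mem_left hq ha]
    rw [this, sub_self, zero_add]
    exact Submodule.sum_mem _ fun i _ => Submodule.smul_mem _ _ (hyA i)
  · rw [finrank_map_of_isUnit hyu, hyd]

/-- Write g = T u with u valued in the fixed space A x. The term containing dT vanishes with u(x),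
and T x = 1. Thus the derivative of a section of A modulo A x depends only on its value at x, so one
good section through each vector is enough to control all sections. -/
theorem SmoothFamily.dAt_mem {A : S → Submodule ℂ (Fin n → ℂ)} (hA : SmoothFamily E A x)
    {g : S → Fin n → ℂ} (hg : GermSmooth E g x) (hgA : ∀ᶠ y in 𝓝 x, g y ∈ A y) (h0 : g x = 0)
    (v : E) : dAt E g x v ∈ A x := by
  obtain ⟨T, hT, hTx, hTA⟩ := hA.exists_trivialization
  have hu : GermSmooth E (fun y => Ring.inverse (T y) (g y)) x :=
    (hT.ringInverse (by rw [hTx]; exact isUnit_one)).clm_apply hg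
  have huA : ∀ᶠ y in 𝓝 x, Ring.inverse (T y) (g y) ∈ A x := by
    filter_upwards [hTA, hgA] with y hy hgy
    rw [← hy.2] at hgy
    obtain ⟨a, ha, e⟩ := hgy
    rw [← e]
    exact (ringInverse_apply_apply hy.1 a).symm ▸ ha
  have e : g =ᶠ[𝓝 x] fun y => T y (Ring.inverse (T y) (g y)) := by
    filter_upwards [hTA] with y hy
    rw [apply_ringInverse_apply hy.1]
  rw [dAt_congr e, dAt_clm_apply hT hu, h0, map_zero, map_zero, zero_add, hTx]
  exact MHS.dAt_mem hu huA v

/-- Constant rank of the intersection makes the rank of A + B constant. Build T from the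
trivialization of B on B x and that of A on a complement C containing a complement of A x ∩ B x in A
x; then T carries A x + B x onto A y + B y. -/
theorem SmoothFamily.inf {A B : S → Submodule ℂ (Fin n → ℂ)} (hA : SmoothFamily E A x)
    (hB : SmoothFamily E B x)
    (hd : ∀ᶠ y in 𝓝 x, Module.finrank ℂ ↥(A y ⊓ B y) = Module.finrank ℂ ↥(A x ⊓ B x)) :
    SmoothFamily E (fun y => A y ⊓ B y) x := by
  refine ⟨fun v hv => ?_, hd⟩
  obtain ⟨TA, hTA, hTAx, hTAe⟩ := hA.exists_trivialization
  obtain ⟨TB, hTB, hTBx, hTBe⟩ := hB.exists_trivialization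
  obtain ⟨Q, hQ⟩ := Submodule.exists_isCompl (A x ⊓ B x)
  have hsup : A x ⊓ Q ⊔ B x = A x ⊔ B x := by
    refine le_antisymm (sup_le_sup_right inf_le_left _) (sup_le ?_ le_sup_right)
    calc A x = A x ⊓ (Q ⊔ A x ⊓ B x) := by rw [sup_comm, hQ.sup_eq_top, inf_top_eq]
      _ = A x ⊓ Q ⊔ A x ⊓ B x := (inf_sup_assoc_of_le _ inf_le_left).symm
      _ ≤ _ := sup_le_sup le_rfl inf_le_right
  have hdis : Disjoint (A x ⊓ Q) (B x) := by
    rw [disjoint_iff, eq_bot_iff, ← hQ.inf_eq_bot]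
    exact le_inf (le_inf (inf_le_left.trans inf_le_left) inf_le_right)
      (inf_le_left.trans inf_le_right)
  obtain ⟨C, hAC, hC⟩ := hdis.exists_isCompl
  set PB : (Fin n → ℂ) →L[ℂ] (Fin n → ℂ) :=
    LinearMap.toContinuousLinearMap ((B x).projection C hC.symm) with hPB
  set PC : (Fin n → ℂ) →L[ℂ] (Fin n → ℂ) :=
    LinearMap.toContinuousLinearMap (C.projection (B x) hC) with hPC
  have hPB1 : ∀ b ∈ B x, PB b = b := fun b hb =>
    Submodule.projection_apply_of_mem_left hC.symm hb
  have hPB0 : ∀ c ∈ C, PB c = 0 := fun c hc =>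
    (Submodule.projection_apply_eq_zero_iff hC.symm).mpr hc
  have hPC1 : ∀ c ∈ C, PC c = c := fun c hc => Submodule.projection_apply_of_mem_left hC hc
  have hPC0 : ∀ b ∈ B x, PC b = 0 := fun b hb =>
    (Submodule.projection_apply_eq_zero_iff hC).mpr hb
  let T : S → (Fin n → ℂ) →L[ℂ] (Fin n → ℂ) := fun y => (TB y).comp PB + (TA y).comp PC
  have hTs : GermSmooth E T x := (hTB.clm_comp (GermSmooth.const PB x)).add
    (hTA.clm_comp (GermSmooth.const PC x))
  have hTB' : ∀ y, ∀ b ∈ B x, T y b = TB y b := fun y b hb => by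
    simp [T, hPB1 b hb, hPC0 b hb]
  have hTC' : ∀ y, ∀ c ∈ C, T y c = TA y c := fun y c hc => by
    simp [T, hPB0 c hc, hPC1 c hc]
  have hTx : T x = 1 := by
    ext1 w
    have hw : w ∈ C ⊔ B x := by rw [hC.sup_eq_top]; trivial
    obtain ⟨c, hc, b, hb, rfl⟩ := Submodule.mem_sup.mp hw
    rw [map_add, hTC' x c hc, hTB' x b hb, hTAx, hTBx]
    rfl
  -- Start from the extension `TA y v` inside A y, write it as T y (a + b) with a in A x ∩ Q and b
  -- in B x, and keep T y b. It lies in B y by construction, and in A y as the difference of `TA y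
  -- v` and T y a.
  refine ⟨fun y => T y (PB (Ring.inverse (T y) (TA y v))), ?_, ?_, ?_⟩
  · exact hTs.clm_apply ((GermSmooth.const PB x).clm_apply
      ((hTs.ringInverse (by rw [hTx]; exact isUnit_one)).clm_apply
        (hTA.clm_apply (GermSmooth.const v x))))
  · simp [hTx, hTAx, hPB1 v hv.2]
  · filter_upwards [hTs.eventually_isUnit hTx, hTAe, hTBe, hd, hA.2, hB.2] with y hu hyA hyB hyd
      hydA hydB
    have hle : (A x ⊔ B x).map (T y).toLinearMap ≤ A y ⊔ B y := by
      rw [← hsup, Submodule.map_sup]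
      refine sup_le_sup ?_ ?_
      · rintro _ ⟨a, ha, rfl⟩
        change T y a ∈ A y
        rw [hTC' y a (hAC ha), ← hyA.2]
        exact ⟨a, ha.1, rfl⟩
      · rintro _ ⟨b, hb, rfl⟩
        change T y b ∈ B y
        rw [hTB' y b hb, ← hyB.2]
        exact ⟨b, hb, rfl⟩
    have heq : (A x ⊔ B x).map (T y).toLinearMap = A y ⊔ B y := by
      refine Submodule.eq_of_le_of_finrank_eq hle ?_
      rw [finrank_map_of_isUnit hu]
      have h1 := Submodule.finrank_sup_add_finrank_inf_eq (A x) (B x)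
      have h2 := Submodule.finrank_sup_add_finrank_inf_eq (A y) (B y)
      omega
    have hgA : TA y v ∈ A y := by
      rw [← hyA.2]
      exact ⟨v, hv.1, rfl⟩
    have hg2 := (le_sup_left : A y ≤ A y ⊔ B y) hgA
    rw [← heq] at hg2
    obtain ⟨u, hu', hgu⟩ := hg2
    have hgu' : T y u = TA y v := hgu
    rw [← hgu', ringInverse_apply_apply hu]
    rw [SetLike.mem_coe, ← hsup] at hu'
    obtain ⟨a, ha, b, hb, rfl⟩ := Submodule.mem_sup.mp hu'
    have e : PB (a + b) = b := by rw [map_add, hPB0 a (hAC ha), hPB1 b hb, zero_add]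
    rw [e]
    refine ⟨?_, ?_⟩
    · have ha' : T y a ∈ A y := by
        rw [hTC' y a (hAC ha), ← hyA.2]
        exact ⟨a, ha.1, rfl⟩
      have : T y b = TA y v - T y a := by rw [← hgu', map_add]; abel
      rw [SetLike.mem_coe, this]
      exact Submodule.sub_mem _ hgA ha'
    · rw [SetLike.mem_coe, hTB' y b hb, ← hyB.2]
      exact ⟨b, hb, rfl⟩

/-- Glue the trivializations of the summands: the sum of the T_i composed with the projections at x
is the identity at x, and only finitely many summands are nonzero. -/
theorem exists_adapted_trivialization {ι : Type*} [DecidableEq ι]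
    {A : ι → S → Submodule ℂ (Fin n → ℂ)} (hA : ∀ i, SmoothFamily E (A i) x)
    (h : DirectSum.IsInternal fun i => A i x) :
    ∃ T : S → (Fin n → ℂ) →L[ℂ] (Fin n → ℂ), GermSmooth E T x ∧ T x = 1 ∧
      ∀ᶠ y in 𝓝 x, IsUnit (T y) ∧ ∀ i, ∀ a ∈ A i x, T y a ∈ A i y := by
  obtain ⟨J, hJ, hsum⟩ := exists_finset_sum_projOp h
  choose T hT hTx hTe using fun i => (hA i).exists_trivialization
  let P : ι → (Fin n → ℂ) →L[ℂ] (Fin n → ℂ) := fun i =>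
    LinearMap.toContinuousLinearMap (projOp h i)
  let R : S → (Fin n → ℂ) →L[ℂ] (Fin n → ℂ) := fun y => ∑ i ∈ J, (T i y).comp (P i)
  have hR : GermSmooth E R x :=
    GermSmooth.sum fun i _ => (hT i).clm_comp (GermSmooth.const (P i) x)
  have hRx : R x = 1 := by
    ext1 v
    simp only [R, hTx, sum_apply]
    exact hsum v
  refine ⟨R, hR, hRx, ?_⟩
  have hall : ∀ᶠ y in 𝓝 x, ∀ i ∈ J, (A i x).map (T i y).toLinearMap = A i y :=
    (Filter.eventually_all_finset J).mpr fun i _ => (hTe i).mono fun y hy => hy.2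
  filter_upwards [hR.eventually_isUnit hRx, hall] with y hu hy
  refine ⟨hu, fun i a ha => ?_⟩
  by_cases hi : i ∈ J
  · have e : R y a = T i y a := by
      simp only [R, sum_apply]
      rw [Finset.sum_eq_single i]
      · exact congrArg (T i y) (projOp_of_mem h ha)
      · intro j _ hj
        have : P j a = 0 := projOp_of_mem_ne h (Ne.symm hj) ha
        rw [ContinuousLinearMap.comp_apply, this, map_zero]
      · exact fun h' => absurd hi h'
    rw [e, ← hy i hi]
    exact ⟨a, ha, rfl⟩
  · rw [hJ i hi, Submodule.mem_bot] at ha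
    rw [ha, map_zero]
    exact Submodule.zero_mem _

theorem germSmooth_diagOp {ι : Type*} [DecidableEq ι] {A : ι → S → Submodule ℂ (Fin n → ℂ)}
    (hA : ∀ i, SmoothFamily E (A i) x) (h : DirectSum.IsInternal fun i => A i x)
    (c : ι → ℂ) {M : S → (Fin n → ℂ) →L[ℂ] (Fin n → ℂ)}
    (hM : ∀ᶠ y in 𝓝 x, ∀ i, ∀ a ∈ A i y, M y a = c i • a) : GermSmooth E M x := by
  obtain ⟨T, hT, hTx, hTe⟩ := exists_adapted_trivialization hA h
  have h1 : GermSmooth E (fun y => ((T y).comp (M x)).comp (Ring.inverse (T y))) x :=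
    (hT.clm_comp (GermSmooth.const _ x)).clm_comp
      (hT.ringInverse (by rw [hTx]; exact isUnit_one))
  refine h1.congr ?_
  filter_upwards [hTe, hM] with y hy hMy
  -- In an adapted trivialization the diagonal operator is constant, so M_y = T_y M_x T_y⁻¹ and
  -- smoothness of T suffices.
  have e : (M y).comp (T y) = (T y).comp (M x) := by
    have : ((M y).comp (T y)).toLinearMap = ((T y).comp (M x)).toLinearMap := by
      refine linearMap_ext_of_isInternal h fun i a ha => ?_
      change M y (T y a) = T y (M x a)
      rw [hM.self_of_nhds i a ha, hMy i _ (hy.2 i a ha), map_smul]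
    exact ContinuousLinearMap.coe_injective this
  rw [← e]
  ext1 v
  simp only [ContinuousLinearMap.comp_apply]
  rw [apply_ringInverse_apply hy.1]

end Families

/-! ### Type decomposition of real-linear maps -/

section Parts

variable {E M M' : Type*} [AddCommGroup E] [Module ℂ E] [AddCommGroup M] [Module ℂ M]
  [AddCommGroup M'] [Module ℂ M']

theorem part10_apply (A : E →ₗ[ℝ] M) (v : E) :
    part10 A v = (2⁻¹ : ℂ) • (A v - Complex.I • A (Complex.I • v)) := rfl

theorem part01_apply (A : E →ₗ[ℝ] M) (v : E) :
    part01 A v = (2⁻¹ : ℂ) • (A v + Complex.I • A (Complex.I • v)) := rfl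

theorem part10_mem {A : E →ₗ[ℝ] M} {C : Submodule ℂ M} (h : ∀ v, A v ∈ C) (v : E) :
    part10 A v ∈ C :=
  C.smul_mem _ (C.sub_mem (h _) (C.smul_mem _ (h _)))

theorem part01_mem {A : E →ₗ[ℝ] M} {C : Submodule ℂ M} (h : ∀ v, A v ∈ C) (v : E) :
    part01 A v ∈ C :=
  C.smul_mem _ (C.add_mem (h _) (C.smul_mem _ (h _)))

theorem part01_eq_zero_of_linear {A : E →ₗ[ℝ] M}
    (h : ∀ v, A (Complex.I • v) = Complex.I • A v) (v : E) : part01 A v = 0 := by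
  rw [part01_apply, h, smul_smul, Complex.I_mul_I]
  module

end Parts

section Bundle

variable {E : Type*} [NormedAddCommGroup E] [NormedSpace ℂ E]
  {S : Type u} [TopologicalSpace S] [ChartedSpace E S] {L : LocalSystem.{u, w} ℂ S}

/-! ### Flat coordinates -/

namespace LocalSystem

variable (L) in
open Classical in
/-- The inverse of the flat trivialization at `x` (zero outside of its domain). -/
def trivInv (x y : S) : (Fin (L.rank x) → ℂ) →ₗ[ℂ] L.Fiber y :=
  if h : y ∈ L.baseSet x then
    (LinearEquiv.ofBijective (L.triv x y) (L.triv_bijective x y h)).symm.toLinearMap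
  else 0

theorem triv_trivInv {x y : S} (h : y ∈ L.baseSet x) (a : Fin (L.rank x) → ℂ) :
    L.triv x y (L.trivInv x y a) = a := by
  rw [trivInv, dif_pos h]
  exact (LinearEquiv.ofBijective (L.triv x y) (L.triv_bijective x y h)).apply_symm_apply a

theorem trivInv_triv {x y : S} (h : y ∈ L.baseSet x) (a : L.Fiber y) :
    L.trivInv x y (L.triv x y a) = a :=
  (L.triv_bijective x y h).1 (triv_trivInv h _)

theorem baseSet_mem_nhds (x : S) {y : S} (h : y ∈ L.baseSet x) : L.baseSet x ∈ 𝓝 y :=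
  (L.isOpen_baseSet x).mem_nhds h

theorem eventually_mem_baseSet (x : S) : ∀ᶠ y in 𝓝 x, y ∈ L.baseSet x :=
  baseSet_mem_nhds x (L.mem_baseSet x)

theorem finiteDimensional_fiber (L : LocalSystem.{u, w} ℂ S) (x : S) :
    FiniteDimensional ℂ (L.Fiber x) :=
  Module.Finite.equiv
    (LinearEquiv.ofBijective (L.triv x x) (L.triv_bijective x x (L.mem_baseSet x))).symm

/-- The section with given components in the flat trivialization at `x`. -/
def secOf (x : S) (g : S → Fin (L.rank x) → ℂ) : L.Sec := fun y => L.trivInv x y (g y)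

theorem coord_secOf {x y : S} (h : y ∈ L.baseSet x) (g : S → Fin (L.rank x) → ℂ) :
    coord x (secOf (L := L) x g) y = g y :=
  triv_trivInv h _

theorem eventually_coord_secOf {x y : S} (h : y ∈ L.baseSet x) (g : S → Fin (L.rank x) → ℂ) :
    coord x (secOf (L := L) x g) =ᶠ[𝓝 y] g := by
  filter_upwards [baseSet_mem_nhds x h] with z hz using coord_secOf hz g

theorem exists_transition {x y : S} (h : y ∈ L.baseSet x) :
    ∃ A : (Fin (L.rank x) → ℂ) →L[ℂ] (Fin (L.rank y) → ℂ),
      ∀ᶠ z in 𝓝 y, ∀ a, L.triv y z a = A (L.triv x z a) := by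
  obtain ⟨A, hA⟩ := L.transition x y y ⟨h, L.mem_baseSet y⟩
  refine ⟨LinearMap.toContinuousLinearMap A, ?_⟩
  filter_upwards [hA] with z hz a
  rw [hz]
  rfl

theorem exists_transition' {x y : S} (h : y ∈ L.baseSet x) :
    ∃ A : (Fin (L.rank y) → ℂ) →L[ℂ] (Fin (L.rank x) → ℂ),
      ∀ᶠ z in 𝓝 y, ∀ a, L.triv x z a = A (L.triv y z a) := by
  obtain ⟨A, hA⟩ := L.transition y x y ⟨L.mem_baseSet y, h⟩
  refine ⟨LinearMap.toContinuousLinearMap A, ?_⟩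
  filter_upwards [hA] with z hz a
  rw [hz]
  rfl

end LocalSystem

open LocalSystem

theorem smoothNear_iff {σ : L.Sec} {x : S} :
    SmoothNear E σ x ↔ GermSmooth E (coord x σ) x := Iff.rfl

theorem smoothNear_iff_of_mem {σ : L.Sec} {x y : S} (h : y ∈ L.baseSet x) :
    SmoothNear E σ y ↔ GermSmooth E (coord x σ) y := by
  constructor
  · intro hσ
    obtain ⟨A, hA⟩ := exists_transition' h
    refine (GermSmooth.comp (φ := A) (A.restrictScalars ℝ).contDiff hσ).congr ?_
    filter_upwards [hA] with z hz using hz _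
  · intro hσ
    obtain ⟨A, hA⟩ := exists_transition h
    refine (GermSmooth.comp (φ := A) (A.restrictScalars ℝ).contDiff hσ).congr ?_
    filter_upwards [hA] with z hz using hz _

theorem SmoothNear.congr {σ σ' : L.Sec} {x : S} (h : SmoothNear E σ x)
    (e : ∀ᶠ y in 𝓝 x, σ' y = σ y) : SmoothNear E σ' x := by
  refine GermSmooth.congr h ?_
  filter_upwards [e] with y hy
  simp only [coord, hy]

theorem coord_add (x : S) (σ σ' : L.Sec) :
    coord x (σ + σ') = fun y => coord x σ y + coord x σ' y := by
  funext y
  simp [coord]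

theorem coord_sub (x : S) (σ σ' : L.Sec) :
    coord x (σ - σ') = fun y => coord x σ y - coord x σ' y := by
  funext y
  simp [coord]

theorem coord_smul (x : S) (g : S → ℂ) (σ : L.Sec) :
    coord x (fun y => g y • σ y) = fun y => g y • coord x σ y := by
  funext y
  simp [coord]

theorem SmoothNear.add {σ σ' : L.Sec} {x : S} (h : SmoothNear E σ x) (h' : SmoothNear E σ' x) :
    SmoothNear E (σ + σ') x := by
  rw [smoothNear_iff, coord_add]
  exact GermSmooth.add h h'

theorem SmoothNear.sub {σ σ' : L.Sec} {x : S} (h : SmoothNear E σ x) (h' : SmoothNear E σ' x) :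
    SmoothNear E (σ - σ') x := by
  rw [smoothNear_iff, coord_sub]
  exact GermSmooth.sub h h'

theorem SmoothNear.zero (x : S) : SmoothNear E (0 : L.Sec) x := by
  have e : coord x (0 : L.Sec) = fun _ => 0 := by
    funext y
    simp [coord]
  rw [smoothNear_iff, e]
  exact GermSmooth.const 0 x

theorem SmoothNear.sum {ι : Type*} {s : Finset ι} {f : ι → L.Sec} {x : S}
    (h : ∀ i ∈ s, SmoothNear E (f i) x) : SmoothNear E (∑ i ∈ s, f i) x :=
  Finset.sum_induction f (fun σ => SmoothNear E σ x) (fun _ _ => SmoothNear.add)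
    (SmoothNear.zero x) h

theorem smoothNear_secOf {x y : S} (h : y ∈ L.baseSet x) {g : S → Fin (L.rank x) → ℂ}
    (hg : GermSmooth E g y) : SmoothNear E (secOf (L := L) x g) y :=
  (smoothNear_iff_of_mem h).mpr (hg.congr (eventually_coord_secOf h g))

/-! ### The connection in flat coordinates -/

theorem triv_nabla_self (σ : L.Sec) (x : S) (v : E) :
    L.triv x x (nabla E σ x v) = dAt E (coord x σ) x v :=
  (LinearEquiv.ofBijective (L.triv x x)
    (L.triv_bijective x x (L.mem_baseSet x))).apply_symm_apply _

/-- The connection at y is defined by the trivialization centred at y. The transition matrix is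
locally constant, so any other trivialization gives the same derivative. -/
theorem triv_nabla {σ : L.Sec} {x y : S} (h : y ∈ L.baseSet x) (hσ : SmoothNear E σ y) (v : E) :
    L.triv x y (nabla E σ y v) = dAt E (coord x σ) y v := by
  obtain ⟨A, hA⟩ := exists_transition' h
  have e : coord x σ =ᶠ[𝓝 y] fun z => A.restrictScalars ℝ (coord y σ z) := by
    filter_upwards [hA] with z hz using hz _
  rw [dAt_congr e, dAt_clm_comp hσ, hA.self_of_nhds, triv_nabla_self]
  rfl

theorem nabla_congr {σ σ' : L.Sec} {x : S} (e : ∀ᶠ y in 𝓝 x, σ' y = σ y) :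
    nabla E σ' x = nabla E σ x := by
  have e' : coord x σ' =ᶠ[𝓝 x] coord x σ := by
    filter_upwards [e] with y hy
    simp only [coord, hy]
  refine LinearMap.ext fun v => (L.triv_bijective x x (L.mem_baseSet x)).1 ?_
  rw [triv_nabla_self, triv_nabla_self, dAt_congr e']

theorem nabla_add {σ σ' : L.Sec} {x : S} (h : SmoothNear E σ x) (h' : SmoothNear E σ' x) :
    nabla E (σ + σ') x = nabla E σ x + nabla E σ' x := by
  refine LinearMap.ext fun v => (L.triv_bijective x x (L.mem_baseSet x)).1 ?_
  rw [LinearMap.add_apply, map_add, triv_nabla_self, triv_nabla_self, triv_nabla_self, coord_add,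
    dAt_add h h']
  rfl

theorem nabla_sub {σ σ' : L.Sec} {x : S} (h : SmoothNear E σ x) (h' : SmoothNear E σ' x) :
    nabla E (σ - σ') x = nabla E σ x - nabla E σ' x := by
  refine LinearMap.ext fun v => (L.triv_bijective x x (L.mem_baseSet x)).1 ?_
  rw [LinearMap.sub_apply, map_sub, triv_nabla_self, triv_nabla_self, triv_nabla_self, coord_sub,
    dAt_sub h h']
  rfl

theorem nabla_smul {g : S → ℂ} {σ : L.Sec} {x : S} (hg : GermSmooth E g x)
    (h : SmoothNear E σ x) (v : E) :
    nabla E (fun y => g y • σ y) x v = dAt E g x v • σ x + g x • nabla E σ x v := by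
  refine (L.triv_bijective x x (L.mem_baseSet x)).1 ?_
  rw [map_add, map_smul, map_smul, triv_nabla_self, triv_nabla_self, coord_smul, dAt_smul hg h]
  rfl

theorem nabla10_apply (σ : L.Sec) (x : S) (v : E) : nabla10 E σ x v =
    (2⁻¹ : ℂ) • (nabla E σ x v - Complex.I • nabla E σ x (Complex.I • v)) := rfl

theorem nabla01_apply (σ : L.Sec) (x : S) (v : E) : nabla01 E σ x v =
    (2⁻¹ : ℂ) • (nabla E σ x v + Complex.I • nabla E σ x (Complex.I • v)) := rfl

theorem nabla10_sub {σ σ' : L.Sec} {x : S} (h : SmoothNear E σ x) (h' : SmoothNear E σ' x)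
    (v : E) : nabla10 E (σ - σ') x v = nabla10 E σ x v - nabla10 E σ' x v := by
  simp only [nabla10_apply, nabla_sub h h', LinearMap.sub_apply]
  module

theorem nabla01_sub {σ σ' : L.Sec} {x : S} (h : SmoothNear E σ x) (h' : SmoothNear E σ' x)
    (v : E) : nabla01 E (σ - σ') x v = nabla01 E σ x v - nabla01 E σ' x v := by
  simp only [nabla01_apply, nabla_sub h h', LinearMap.sub_apply]
  module

theorem nabla10_add {σ σ' : L.Sec} {x : S} (h : SmoothNear E σ x) (h' : SmoothNear E σ' x)
    (v : E) : nabla10 E (σ + σ') x v = nabla10 E σ x v + nabla10 E σ' x v := by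
  simp only [nabla10_apply, nabla_add h h', LinearMap.add_apply]
  module

theorem nabla01_add {σ σ' : L.Sec} {x : S} (h : SmoothNear E σ x) (h' : SmoothNear E σ' x)
    (v : E) : nabla01 E (σ + σ') x v = nabla01 E σ x v + nabla01 E σ' x v := by
  simp only [nabla01_apply, nabla_add h h', LinearMap.add_apply]
  module

theorem nabla_zero (x : S) (v : E) : nabla E (0 : L.Sec) x v = 0 := by
  have h := nabla_sub (SmoothNear.zero (E := E) (L := L) x) (SmoothNear.zero x)
  rw [sub_self, sub_self] at h
  rw [h, LinearMap.zero_apply]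

theorem nabla10_zero (x : S) (v : E) : nabla10 E (0 : L.Sec) x v = 0 := by
  simp [nabla10_apply, nabla_zero]

theorem nabla01_zero (x : S) (v : E) : nabla01 E (0 : L.Sec) x v = 0 := by
  simp [nabla01_apply, nabla_zero]

/-! ### Smooth families of endomorphisms -/

variable (L) in
/-- A (not necessarily continuous) endomorphism of `L`. -/
abbrev EndSec : Type _ := ∀ s : S, Module.End ℂ (L.Fiber s)

/-- The matrix of an endomorphism in the flat trivialization at `x`. -/
def coordEnd (x : S) (Φ : EndSec L) (y : S) : (Fin (L.rank x) → ℂ) →L[ℂ] (Fin (L.rank x) → ℂ) :=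
  LinearMap.toContinuousLinearMap (L.triv x y ∘ₗ Φ y ∘ₗ L.trivInv x y)

variable (E) in
/-- An endomorphism is smooth near `x`. -/
def SmoothEnd (Φ : EndSec L) (x : S) : Prop := GermSmooth E (coordEnd x Φ) x

variable (E) in
/-- The connection induced on endomorphisms. -/
def nablaEnd (Φ : EndSec L) (x : S) : E →ₗ[ℝ] Module.End ℂ (L.Fiber x) where
  toFun v := L.trivInv x x ∘ₗ (dAt E (coordEnd x Φ) x v).toLinearMap ∘ₗ L.triv x x
  map_add' u v := by
    ext a
    simp
  map_smul' c v := by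
    ext a
    have h : (dAt E (coordEnd x Φ) x (c • v)) (L.triv x x a) =
        (c : ℂ) • (dAt E (coordEnd x Φ) x v) (L.triv x x a) := by
      rw [map_smul]
      rfl
    change L.trivInv x x ((dAt E (coordEnd x Φ) x (c • v)) (L.triv x x a)) =
      c • L.trivInv x x ((dAt E (coordEnd x Φ) x v) (L.triv x x a))
    rw [h, map_smul]
    rfl

theorem coordEnd_apply {x y : S} (h : y ∈ L.baseSet x) (Φ : EndSec L) (a : L.Fiber y) :
    coordEnd x Φ y (L.triv x y a) = L.triv x y (Φ y a) := by
  change L.triv x y (Φ y (L.trivInv x y (L.triv x y a))) = _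
  rw [trivInv_triv h]

theorem eventually_coord_end {x y : S} (h : y ∈ L.baseSet x) (Φ : EndSec L) (σ : L.Sec) :
    coord x (fun z => Φ z (σ z)) =ᶠ[𝓝 y] fun z => coordEnd x Φ z (coord x σ z) := by
  filter_upwards [baseSet_mem_nhds x h] with z hz
  exact (coordEnd_apply hz Φ (σ z)).symm

theorem SmoothEnd.apply {Φ : EndSec L} {σ : L.Sec} {x : S} (hΦ : SmoothEnd E Φ x)
    (hσ : SmoothNear E σ x) : SmoothNear E (fun y => Φ y (σ y)) x :=
  GermSmooth.congr (hΦ.clm_apply hσ) (eventually_coord_end (L.mem_baseSet x) Φ σ)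

theorem triv_nablaEnd_self (Φ : EndSec L) (x : S) (v : E) (a : L.Fiber x) :
    L.triv x x (nablaEnd E Φ x v a) = dAt E (coordEnd x Φ) x v (L.triv x x a) :=
  triv_trivInv (L.mem_baseSet x) _

theorem nabla_end_apply {Φ : EndSec L} {σ : L.Sec} {x : S} (hΦ : SmoothEnd E Φ x)
    (hσ : SmoothNear E σ x) (v : E) :
    nabla E (fun y => Φ y (σ y)) x v = nablaEnd E Φ x v (σ x) + Φ x (nabla E σ x v) := by
  refine (L.triv_bijective x x (L.mem_baseSet x)).1 ?_
  rw [map_add, triv_nabla_self, triv_nablaEnd_self, ← coordEnd_apply (L.mem_baseSet x),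
    triv_nabla_self, dAt_congr (eventually_coord_end (L.mem_baseSet x) Φ σ), dAt_clm_apply hΦ hσ]
  rfl

theorem nabla10_end_apply {Φ : EndSec L} {σ : L.Sec} {x : S} (hΦ : SmoothEnd E Φ x)
    (hσ : SmoothNear E σ x) (v : E) :
    nabla10 E (fun y => Φ y (σ y)) x v =
      part10 (nablaEnd E Φ x) v (σ x) + Φ x (nabla10 E σ x v) := by
  simp only [nabla10_apply, part10_apply, nabla_end_apply hΦ hσ, LinearMap.smul_apply,
    LinearMap.sub_apply, map_smul, map_sub]
  module

theorem nabla01_end_apply {Φ : EndSec L} {σ : L.Sec} {x : S} (hΦ : SmoothEnd E Φ x)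
    (hσ : SmoothNear E σ x) (v : E) :
    nabla01 E (fun y => Φ y (σ y)) x v =
      part01 (nablaEnd E Φ x) v (σ x) + Φ x (nabla01 E σ x v) := by
  simp only [nabla01_apply, part01_apply, nabla_end_apply hΦ hσ, LinearMap.smul_apply,
    LinearMap.add_apply, map_smul, map_add]
  module

theorem triv_nablaEnd {Φ : EndSec L} {x y : S} (h : y ∈ L.baseSet x) (hy : SmoothEnd E Φ y)
    (hxy : GermSmooth E (coordEnd x Φ) y) (v : E) (a : L.Fiber y) :
    L.triv x y (nablaEnd E Φ y v a) = dAt E (coordEnd x Φ) y v (L.triv x y a) := by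
  -- Test on the flat section through a: its own derivative vanishes, so the Leibniz rule leaves
  -- only the derivative of Φ.
  set σ : L.Sec := secOf x fun _ => L.triv x y a with hσd
  have hσ : SmoothNear E σ y := smoothNear_secOf h (GermSmooth.const _ y)
  have hc : coord x σ =ᶠ[𝓝 y] fun _ => L.triv x y a := eventually_coord_secOf h _
  have hσy : σ y = a := trivInv_triv h a
  have h0 : nabla E σ y v = 0 := by
    refine (L.triv_bijective x y h).1 ?_
    rw [triv_nabla h hσ, dAt_congr hc, dAt_const, map_zero]
    rfl
  have h1 := nabla_end_apply hy hσ v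
  rw [h0, map_zero, add_zero, hσy] at h1
  have e : coord x (fun z => Φ z (σ z)) =ᶠ[𝓝 y]
      fun z => coordEnd x Φ z ((fun _ => L.triv x y a) z) := by
    filter_upwards [eventually_coord_end h Φ σ, hc] with z hz hcz
    rw [hz, hcz]
  rw [← h1, triv_nabla h (hy.apply hσ), dAt_congr e, dAt_clm_apply hxy (GermSmooth.const _ y),
    dAt_const]
  simp

/-! ### Smooth subbundles -/

variable (E) in
/-- `A` is a smooth subbundle near `x`: vectors in `A x` extend to smooth sections and the
dimension is locally constant. -/
def IsSubbundleAt (A : ∀ s, Submodule ℂ (L.Fiber s)) (x : S) : Prop :=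
  (∀ a ∈ A x, ∃ σ : L.Sec, SmoothNear E σ x ∧ σ x = a ∧ ∀ᶠ y in 𝓝 x, σ y ∈ A y) ∧
    ∀ᶠ y in 𝓝 x, Module.finrank ℂ (A y) = Module.finrank ℂ (A x)

theorem finrank_map_triv {x y : S} (h : y ∈ L.baseSet x) (A : Submodule ℂ (L.Fiber y)) :
    Module.finrank ℂ (A.map (L.triv x y)) = Module.finrank ℂ A :=
  (Submodule.equivMapOfInjective _ (L.triv_bijective x y h).1 A).finrank_eq.symm

theorem triv_mem_map {x y : S} (h : y ∈ L.baseSet x) {A : Submodule ℂ (L.Fiber y)}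
    {a : L.Fiber y} : L.triv x y a ∈ A.map (L.triv x y) ↔ a ∈ A :=
  ⟨fun ⟨_, hb, e⟩ => (L.triv_bijective x y h).1 e ▸ hb, fun ha => ⟨a, ha, rfl⟩⟩

theorem isSubbundleAt_iff {A : ∀ s, Submodule ℂ (L.Fiber s)} {x : S} :
    IsSubbundleAt E A x ↔ SmoothFamily E (fun y => (A y).map (L.triv x y)) x := by
  have hx := L.mem_baseSet x
  refine and_congr ⟨fun H a ha => ?_, fun H a ha => ?_⟩ ⟨fun H => ?_, fun H => ?_⟩
  · obtain ⟨b, hb, rfl⟩ := ha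
    obtain ⟨σ, hσ, hσx, hσA⟩ := H b hb
    refine ⟨coord x σ, hσ, by simp only [coord, hσx], ?_⟩
    filter_upwards [hσA] with y hy using ⟨_, hy, rfl⟩
  · obtain ⟨g, hg, hgx, hgA⟩ := H (L.triv x x a) ⟨a, ha, rfl⟩
    refine ⟨secOf x g, smoothNear_secOf hx hg, ?_, ?_⟩
    · rw [secOf, hgx, trivInv_triv hx]
    · filter_upwards [hgA, eventually_mem_baseSet x] with y hy hyx
      rw [← triv_mem_map hyx, secOf, triv_trivInv hyx]
      exact hy
  · filter_upwards [H, eventually_mem_baseSet x] with y hy hyx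
    rw [finrank_map_triv hyx, finrank_map_triv hx, hy]
  · filter_upwards [H, eventually_mem_baseSet x] with y hy hyx
    rwa [finrank_map_triv hyx, finrank_map_triv hx] at hy

theorem IsSubbundleAt.nabla_mem {A : ∀ s, Submodule ℂ (L.Fiber s)} {x : S}
    (hA : IsSubbundleAt E A x) {σ : L.Sec} (hσ : SmoothNear E σ x)
    (hσA : ∀ᶠ y in 𝓝 x, σ y ∈ A y) (h0 : σ x = 0) (v : E) : nabla E σ x v ∈ A x := by
  rw [← triv_mem_map (L.mem_baseSet x), triv_nabla_self]
  refine (isSubbundleAt_iff.mp hA).dAt_mem hσ ?_ (by simp [coord, h0]) v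
  filter_upwards [hσA] with y hy using ⟨_, hy, rfl⟩

theorem IsSubbundleAt.inf {A B : ∀ s, Submodule ℂ (L.Fiber s)} {x : S}
    (hA : IsSubbundleAt E A x) (hB : IsSubbundleAt E B x)
    (hd : ∀ᶠ y in 𝓝 x, Module.finrank ℂ ↥(A y ⊓ B y) = Module.finrank ℂ ↥(A x ⊓ B x)) :
    IsSubbundleAt E (fun y => A y ⊓ B y) x := by
  have hmap : ∀ y ∈ L.baseSet x, (A y ⊓ B y).map (L.triv x y) =
      (A y).map (L.triv x y) ⊓ (B y).map (L.triv x y) := fun y hy =>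
    Submodule.map_inf _ (L.triv_bijective x y hy).1
  have hx := L.mem_baseSet x
  have h1 := (isSubbundleAt_iff.mp hA).inf (isSubbundleAt_iff.mp hB) (by
    filter_upwards [hd, eventually_mem_baseSet x] with y hy hyx
    rw [← hmap y hyx, ← hmap x hx, finrank_map_triv hyx, finrank_map_triv hx, hy])
  refine ⟨fun a ha => ?_, hd⟩
  obtain ⟨g, hg, hgx, hgA⟩ := h1.1 (L.triv x x a) ⟨⟨a, ha.1, rfl⟩, ⟨a, ha.2, rfl⟩⟩
  refine ⟨secOf x g, smoothNear_secOf hx hg, ?_, ?_⟩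
  · rw [secOf, hgx, trivInv_triv hx]
  · filter_upwards [hgA, eventually_mem_baseSet x] with y hy hyx
    rw [← triv_mem_map hyx, secOf, triv_trivInv hyx, hmap y hyx]
    exact hy

theorem eventually_linearIndependent {x : S} {ι : Type*} [Finite ι] {f : ι → L.Sec}
    (hf : ∀ j, SmoothNear E (f j) x) (hx : LinearIndependent ℂ fun j => f j x) :
    ∀ᶠ y in 𝓝 x, LinearIndependent ℂ fun j => f j y := by
  have hc : ContinuousAt (fun y j => coord x (f j) y) x :=
    continuousAt_pi.mpr fun j => GermSmooth.continuousAt (hf j)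
  have hli : LinearIndependent ℂ fun j => coord x (f j) x :=
    hx.map' (L.triv x x) (LinearMap.ker_eq_bot.mpr (L.triv_bijective x x (L.mem_baseSet x)).1)
  filter_upwards [hc.eventually (isOpen_setOfPred_linearIndependent.mem_nhds hli)] with y hy
  exact LinearIndependent.of_comp (L.triv x y) hy

theorem isSmoothSubbundle_of_forall {A : ∀ s, Submodule ℂ (L.Fiber s)}
    (hA : ∀ x, IsSubbundleAt E A x) : IsSmoothSubbundle E A := by
  intro x
  have := fun y => L.finiteDimensional_fiber y
  set b := Module.finBasis ℂ (A x)
  choose f hf hfx hfA using fun i => (hA x).1 (b i) (b i).2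
  refine ⟨_, f, hf, ?_⟩
  have hli : LinearIndependent ℂ fun j => f j x := by
    simp only [hfx]
    exact b.linearIndependent.map' (A x).subtype (Submodule.ker_subtype _)
  filter_upwards [eventually_linearIndependent hf hli, Filter.eventually_all.mpr hfA, (hA x).2]
    with y hy hyA hyd
  refine ⟨hy, Submodule.eq_of_le_of_finrank_eq ?_ ?_⟩
  · rw [Submodule.span_le]
    rintro _ ⟨j, rfl⟩
    exact hyA j
  · rw [finrank_span_eq_card hy, hyd, Fintype.card_fin]

theorem smoothEnd_diagOp {ι : Type*} [DecidableEq ι] {A : ι → ∀ s, Submodule ℂ (L.Fiber s)}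
    {x : S} (hA : ∀ i, IsSubbundleAt E (A i) x) (h : ∀ s, DirectSum.IsInternal fun i => A i s)
    (c : ι → ℂ) : SmoothEnd E (fun s => diagOp (h s) c) x := by
  have hx := L.mem_baseSet x
  refine germSmooth_diagOp (fun i => isSubbundleAt_iff.mp (hA i)) ?_ c ?_
  · set e := LinearEquiv.ofBijective (L.triv x x) (L.triv_bijective x x hx)
    rw [DirectSum.isInternal_submodule_iff_iSupIndep_and_iSup_eq_top]
    have h1 := (DirectSum.isInternal_submodule_iff_iSupIndep_and_iSup_eq_top _).mp (h x)
    refine ⟨?_, ?_⟩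
    · exact h1.1.map_orderIso (Submodule.orderIsoMapComap e)
    · rw [← Submodule.map_iSup, h1.2, Submodule.map_top]
      exact LinearMap.range_eq_top.mpr (L.triv_bijective x x hx).2
  · filter_upwards [eventually_mem_baseSet x] with y hy i a ha
    obtain ⟨b, hb, rfl⟩ := ha
    rw [coordEnd_apply hy, diagOp_apply (h y) c hb, map_smul]

end Bundle

/-! ### Holomorphic sections -/

section Holomorphic

variable {E : Type*} [NormedAddCommGroup E] [NormedSpace ℂ E]
  {S : Type u} [TopologicalSpace S] [ChartedSpace E S]

open LocalSystem

theorem contMDiffAt_real_of_complex {n : ℕ} {g : S → Fin n → ℂ} {x : S}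
    (h : ContMDiffAt 𝓘(ℂ, E) 𝓘(ℂ, Fin n → ℂ) ω g x) :
    ContMDiffAt 𝓘(ℝ, E) 𝓘(ℝ, Fin n → ℂ) ∞ g x := by
  rw [contMDiffAt_iff] at h ⊢
  exact ⟨h.1, (h.2.restrict_scalars ℝ).of_le le_top⟩

theorem dAt_smul_of_complex {n : ℕ} {g : S → Fin n → ℂ} {x : S}
    (h : ContMDiffAt 𝓘(ℂ, E) 𝓘(ℂ, Fin n → ℂ) ω g x) (c : ℂ) (v : E) :
    dAt E g x (c • v) = c • dAt E g x v := by
  have h1 := (h.mdifferentiableAt (by simp)).hasMFDerivAt.2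
  simp only [mfld_simps] at h1
  have h2 : HasFDerivAt (inChart E x g)
      (show E →L[ℂ] (Fin n → ℂ) from mfderiv 𝓘(ℂ, E) 𝓘(ℂ, Fin n → ℂ) g x) (chartAt E x x) :=
    hasFDerivWithinAt_univ.mp h1
  rw [dAt_eq_of_hasFDerivAt (contMDiffAt_real_of_complex h) (h2.restrictScalars ℝ)]
  exact map_smul (show E →L[ℂ] (Fin n → ℂ) from mfderiv 𝓘(ℂ, E) 𝓘(ℂ, Fin n → ℂ) g x) c v

variable {L : LocalSystem.{u, w} ℂ S}

theorem HolNear.smoothNear {σ : L.Sec} {x : S} (h : HolNear E σ x) : SmoothNear E σ x := by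
  filter_upwards [h] with y hy using contMDiffAt_real_of_complex hy

theorem HolNear.nabla01_eq_zero {σ : L.Sec} {x : S} (h : HolNear E σ x) (v : E) :
    nabla01 E σ x v = 0 := by
  refine part01_eq_zero_of_linear (fun u => (L.triv_bijective x x (L.mem_baseSet x)).1 ?_) v
  rw [triv_nabla_self, (L.triv x x).map_smul, triv_nabla_self,
    dAt_smul_of_complex h.self_of_nhds]

theorem HolNear.eventually {σ : L.Sec} {x : S} (h : HolNear E σ x) :
    ∀ᶠ y in 𝓝 x, HolNear E σ y := by
  filter_upwards [eventually_eventually_nhds.mpr h, eventually_mem_baseSet x] with y hy hyx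
  obtain ⟨A, hA⟩ := exists_transition hyx
  filter_upwards [hy, eventually_eventually_nhds.mpr hA] with z hz hAz
  refine (ContMDiffAt.comp z (A.contDiff.contDiffAt.contMDiffAt) hz).congr_of_eventuallyEq ?_
  filter_upwards [hAz] with t ht using ht _

theorem HolNear.linearCombination {m : ℕ} {f : Fin m → L.Sec} {x : S}
    (hf : ∀ j, HolNear E (f j) x) (c : Fin m → ℂ) :
    HolNear E (fun y => ∑ j, c j • f j y) x := by
  filter_upwards [Filter.eventually_all.mpr hf] with y hy
  have h1 : ContMDiffAt 𝓘(ℂ, E) 𝓘(ℂ, Fin m → Fin (L.rank x) → ℂ) ω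
      (fun z j => coord x (f j) z) y := contMDiffAt_pi_space.mpr hy
  have h2 : ContDiff ℂ ω fun p : Fin m → Fin (L.rank x) → ℂ => ∑ j, c j • p j :=
    ContDiff.sum fun j _ => (contDiff_apply ℂ _ j).const_smul (c j)
  have e : coord x (fun y => ∑ j, c j • f j y) =
      (fun p : Fin m → Fin (L.rank x) → ℂ => ∑ j, c j • p j) ∘ fun z j => coord x (f j) z := by
    funext z
    simp [coord]
  rw [e]
  exact h2.contDiffAt.contMDiffAt.comp y h1

theorem IsHolSubbundle.exists_holNear {A : ∀ s, Submodule ℂ (L.Fiber s)}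
    (hA : IsHolSubbundle E A) {x : S} {a : L.Fiber x} (ha : a ∈ A x) :
    ∃ σ : L.Sec, HolNear E σ x ∧ σ x = a ∧ ∀ᶠ y in 𝓝 x, σ y ∈ A y := by
  obtain ⟨m, f, hf, hev⟩ := hA x
  rw [← hev.self_of_nhds.2] at ha
  obtain ⟨c, hc⟩ := (Submodule.mem_span_range_iff_exists_fun ℂ).mp ha
  refine ⟨_, HolNear.linearCombination hf c, hc, ?_⟩
  filter_upwards [hev] with y hy
  rw [← hy.2]
  exact Submodule.sum_mem _ fun j _ => Submodule.smul_mem _ _ (Submodule.subset_span ⟨j, rfl⟩)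

theorem eventually_finrank_eq_of_frame {V : S → Type*} [∀ s, AddCommGroup (V s)]
    [∀ s, Module ℂ (V s)] {A : ∀ s, Submodule ℂ (V s)} {x : S} {m : ℕ}
    {f : Fin m → ∀ s, V s} (hev : ∀ᶠ y in 𝓝 x, LinearIndependent ℂ (fun j => f j y) ∧
      Submodule.span ℂ (Set.range fun j => f j y) = A y) :
    ∀ᶠ y in 𝓝 x, Module.finrank ℂ (A y) = Module.finrank ℂ (A x) := by
  have h : ∀ᶠ y in 𝓝 x, Module.finrank ℂ (A y) = m := by
    filter_upwards [hev] with y hy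
    rw [← hy.2, finrank_span_eq_card hy.1, Fintype.card_fin]
  filter_upwards [h] with y hy
  rw [hy, h.self_of_nhds]

theorem IsHolSubbundle.isSubbundleAt {A : ∀ s, Submodule ℂ (L.Fiber s)}
    (hA : IsHolSubbundle E A) (x : S) : IsSubbundleAt E A x := by
  refine ⟨fun a ha => ?_, ?_⟩
  · obtain ⟨σ, hσ, hσx, hσA⟩ := hA.exists_holNear ha
    exact ⟨σ, hσ.smoothNear, hσx, hσA⟩
  · obtain ⟨m, f, -, hev⟩ := hA x
    exact eventually_finrank_eq_of_frame hev

/-- Compare σ with a holomorphic section g of A having the same value at x. The difference vanishes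
at x, so its derivative stays in A x, and ∇^{0,1}g = 0. -/
theorem IsHolSubbundle.nabla01_mem {A : ∀ s, Submodule ℂ (L.Fiber s)}
    (hA : IsHolSubbundle E A) {x : S} {σ : L.Sec} (hσ : SmoothNear E σ x)
    (hσA : ∀ᶠ y in 𝓝 x, σ y ∈ A y) (v : E) : nabla01 E σ x v ∈ A x := by
  obtain ⟨g, hg, hgx, hgA⟩ := hA.exists_holNear hσA.self_of_nhds
  have h := part01_mem ((hA.isSubbundleAt x).nabla_mem (hσ.sub hg.smoothNear)
    (by filter_upwards [hσA, hgA] with y h1 h2 using Submodule.sub_mem _ h1 h2)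
    (by simp [hgx])) v
  change nabla01 E (σ - g) x v ∈ A x at h
  rwa [nabla01_sub hσ hg.smoothNear, hg.nabla01_eq_zero, sub_zero] at h

/-- The same comparison extends Griffiths transversality from holomorphic to smooth sections. -/
theorem IsHolSubbundle.nabla_mem {A : ∀ s, Submodule ℂ (L.Fiber s)}
    (hA : IsHolSubbundle E A) {x : S} {B : Submodule ℂ (L.Fiber x)} (hAB : A x ≤ B)
    (hB : ∀ g : L.Sec, HolNear E g x → (∀ᶠ y in 𝓝 x, g y ∈ A y) → ∀ v : E, nabla E g x v ∈ B)
    {σ : L.Sec} (hσ : SmoothNear E σ x) (hσA : ∀ᶠ y in 𝓝 x, σ y ∈ A y) (v : E) :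
    nabla E σ x v ∈ B := by
  obtain ⟨g, hg, hgx, hgA⟩ := hA.exists_holNear hσA.self_of_nhds
  have h := hAB ((hA.isSubbundleAt x).nabla_mem (hσ.sub hg.smoothNear)
    (by filter_upwards [hσA, hgA] with y h1 h2 using Submodule.sub_mem _ h1 h2)
    (by simp [hgx]) v)
  rw [nabla_sub hσ hg.smoothNear, LinearMap.sub_apply] at h
  simpa using Submodule.add_mem _ h (hB g hg hgA v)

/-- A subbundle which is constant in flat trivializations. -/
def IsFlatSub (A : ∀ s, Submodule ℂ (L.Fiber s)) (x : S) : Prop :=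
  ∀ᶠ y in 𝓝 x, (A y).map (L.triv x y) = (A x).map (L.triv x x)

theorem IsFlatSub.isSubbundleAt {A : ∀ s, Submodule ℂ (L.Fiber s)} {x : S}
    (hA : IsFlatSub A x) : IsSubbundleAt E A x := by
  rw [isSubbundleAt_iff]
  refine ⟨fun a ha => ⟨fun _ => a, GermSmooth.const a x, rfl, ?_⟩, ?_⟩
  · filter_upwards [hA] with y hy
    rwa [hy]
  · filter_upwards [hA] with y hy
    exact congrArg (fun B : Submodule ℂ (Fin (L.rank x) → ℂ) => Module.finrank ℂ B) hy

theorem IsFlatSub.nabla_mem {A : ∀ s, Submodule ℂ (L.Fiber s)} {x : S} (hA : IsFlatSub A x)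
    {σ : L.Sec} (hσ : SmoothNear E σ x) (hσA : ∀ᶠ y in 𝓝 x, σ y ∈ A y) (v : E) :
    nabla E σ x v ∈ A x := by
  rw [← triv_mem_map (L.mem_baseSet x), triv_nabla_self]
  refine dAt_mem hσ ?_ v
  filter_upwards [hA, hσA] with y hy hσy
  rw [← hy]
  exact ⟨_, hσy, rfl⟩

end Holomorphic

/-! ### Complex conjugation of sections -/

section Conjugation

variable {E : Type*} [NormedAddCommGroup E] [NormedSpace ℂ E]
  {S : Type u} [TopologicalSpace S] [ChartedSpace E S] {V : LocalSystem.{u, w} ℚ S}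

open LocalSystem

/-- The complex conjugate of a section of the complexification. -/
def conjSec (σ : V.complexify.Sec) : V.complexify.Sec := fun s => conjC (V.Fiber s) (σ s)

/-- Complex conjugation on `ℂⁿ` as a real-linear map. -/
def conjVec (n : ℕ) : (Fin n → ℂ) →L[ℝ] (Fin n → ℂ) :=
  ContinuousLinearMap.pi fun i =>
    (Complex.conjCLE : ℂ →L[ℝ] ℂ).comp (ContinuousLinearMap.proj (R := ℝ) i)

theorem triv_conjC (x y : S) (t : ℂ ⊗[ℚ] V.Fiber y) :
    V.complexify.triv x y (conjC (V.Fiber y) t) = conjVec _ (V.complexify.triv x y t) := by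
  change TensorProduct.piScalarRight ℚ ℂ ℂ (Fin (V.rank x)) ((V.triv x y).baseChange ℂ _) =
    conjVec (V.rank x) (TensorProduct.piScalarRight ℚ ℂ ℂ (Fin (V.rank x))
      ((V.triv x y).baseChange ℂ t))
  induction t using TensorProduct.induction_on with
  | zero => simp
  | tmul z h =>
    ext i
    simp [conjVec]
  | add a b ha hb => simp only [map_add, ha, hb]

theorem coord_conjSec (x : S) (σ : V.complexify.Sec) :
    coord x (conjSec σ) = fun y => conjVec _ (coord x σ y) :=
  funext fun y => triv_conjC x y (σ y)

theorem SmoothNear.conjSec {σ : V.complexify.Sec} {x : S} (h : SmoothNear E σ x) :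
    SmoothNear E (conjSec σ) x := by
  rw [smoothNear_iff, coord_conjSec]
  exact GermSmooth.comp (conjVec _).contDiff h

/-- The flat trivializations are rational, so conjugation of sections is coordinatewise conjugation,
a constant real-linear map. Being antilinear, it exchanges the types (1,0) and (0,1). -/
theorem nabla_conjSec {σ : V.complexify.Sec} {x : S} (h : SmoothNear E σ x) (v : E) :
    nabla E (conjSec σ) x v = conjC (V.Fiber x) (nabla E σ x v) := by
  refine (V.complexify.triv_bijective x x (V.complexify.mem_baseSet x)).1 ?_
  refine Eq.trans ?_ (triv_conjC x x _).symm
  rw [triv_nabla_self, triv_nabla_self, coord_conjSec, dAt_clm_comp h]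
  rfl

theorem conjC_half_smul_add {H : Type*} [AddCommGroup H] [Module ℚ H] (a b : ℂ ⊗[ℚ] H) :
    conjC H ((2⁻¹ : ℂ) • (a + Complex.I • b)) =
      (2⁻¹ : ℂ) • (conjC H a - Complex.I • conjC H b) := by
  rw [LinearMap.map_smulₛₗ, map_add, LinearMap.map_smulₛₗ, map_inv₀, map_ofNat, Complex.conj_I,
    neg_smul, sub_eq_add_neg]

theorem nabla10_conjSec {σ : V.complexify.Sec} {x : S} (h : SmoothNear E σ x) (v : E) :
    nabla10 E (conjSec σ) x v = conjC (V.Fiber x) (nabla01 E σ x v) := by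
  rw [nabla10_apply, nabla01_apply, nabla_conjSec h, nabla_conjSec h]
  exact (conjC_half_smul_add _ _).symm

theorem nabla01_conjSec {σ : V.complexify.Sec} {x : S} (h : SmoothNear E σ x) (v : E) :
    nabla01 E (conjSec σ) x v = conjC (V.Fiber x) (nabla10 E σ x v) := by
  have h1 := nabla10_conjSec h.conjSec v
  have e : conjSec (conjSec σ) = σ := funext fun s => conjC_conjC (σ s)
  rw [e] at h1
  rw [h1]
  exact (conjC_conjC _).symm

theorem finrank_conjSub {H : Type*} [AddCommGroup H] [Module ℚ H]
    (A : Submodule ℂ (ℂ ⊗[ℚ] H)) : Module.finrank ℂ (conjSub A) = Module.finrank ℂ A := by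
  -- Conjugation is not complex-linear, so dimensions are compared over ℝ and then halved.
  have e : A ≃ₗ[ℝ] conjSub A :=
    { toFun := fun a => ⟨conjC H a, conjC_mem_conjSub.mpr a.2⟩
      invFun := fun a => ⟨conjC H a, mem_conjSub.mp a.2⟩
      map_add' := fun a b => Subtype.ext (by simp)
      map_smul' := fun c a => Subtype.ext (by
        have h := (conjC H).map_smulₛₗ (c : ℂ) (a : ℂ ⊗[ℚ] H)
        rw [Complex.conj_ofReal] at h
        exact h)
      left_inv := fun a => Subtype.ext (conjC_conjC _)
      right_inv := fun a => Subtype.ext (conjC_conjC _) }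
  have h1 := e.finrank_eq
  have h2 := Module.finrank_mul_finrank ℝ ℂ A
  have h3 := Module.finrank_mul_finrank ℝ ℂ (conjSub A)
  rw [Complex.finrank_real_complex] at h2 h3
  omega

theorem IsSubbundleAt.conjSub {A : ∀ s, Submodule ℂ (ℂ ⊗[ℚ] V.Fiber s)} {x : S}
    (hA : IsSubbundleAt E (L := V.complexify) A x) :
    IsSubbundleAt E (L := V.complexify) (fun s => conjSub (A s)) x := by
  refine ⟨fun a ha => ?_, ?_⟩
  · obtain ⟨σ, hσ, hσx, hσA⟩ := hA.1 _ (mem_conjSub.mp ha)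
    refine ⟨conjSec σ, hσ.conjSec, ?_, ?_⟩
    · rw [conjSec, hσx]
      exact conjC_conjC a
    · filter_upwards [hσA] with y hy using conjC_mem_conjSub.mpr hy
  · filter_upwards [hA.2] with y hy
    exact (finrank_conjSub _).trans (hy.trans (finrank_conjSub _).symm)

end Conjugation

/-! ### Dimensions of the Hodge filtration on the weight filtration -/

section Dimension

variable {H : Type*} [AddCommGroup H] [Module ℚ H]

theorem mem_oppF_of_mem {F : ℤ → Submodule ℂ (ℂ ⊗[ℚ] H)} {W : ℤ → Submodule ℚ H} {l p q : ℤ}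
    (hq : q = l - p) {a : ℂ ⊗[ℚ] H} (ha : a ∈ WC W l ⊓ conjF F q) : a ∈ oppF F W p := by
  subst hq
  exact Submodule.mem_iSup_of_mem l ha

theorem map_baseChange {H' : Type*} [AddCommGroup H'] [Module ℚ H'] (f : H →ₗ[ℚ] H')
    (A : Submodule ℚ H) :
    (A.baseChange ℂ).map (f.baseChange ℂ) = (A.map f).baseChange ℂ := by
  let g : A →ₗ[ℚ] A.map f := f.submoduleMap A
  have e : (A.map f).subtype ∘ₗ g = f ∘ₗ A.subtype := rfl
  have hg : LinearMap.range (g.baseChange ℂ) = ⊤ :=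
    LinearMap.range_eq_top.mpr (LinearMap.lTensor_surjective ℂ (f.submoduleMap_surjective A))
  rw [baseChange_eq_range, baseChange_eq_range, ← LinearMap.range_comp, ← LinearMap.baseChange_comp,
    ← e, LinearMap.baseChange_comp, LinearMap.range_comp, hg, Submodule.map_top]

/-- Rank count in 0 → F^p ∩ W_{k-1} → F^p ∩ W_k → F^p Gr_k → 0. -/
theorem finrank_F_inf_W [FiniteDimensional ℂ (ℂ ⊗[ℚ] H)] {W : ℤ → Submodule ℚ H}
    (hW : Monotone W) (F : ℤ → Submodule ℂ (ℂ ⊗[ℚ] H)) (p k : ℤ) :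
    Module.finrank ℂ ↥(F p ⊓ WC W k) =
      Module.finrank ℂ (grF F W k p) + Module.finrank ℂ ↥(F p ⊓ WC W (k - 1)) := by
  set P := (F p).comap (inclC W k) with hP
  have hfin : FiniteDimensional ℂ (ℂ ⊗[ℚ] W k) :=
    Module.Finite.of_injective (inclC W k) (inclC_injective W k)
  set φ := (projC W k).domRestrict P
  have h1 : LinearMap.range φ = grF F W k p := LinearMap.range_domRestrict _ _
  have h2 := LinearMap.finrank_range_add_finrank_ker φ
  have h3 : P.map (inclC W k) = F p ⊓ WC W k := by
    rw [hP, Submodule.map_comap_eq, range_inclC, inf_comm]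
  have h4 : ((LinearMap.ker φ).map P.subtype).map (inclC W k) = F p ⊓ WC W (k - 1) := by
    ext v
    constructor
    · rintro ⟨_, ⟨t, ht, rfl⟩, rfl⟩
      exact ⟨t.2, (projC_eq_zero_iff hW k _).mp ht⟩
    · rintro ⟨hvF, hvW⟩
      have hv : v ∈ WC W k := Submodule.baseChange_mono ℂ (hW (by omega)) hvW
      rw [WC, ← range_inclC] at hv
      obtain ⟨t, rfl⟩ := hv
      exact ⟨t, ⟨⟨t, hvF⟩, (projC_eq_zero_iff hW k t).mpr hvW, rfl⟩, rfl⟩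
  have h5 := (Submodule.equivMapOfInjective _ (inclC_injective W k) P).finrank_eq
  have h6 := (Submodule.equivMapOfInjective _ (inclC_injective W k)
    ((LinearMap.ker φ).map P.subtype)).finrank_eq
  have h7 := (Submodule.equivMapOfInjective _ P.injective_subtype (LinearMap.ker φ)).finrank_eq
  rw [h3] at h5
  rw [h4] at h6
  rw [h1] at h2
  omega

end Dimension

/-! ### Variations of mixed Hodge structure -/

namespace VGPMHS

variable {E : Type*} [NormedAddCommGroup E] [NormedSpace ℂ E]
  {S : Type u} [TopologicalSpace S] [ChartedSpace E S] (X : VGPMHS.{u, w} E S)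

open LocalSystem

theorem finiteDimensional_fiber (s : S) : FiniteDimensional ℂ (ℂ ⊗[ℚ] X.V.Fiber s) :=
  X.V.complexify.finiteDimensional_fiber s

theorem isFlatSub_W (k : ℤ) (x : S) :
    IsFlatSub (L := X.V.complexify) (fun s => WC (X.W s) k) x := by
  have h : ∀ y, (WC (X.W y) k).map (X.V.complexify.triv x y) =
      (((X.W y k).map (X.V.triv x y)).baseChange ℂ).map
        (TensorProduct.piScalarRight ℚ ℂ ℂ (Fin (X.V.rank x))).toLinearMap := by
    intro y
    rw [← map_baseChange]
    exact Submodule.map_comp _ _ _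
  filter_upwards [X.W_flat x k] with y hy
  rw [h, h, hy]

theorem eventually_W_eq_bot {x : S} {k : ℤ} (hk : X.W x k = ⊥) : ∀ᶠ y in 𝓝 x, X.W y k = ⊥ := by
  filter_upwards [X.W_flat x k, (X.V.isOpen_baseSet x).mem_nhds (X.V.mem_baseSet x)] with y hy hyx
  rw [hk, Submodule.map_bot] at hy
  exact Submodule.map_injective_of_injective (X.V.triv_bijective x y hyx).1
    (hy.trans (Submodule.map_bot _).symm)

/-- An intersection of two subbundles may jump in rank. Here it does not, since each F^p Gr_k has a
local frame; add up the graded ranks from an index where W vanishes, near x as well as at x. -/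
theorem eventually_finrank_F_inf_W (p k : ℤ) (x : S) : ∀ᶠ y in 𝓝 x,
    Module.finrank ℂ ↥(X.F y p ⊓ WC (X.W y) k) = Module.finrank ℂ ↥(X.F x p ⊓ WC (X.W x) k) := by
  have := X.finiteDimensional_fiber
  obtain ⟨a, ha⟩ := (X.mixed x).W_separated
  refine int_le_induction_of_monotone (a := a) (P := fun k => ∀ᶠ y in 𝓝 x,
    Module.finrank ℂ ↥(X.F y p ⊓ WC (X.W y) k) = Module.finrank ℂ ↥(X.F x p ⊓ WC (X.W x) k))
    (fun k hk => ?_) (fun k ih => ?_) k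
  · have h0 : ∀ y, X.W y a = ⊥ → Module.finrank ℂ ↥(X.F y p ⊓ WC (X.W y) k) = 0 := by
      intro y hy
      have hb : X.W y k = ⊥ := le_bot_iff.mp (((X.mixed y).W_monotone hk).trans hy.le)
      rw [WC, hb, Submodule.baseChange_bot, inf_bot_eq, finrank_bot]
    filter_upwards [X.eventually_W_eq_bot ha] with y hy
    rw [h0 y hy, h0 x ha]
  · obtain ⟨m, f, -, hev⟩ := X.grF_hol k p x
    filter_upwards [ih, eventually_finrank_eq_of_frame
      (f := fun j s => projC (X.W s) k (f j s)) hev] with y hy hgr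
    rw [finrank_F_inf_W (X.mixed y).W_monotone, finrank_F_inf_W (X.mixed x).W_monotone, hy, hgr]

/-! ### First-order behaviour of F, of W ∩ conj F and of Φ -/

theorem isSubbundleAt_F (p : ℤ) (x : S) :
    IsSubbundleAt E (L := X.V.complexify) (fun s => X.F s p) x :=
  (X.F_hol p).isSubbundleAt x

theorem nabla01_mem_F {p : ℤ} {x : S} {σ : X.V.complexify.Sec} (hσ : SmoothNear E σ x)
    (hσF : ∀ᶠ y in 𝓝 x, σ y ∈ X.F y p) (v : E) : nabla01 E σ x v ∈ X.F x p :=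
  (X.F_hol p).nabla01_mem hσ hσF v

theorem nabla10_mem_F {p : ℤ} {x : S} {σ : X.V.complexify.Sec} (hσ : SmoothNear E σ x)
    (hσF : ∀ᶠ y in 𝓝 x, σ y ∈ X.F y p) (v : E) : nabla10 E σ x v ∈ X.F x (p - 1) :=
  part10_mem (C := (show Submodule ℂ (X.V.complexify.Fiber x) from X.F x (p - 1)))
    ((X.F_hol p).nabla_mem ((X.mixed x).F_antitone (by omega))
      (fun g hg hgF v => X.transversal p x g hg hgF v) hσ hσF) v

theorem isSubbundleAt_W_inf_conjF (k q : ℤ) (x : S) :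
    IsSubbundleAt E (L := X.V.complexify) (fun s => WC (X.W s) k ⊓ conjF (X.F s) q) x := by
  have h := (IsSubbundleAt.inf (X.isSubbundleAt_F q x) (X.isFlatSub_W k x).isSubbundleAt
    (X.eventually_finrank_F_inf_W q k x)).conjSub
  have e : (fun s => conjSub (X.F s q ⊓ WC (X.W s) k)) =
      fun s => WC (X.W s) k ⊓ conjF (X.F s) q := by
    funext s
    rw [conjSub_inf, WC, conjSub_baseChange, inf_comm]
  exact e ▸ h

/-- W is flat, and the two statements about conj F are the conjugates of holomorphy and
transversality of F, with types exchanged. -/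
theorem nabla_mem_W_inf_conjF {k q : ℤ} {x : S} {σ : X.V.complexify.Sec} (hσ : SmoothNear E σ x)
    (hσA : ∀ᶠ y in 𝓝 x, σ y ∈ WC (X.W y) k ⊓ conjF (X.F y) q) (v : E) :
    nabla10 E σ x v ∈ WC (X.W x) k ⊓ conjF (X.F x) q ∧
      nabla01 E σ x v ∈ WC (X.W x) k ⊓ conjF (X.F x) (q - 1) := by
  have hW : ∀ u, nabla E σ x u ∈ WC (X.W x) k :=
    (X.isFlatSub_W k x).nabla_mem hσ (hσA.mono fun y hy => hy.1)
  have hF : ∀ᶠ y in 𝓝 x, conjSec σ y ∈ X.F y q := hσA.mono fun y hy => mem_conjSub.mp hy.2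
  refine ⟨⟨part10_mem (C := (show Submodule ℂ (X.V.complexify.Fiber x) from WC (X.W x) k)) hW v,
    mem_conjSub.mpr ?_⟩,
    ⟨part01_mem (C := (show Submodule ℂ (X.V.complexify.Fiber x) from WC (X.W x) k)) hW v,
      mem_conjSub.mpr ?_⟩⟩
  · have h1 := X.nabla01_mem_F hσ.conjSec hF v
    rwa [nabla01_conjSec hσ] at h1
  · have h1 := X.nabla10_mem_F hσ.conjSec hF v
    rwa [nabla10_conjSec hσ] at h1

/-- The sum defining Φ_p is not direct, so a given smooth section is not visibly a sum of sections
of the summands. Only the value at x is decomposed, and each piece is extended in its own W_l ∩ conj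
F^{l-p}. -/
theorem exists_section_oppF (p : ℤ) {x : S} {a : ℂ ⊗[ℚ] X.V.Fiber x}
    (ha : a ∈ oppF (X.F x) (X.W x) p) :
    ∃ σ : X.V.complexify.Sec, SmoothNear E σ x ∧ σ x = a ∧
      (∀ᶠ y in 𝓝 x, σ y ∈ oppF (X.F y) (X.W y) p) ∧
      ∀ v : E, nabla10 E σ x v ∈ oppF (X.F x) (X.W x) p ∧
        nabla01 E σ x v ∈ oppF (X.F x) (X.W x) (p + 1) := by
  refine Submodule.iSup_induction _ (motive := fun a => ∃ σ : X.V.complexify.Sec,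
    SmoothNear E σ x ∧ σ x = a ∧ (∀ᶠ y in 𝓝 x, σ y ∈ oppF (X.F y) (X.W y) p) ∧
      ∀ v : E, nabla10 E σ x v ∈ oppF (X.F x) (X.W x) p ∧
        nabla01 E σ x v ∈ oppF (X.F x) (X.W x) (p + 1)) ha ?_ ?_ ?_
  · intro l a ha
    obtain ⟨σ, hσ, hσx, hσA⟩ := (X.isSubbundleAt_W_inf_conjF l (l - p) x).1 a ha
    refine ⟨σ, hσ, hσx, ?_, fun v => ?_⟩
    · filter_upwards [hσA] with y hy using mem_oppF_of_mem rfl hy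
    · have h := X.nabla_mem_W_inf_conjF hσ hσA v
      -- Lowering the index l - p of conj F by one, at the same weight l, is raising p by one.
      exact ⟨mem_oppF_of_mem rfl h.1, mem_oppF_of_mem (by ring) h.2⟩
  · have h0 : ∀ q y, (0 : ℂ ⊗[ℚ] X.V.Fiber y) ∈ oppF (X.F y) (X.W y) q :=
      fun q y => Submodule.zero_mem _
    refine ⟨0, SmoothNear.zero x, rfl, .of_forall fun y => h0 p y, fun v => ?_⟩
    rw [nabla10_zero, nabla01_zero]
    exact ⟨h0 p x, h0 (p + 1) x⟩
  · rintro a b ⟨σ, hσ, hσx, hσA, hσn⟩ ⟨σ', hσ', hσx', hσA', hσn'⟩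
    refine ⟨σ + σ', hσ.add hσ', by rw [← hσx, ← hσx']; rfl, ?_, fun v => ?_⟩
    · filter_upwards [hσA, hσA'] with y h h' using Submodule.add_mem _ h h'
    · rw [nabla10_add hσ hσ', nabla01_add hσ hσ']
      exact ⟨Submodule.add_mem _ (hσn v).1 (hσn' v).1, Submodule.add_mem _ (hσn v).2 (hσn' v).2⟩

theorem eventually_finrank_fiber (x : S) : ∀ᶠ y in 𝓝 x,
    Module.finrank ℂ (ℂ ⊗[ℚ] X.V.Fiber y) = Module.finrank ℂ (ℂ ⊗[ℚ] X.V.Fiber x) := by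
  have h : ∀ y ∈ X.V.complexify.baseSet x,
      Module.finrank ℂ (ℂ ⊗[ℚ] X.V.Fiber y) = X.V.complexify.rank x := fun y hy =>
    ((LinearEquiv.ofBijective _ (X.V.complexify.triv_bijective x y hy)).finrank_eq).trans
      (Module.finrank_fin_fun ℂ)
  filter_upwards [eventually_mem_baseSet (L := X.V.complexify) x] with y hy
  rw [h y hy, h x (X.V.complexify.mem_baseSet x)]

/-- The rank is locally constant because Φ_p is a complement of the bundle F^{p+1}. -/
theorem isSubbundleAt_oppF (p : ℤ) (x : S) :
    IsSubbundleAt E (L := X.V.complexify) (fun s => oppF (X.F s) (X.W s) p) x := by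
  refine ⟨fun a ha => ?_, ?_⟩
  · obtain ⟨σ, hσ, hσx, hσA, -⟩ := X.exists_section_oppF p ha
    exact ⟨σ, hσ, hσx, hσA⟩
  · have := X.finiteDimensional_fiber
    have h : ∀ y, Module.finrank ℂ (X.F y (p + 1)) +
        Module.finrank ℂ (oppF (X.F y) (X.W y) p) = Module.finrank ℂ (ℂ ⊗[ℚ] X.V.Fiber y) :=
      fun y => Submodule.finrank_add_eq_of_isCompl ((X.mixed y).isCompl_oppF p)
    filter_upwards [(X.isSubbundleAt_F (p + 1) x).2, X.eventually_finrank_fiber x] with y h1 h2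
    have h3 := h y
    have h4 := h x
    change Module.finrank ℂ (X.F y (p + 1)) = Module.finrank ℂ (X.F x (p + 1)) at h1
    change Module.finrank ℂ (oppF (X.F y) (X.W y) p) = Module.finrank ℂ (oppF (X.F x) (X.W x) p)
    omega

/-- Any section differs from a good one with the same value by a section vanishing at x, whose
derivative stays in Φ_p ⊆ Φ_{p+1}. -/
theorem nabla_mem_oppF {p : ℤ} {x : S} {σ : X.V.complexify.Sec} (hσ : SmoothNear E σ x)
    (hσA : ∀ᶠ y in 𝓝 x, σ y ∈ oppF (X.F y) (X.W y) p) (v : E) :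
    nabla10 E σ x v ∈ oppF (X.F x) (X.W x) p ∧
      nabla01 E σ x v ∈ oppF (X.F x) (X.W x) (p + 1) := by
  obtain ⟨g, hg, hgx, hgA, hgn⟩ := X.exists_section_oppF p hσA.self_of_nhds
  have h : ∀ u, nabla E (σ - g) x u ∈ oppF (X.F x) (X.W x) p := fun u =>
    (X.isSubbundleAt_oppF p x).nabla_mem (hσ.sub hg)
      (by filter_upwards [hσA, hgA] with y h1 h2 using Submodule.sub_mem _ h1 h2)
      (sub_eq_zero.mpr hgx.symm) u
  have h10 : nabla10 E (σ - g) x v ∈ oppF (X.F x) (X.W x) p :=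
    part10_mem (C := (show Submodule ℂ (X.V.complexify.Fiber x) from _)) h v
  have h01 : nabla01 E (σ - g) x v ∈ oppF (X.F x) (X.W x) p :=
    part01_mem (C := (show Submodule ℂ (X.V.complexify.Fiber x) from _)) h v
  rw [nabla10_sub hσ hg] at h10
  rw [nabla01_sub hσ hg] at h01
  refine ⟨(Submodule.sub_mem_iff_left _ (hgn v).1).mp h10,
    (Submodule.sub_mem_iff_left _ (hgn v).2).mp ?_⟩
  exact (X.mixed x).oppF_mono (show p ≤ p + 1 by omega) h01

/-- The components `U^p` of the variation, as a family of subspaces of the fibres. -/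
def U (p : ℤ) (s : S) : Submodule ℂ (X.V.complexify.Fiber s) := deligneU (X.F s) (X.W s) p

theorem U_eq (p : ℤ) (s : S) : X.U p s = X.F s p ⊓ oppF (X.F s) (X.W s) p :=
  (X.mixed s).deligneU_eq p

theorem U_le_F (p : ℤ) (s : S) : X.U p s ≤ X.F s p := by
  rw [U_eq]
  exact inf_le_left

theorem U_le_oppF (p : ℤ) (s : S) : X.U p s ≤ oppF (X.F s) (X.W s) p := by
  rw [U_eq]
  exact inf_le_right

theorem isInternal_U (s : S) : DirectSum.IsInternal fun p => X.U p s :=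
  (X.mixed s).isInternal_deligneU

/-- U^p is the intersection of the subbundles F^p and Φ_p, and its rank is rank F^p - rank F^{p+1}.
-/
theorem isSubbundleAt_U (p : ℤ) (x : S) : IsSubbundleAt E (X.U p) x := by
  have := X.finiteDimensional_fiber
  have hd : ∀ y, Module.finrank ℂ ↥(X.F y p ⊓ oppF (X.F y) (X.W y) p) +
      Module.finrank ℂ (X.F y (p + 1)) = Module.finrank ℂ (X.F y p) := by
    intro y
    have h := Submodule.finrank_sup_add_finrank_inf_eq (deligneU (X.F y) (X.W y) p)
      (X.F y (p + 1))
    rw [(X.mixed y).deligneU_inf_F, ← (X.mixed y).F_eq_sup, finrank_bot,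
      (X.mixed y).deligneU_eq] at h
    omega
  have h := IsSubbundleAt.inf (X.isSubbundleAt_F p x) (X.isSubbundleAt_oppF p x) (by
    filter_upwards [(X.isSubbundleAt_F p x).2, (X.isSubbundleAt_F (p + 1) x).2] with y h1 h2
    have h3 := hd y
    have h4 := hd x
    change Module.finrank ℂ (X.F y (p + 1)) = Module.finrank ℂ (X.F x (p + 1)) at h2
    change Module.finrank ℂ (X.F y p) = Module.finrank ℂ (X.F x p) at h1
    change Module.finrank ℂ ↥(X.F y p ⊓ oppF (X.F y) (X.W y) p) =
      Module.finrank ℂ ↥(X.F x p ⊓ oppF (X.F x) (X.W x) p)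
    omega)
  have e : X.U p = fun s => X.F s p ⊓ oppF (X.F s) (X.W s) p := funext (X.U_eq p)
  rw [e]
  exact h

/-- The (0,1)-part lands in F^p ∩ Φ_{p+1} and the (1,0)-part in F^{p-1} ∩ Φ_p; each is contained in
the sum of two adjacent components. -/
theorem nabla_mem_U {p : ℤ} {x : S} {σ : X.V.complexify.Sec} (hσ : SmoothNear E σ x)
    (hσU : ∀ᶠ y in 𝓝 x, σ y ∈ X.U p y) (v : E) :
    nabla01 E σ x v ∈ X.U (p + 1) x ⊔ X.U p x ∧ nabla10 E σ x v ∈ X.U p x ⊔ X.U (p - 1) x := by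
  have hF : ∀ᶠ y in 𝓝 x, σ y ∈ X.F y p := hσU.mono fun y hy => X.U_le_F p y hy
  have hO := X.nabla_mem_oppF hσ (hσU.mono fun y hy => X.U_le_oppF p y hy) v
  refine ⟨?_, ?_⟩
  · rw [sup_comm]
    exact (X.mixed x).F_inf_oppF_succ p ⟨X.nabla01_mem_F hσ hF v, hO.2⟩
  · rw [sup_comm]
    have h := (X.mixed x).F_inf_oppF_succ (p - 1)
    rw [sub_add_cancel] at h
    exact h ⟨X.nabla10_mem_F hσ hF v, hO.1⟩

/-- The complex variation of Hodge structure with components `U^p`. -/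
def complexVHS : ComplexVHS E X.V.complexify where
  U := X.U
  smooth p := isSmoothSubbundle_of_forall (X.isSubbundleAt_U p)
  directSum := X.isInternal_U
  horizontal _ _ _ hσ hσU v := X.nabla_mem_U hσ hσU v

end VGPMHS

/-! ### Calculus of operator-valued functions on a complex vector space -/

section Calculus

variable {E : Type*} [NormedAddCommGroup E] [NormedSpace ℂ E] {n : ℕ}

/-- The derivative of type `(1,0)` of an operator-valued function. -/
def del (f : E → (Fin n → ℂ) →L[ℂ] (Fin n → ℂ)) (v e : E) : (Fin n → ℂ) →L[ℂ] (Fin n → ℂ) :=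
  part10 (fderiv ℝ f e).toLinearMap v

/-- The derivative of type `(0,1)` of an operator-valued function. -/
def delbar (f : E → (Fin n → ℂ) →L[ℂ] (Fin n → ℂ)) (v e : E) :
    (Fin n → ℂ) →L[ℂ] (Fin n → ℂ) :=
  part01 (fderiv ℝ f e).toLinearMap v

variable {f g : E → (Fin n → ℂ) →L[ℂ] (Fin n → ℂ)} {e : E}

theorem del_eq (f : E → (Fin n → ℂ) →L[ℂ] (Fin n → ℂ)) (v e : E) :
    del f v e = (2⁻¹ : ℂ) • (fderiv ℝ f e v - Complex.I • fderiv ℝ f e (Complex.I • v)) := rfl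

theorem delbar_eq (f : E → (Fin n → ℂ) →L[ℂ] (Fin n → ℂ)) (v e : E) :
    delbar f v e = (2⁻¹ : ℂ) • (fderiv ℝ f e v + Complex.I • fderiv ℝ f e (Complex.I • v)) := rfl

theorem smul_mul_operator (c : ℂ) (a b : (Fin n → ℂ) →L[ℂ] (Fin n → ℂ)) :
    (c • a) * b = c • (a * b) := rfl

theorem mul_smul_operator (c : ℂ) (a b : (Fin n → ℂ) →L[ℂ] (Fin n → ℂ)) :
    a * (c • b) = c • (a * b) := by
  ext1 v
  exact map_smul a c (b v)

theorem hasFDerivAt_mul_operator (hf : DifferentiableAt ℝ f e) (hg : DifferentiableAt ℝ g e) :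
    ∃ A : E →L[ℝ] ((Fin n → ℂ) →L[ℂ] (Fin n → ℂ)), HasFDerivAt (fun e => f e * g e) A e ∧
      ∀ v, A v = fderiv ℝ f e v * g e + f e * fderiv ℝ g e v := by
  have hb := (isBoundedBilinearMap_comp (𝕜 := ℂ) (E := Fin n → ℂ) (F := Fin n → ℂ)
    (G := Fin n → ℂ))
  have h1 := (hb.hasFDerivAt (f e, g e)).restrictScalars ℝ
  exact ⟨_, HasFDerivAt.comp (g := fun p : ((Fin n → ℂ) →L[ℂ] (Fin n → ℂ)) ×
    ((Fin n → ℂ) →L[ℂ] (Fin n → ℂ)) => p.1.comp p.2) e h1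
    (hf.hasFDerivAt.prodMk hg.hasFDerivAt), fun v => add_comm _ _⟩

theorem differentiableAt_mul_operator (hf : DifferentiableAt ℝ f e)
    (hg : DifferentiableAt ℝ g e) : DifferentiableAt ℝ (fun e => f e * g e) e :=
  (hasFDerivAt_mul_operator hf hg).choose_spec.1.differentiableAt

theorem fderiv_mul_operator (hf : DifferentiableAt ℝ f e) (hg : DifferentiableAt ℝ g e) (v : E) :
    fderiv ℝ (fun e => f e * g e) e v = fderiv ℝ f e v * g e + f e * fderiv ℝ g e v := by
  obtain ⟨A, hA, hAv⟩ := hasFDerivAt_mul_operator hf hg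
  rw [hA.fderiv, hAv]

theorem del_mul (hf : DifferentiableAt ℝ f e) (hg : DifferentiableAt ℝ g e) (v : E) :
    del (fun e => f e * g e) v e = del f v e * g e + f e * del g v e := by
  simp only [del_eq, fderiv_mul_operator hf hg, smul_mul_operator, mul_smul_operator,
    sub_mul, mul_sub]
  module

theorem delbar_mul (hf : DifferentiableAt ℝ f e) (hg : DifferentiableAt ℝ g e) (v : E) :
    delbar (fun e => f e * g e) v e = delbar f v e * g e + f e * delbar g v e := by
  simp only [delbar_eq, fderiv_mul_operator hf hg, smul_mul_operator, mul_smul_operator,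
    add_mul, mul_add]
  module

theorem del_sub (hf : DifferentiableAt ℝ f e) (hg : DifferentiableAt ℝ g e) (v : E) :
    del (fun e => f e - g e) v e = del f v e - del g v e := by
  simp only [del_eq, fderiv_fun_sub hf hg, sub_apply]
  module

theorem delbar_sub (hf : DifferentiableAt ℝ f e) (hg : DifferentiableAt ℝ g e) (v : E) :
    delbar (fun e => f e - g e) v e = delbar f v e - delbar g v e := by
  simp only [delbar_eq, fderiv_fun_sub hf hg, sub_apply]
  module

theorem del_neg (f : E → (Fin n → ℂ) →L[ℂ] (Fin n → ℂ)) (v e : E) :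
    del (fun e => -f e) v e = -del f v e := by
  simp only [del_eq, fderiv_fun_neg, neg_apply]
  module

theorem delbar_neg (f : E → (Fin n → ℂ) →L[ℂ] (Fin n → ℂ)) (v e : E) :
    delbar (fun e => -f e) v e = -delbar f v e := by
  simp only [delbar_eq, fderiv_fun_neg, neg_apply]
  module

theorem del_congr (h : f =ᶠ[𝓝 e] g) (v : E) : del f v e = del g v e := by
  rw [del_eq, del_eq, h.fderiv_eq]

theorem delbar_congr (h : f =ᶠ[𝓝 e] g) (v : E) : delbar f v e = delbar g v e := by
  rw [delbar_eq, delbar_eq, h.fderiv_eq]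

/-! ### Second derivatives and the identities behind θ ∧ θ = 0 and ∂̄θ = 0 -/

theorem contDiffAt_fderiv_apply (hf : ContDiffAt ℝ ∞ f e) (v : E) :
    ContDiffAt ℝ ∞ (fun e => fderiv ℝ f e v) e :=
  (hf.fderiv_right (m := ∞) (by simp)).clm_apply contDiffAt_const

theorem contDiffAt_const_smul (c : ℂ) (hf : ContDiffAt ℝ ∞ f e) :
    ContDiffAt ℝ ∞ (fun e => c • f e) e :=
  ((c • ContinuousLinearMap.id ℂ ((Fin n → ℂ) →L[ℂ] (Fin n → ℂ))).restrictScalars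
    ℝ).contDiff.contDiffAt.comp e hf

theorem contDiffAt_del (hf : ContDiffAt ℝ ∞ f e) (v : E) : ContDiffAt ℝ ∞ (del f v) e :=
  contDiffAt_const_smul _ ((contDiffAt_fderiv_apply hf v).sub
    (contDiffAt_const_smul _ (contDiffAt_fderiv_apply hf _)))

theorem contDiffAt_delbar (hf : ContDiffAt ℝ ∞ f e) (v : E) : ContDiffAt ℝ ∞ (delbar f v) e :=
  contDiffAt_const_smul _ ((contDiffAt_fderiv_apply hf v).add
    (contDiffAt_const_smul _ (contDiffAt_fderiv_apply hf _)))

theorem fderiv_const_smul_operator (c : ℂ) (hf : DifferentiableAt ℝ f e) (v : E) :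
    fderiv ℝ (fun e => c • f e) e v = c • fderiv ℝ f e v := by
  have h := ((c • ContinuousLinearMap.id ℂ ((Fin n → ℂ) →L[ℂ] (Fin n → ℂ))).restrictScalars
    ℝ).hasFDerivAt.comp e hf.hasFDerivAt
  have h' : HasFDerivAt (fun e => c • f e) _ e := h
  rw [h'.fderiv]
  rfl

theorem fderiv_fderiv_apply (hf : ContDiffAt ℝ ∞ f e) (u v : E) :
    fderiv ℝ (fun e => fderiv ℝ f e v) e u = fderiv ℝ (fderiv ℝ f) e u v := by
  have h : DifferentiableAt ℝ (fderiv ℝ f) e :=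
    (hf.fderiv_right (m := ∞) (by simp)).differentiableAt (by simp)
  rw [fderiv_clm_apply h (differentiableAt_const v)]
  simp

theorem fderiv_del (hf : ContDiffAt ℝ ∞ f e) (u v : E) : fderiv ℝ (del f v) e u =
    (2⁻¹ : ℂ) • (fderiv ℝ (fderiv ℝ f) e u v -
      Complex.I • fderiv ℝ (fderiv ℝ f) e u (Complex.I • v)) := by
  have h1 := fun v => (contDiffAt_fderiv_apply hf v).differentiableAt (by simp)
  have h2 := fun v => (contDiffAt_const_smul Complex.I
    (contDiffAt_fderiv_apply hf v)).differentiableAt (by simp)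
  have e1 : del f v = fun e => (2⁻¹ : ℂ) • (fderiv ℝ f e v -
    Complex.I • fderiv ℝ f e (Complex.I • v)) := rfl
  rw [e1, fderiv_const_smul_operator _ ((h1 v).fun_sub (h2 _)), fderiv_fun_sub (h1 v) (h2 _),
    sub_apply, fderiv_const_smul_operator _ (h1 _), fderiv_fderiv_apply hf,
    fderiv_fderiv_apply hf]

theorem fderiv_delbar (hf : ContDiffAt ℝ ∞ f e) (u v : E) : fderiv ℝ (delbar f v) e u =
    (2⁻¹ : ℂ) • (fderiv ℝ (fderiv ℝ f) e u v +
      Complex.I • fderiv ℝ (fderiv ℝ f) e u (Complex.I • v)) := by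
  have h1 := fun v => (contDiffAt_fderiv_apply hf v).differentiableAt (by simp)
  have h2 := fun v => (contDiffAt_const_smul Complex.I
    (contDiffAt_fderiv_apply hf v)).differentiableAt (by simp)
  have e1 : delbar f v = fun e => (2⁻¹ : ℂ) • (fderiv ℝ f e v +
    Complex.I • fderiv ℝ f e (Complex.I • v)) := rfl
  rw [e1, fderiv_const_smul_operator _ ((h1 v).fun_add (h2 _)), fderiv_fun_add (h1 v) (h2 _),
    add_apply, fderiv_const_smul_operator _ (h1 _), fderiv_fderiv_apply hf,
    fderiv_fderiv_apply hf]

theorem fderiv_fderiv_symm (hf : ContDiffAt ℝ ∞ f e) (u v : E) :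
    fderiv ℝ (fderiv ℝ f) e u v = fderiv ℝ (fderiv ℝ f) e v u :=
  (hf.isSymmSndFDerivAt (by
    rw [minSmoothness_of_isRCLikeNormedField]
    exact (WithTop.coe_le_coe.mpr le_top : ((2 : ℕ∞) : ℕ∞ω) ≤ ((⊤ : ℕ∞) : ℕ∞ω)))).eq u v

theorem del_del_comm (hf : ContDiffAt ℝ ∞ f e) (u v : E) :
    del (del f v) u e = del (del f u) v e := by
  simp only [del_eq (del f _), fderiv_del hf]
  rw [fderiv_fderiv_symm hf v u, fderiv_fderiv_symm hf v (Complex.I • u),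
    fderiv_fderiv_symm hf (Complex.I • v) u, fderiv_fderiv_symm hf (Complex.I • v) (Complex.I • u)]
  module

theorem delbar_del_comm (hf : ContDiffAt ℝ ∞ f e) (u v : E) :
    delbar (del f v) u e = del (delbar f u) v e := by
  simp only [del_eq (delbar f _), delbar_eq (del f _), fderiv_del hf, fderiv_delbar hf]
  rw [fderiv_fderiv_symm hf v u, fderiv_fderiv_symm hf v (Complex.I • u),
    fderiv_fderiv_symm hf (Complex.I • v) u, fderiv_fderiv_symm hf (Complex.I • v) (Complex.I • u)]
  module

theorem differentiableAt_del (hf : ContDiffAt ℝ ∞ f e) (v : E) :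
    DifferentiableAt ℝ (del f v) e :=
  (contDiffAt_del hf v).differentiableAt (by simp)

theorem differentiableAt_delbar (hf : ContDiffAt ℝ ∞ f e) (v : E) :
    DifferentiableAt ℝ (delbar f v) e :=
  (contDiffAt_delbar hf v).differentiableAt (by simp)

/-- Here a and b are the two products of first derivatives, h is the common second derivative, and
c, d are f h and h f. Subtracting the relations eliminates c, d and h, leaving 2(a - b) = 0. -/
theorem eq_of_symm_relations {M : Type*} [AddCommGroup M] [Module ℂ M] {a b c d h : M}
    (h1 : a + c - (d + b) = -h) (h2 : b + c - (d + a) = -h) : a = b := by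
  have h3 : (2 : ℂ) • (a - b) = (a + c - (d + b)) - (b + c - (d + a)) := by module
  rw [h1, h2, sub_self, smul_eq_zero] at h3
  exact sub_eq_zero.mp (h3.resolve_left two_ne_zero)

/-- The mixed case: degrees -1 and +1 give opposite signs of h, so subtraction leaves 2(a - b) =
-2h. -/
theorem add_eq_of_relations {M : Type*} [AddCommGroup M] [Module ℂ M] {a b c d h : M}
    (h1 : a + c - (d + b) = -h) (h2 : b + c - (d + a) = h) : h + a = b := by
  have h3 : (2 : ℂ) • (a - b) = (a + c - (d + b)) - (b + c - (d + a)) := by module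
  rw [h1, h2] at h3
  have h4 : (2 : ℂ) • (h + a - b) = 0 := by
    have h5 : (2 : ℂ) • (h + a - b) = (2 : ℂ) • (a - b) + (2 : ℂ) • h := by module
    rw [h5, h3]
    module
  exact sub_eq_zero.mp ((smul_eq_zero.mp h4).resolve_left two_ne_zero)

/-- If `∂f` is homogeneous of degree `-1` under `ad f`, then its components commute. -/
theorem del_mul_del_comm (hf : ContDiffAt ℝ ∞ f e)
    (h10 : ∀ᶠ e in 𝓝 e, ∀ v, f e * del f v e - del f v e * f e = -del f v e) (u v : E) :
    del f u e * del f v e = del f v e * del f u e := by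
  have hd := hf.differentiableAt (by simp)
  have hdd := differentiableAt_del hf
  have key : ∀ u v, del f u e * del f v e + f e * del (del f v) u e -
      (del (del f v) u e * f e + del f v e * del f u e) = -del (del f v) u e := by
    intro u v
    have hc : (fun e => f e * del f v e - del f v e * f e) =ᶠ[𝓝 e] fun e => -del f v e :=
      h10.mono fun e he => he v
    have h := del_congr hc u
    rwa [del_sub (differentiableAt_mul_operator hd (hdd v))
      (differentiableAt_mul_operator (hdd v) hd), del_mul hd (hdd v), del_mul (hdd v) hd,
      del_neg] at h
  have h1 := key u v
  have h2 := key v u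
  rw [del_del_comm hf v u] at h2
  exact eq_of_symm_relations h1 h2

/-- If `∂f` and `∂̄f` are homogeneous of degrees `-1` and `1` under `ad f`, then
`∂̄∂f + [∂̄f, ∂f] = 0`. -/
theorem delbar_del_add_comm (hf : ContDiffAt ℝ ∞ f e)
    (h10 : ∀ᶠ e in 𝓝 e, ∀ v, f e * del f v e - del f v e * f e = -del f v e)
    (h01 : ∀ᶠ e in 𝓝 e, ∀ v, f e * delbar f v e - delbar f v e * f e = delbar f v e) (v w : E) :
    delbar (del f v) w e + delbar f w e * del f v e = del f v e * delbar f w e := by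
  have hd := hf.differentiableAt (by simp)
  have hdd := differentiableAt_del hf
  have hdb := differentiableAt_delbar hf
  have hc1 : (fun e => f e * del f v e - del f v e * f e) =ᶠ[𝓝 e] fun e => -del f v e :=
    h10.mono fun e he => he v
  have hc2 : (fun e => f e * delbar f w e - delbar f w e * f e) =ᶠ[𝓝 e] fun e => delbar f w e :=
    h01.mono fun e he => he w
  have h1 := delbar_congr hc1 w
  have h2 := del_congr hc2 v
  rw [delbar_sub (differentiableAt_mul_operator hd (hdd v))
      (differentiableAt_mul_operator (hdd v) hd), delbar_mul hd (hdd v), delbar_mul (hdd v) hd,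
      delbar_neg] at h1
  rw [del_sub (differentiableAt_mul_operator hd (hdb w))
      (differentiableAt_mul_operator (hdb w) hd), del_mul hd (hdb w), del_mul (hdb w) hd,
      ← delbar_del_comm hf] at h2
  exact add_eq_of_relations h1 h2

end Calculus

/-! ### Smooth functions and the charts of a complex manifold -/

section Charts

variable {E : Type*} [NormedAddCommGroup E] [NormedSpace ℂ E]
  {S : Type u} [TopologicalSpace S] [ChartedSpace E S]
  {M : Type*} [NormedAddCommGroup M] [NormedSpace ℝ M]

theorem _root_.ContMDiffAt.real_of_complex {E' : Type*} [NormedAddCommGroup E']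
    [NormedSpace ℂ E'] {S' : Type*} [TopologicalSpace S'] [ChartedSpace E' S'] {g : S → S'} {x : S}
    (h : ContMDiffAt 𝓘(ℂ, E) 𝓘(ℂ, E') ω g x) : ContMDiffAt 𝓘(ℝ, E) 𝓘(ℝ, E') ∞ g x := by
  rw [contMDiffAt_iff] at h ⊢
  exact ⟨h.1, (h.2.restrict_scalars ℝ).of_le le_top⟩

theorem tendsto_chartAt_symm {E : Type*} [NormedAddCommGroup E] [ChartedSpace E S] (x : S) :
    Filter.Tendsto (chartAt E x).symm (𝓝 (chartAt E x x)) (𝓝 x) := by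
  have h := (chartAt E x).continuousAt_symm (mem_chart_target E x)
  rwa [ContinuousAt, (chartAt E x).left_inv (mem_chart_source E x)] at h

variable [IsManifold 𝓘(ℂ, E) ω S]

theorem contMDiffAt_chartAt_real {x y : S} (hy : y ∈ (chartAt E x).source) :
    ContMDiffAt 𝓘(ℝ, E) 𝓘(ℝ, E) ∞ (chartAt E x) y :=
  (((contMDiffOn_chart (I := 𝓘(ℂ, E)) (n := ω)) y hy).contMDiffAt
    ((chartAt E x).open_source.mem_nhds hy)).real_of_complex

theorem contMDiffAt_chartAt_symm_real {x : S} {e : E} (he : e ∈ (chartAt E x).target) :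
    ContMDiffAt 𝓘(ℝ, E) 𝓘(ℝ, E) ∞ (chartAt E x).symm e :=
  (((contMDiffOn_chart_symm (I := 𝓘(ℂ, E)) (n := ω)) e he).contMDiffAt
    ((chartAt E x).open_target.mem_nhds he)).real_of_complex

theorem GermSmooth.contDiffAt_inChart {g : S → M} {x : S} (h : GermSmooth E g x) :
    ∀ᶠ e in 𝓝 (chartAt E x x), ContDiffAt ℝ ∞ (inChart E x g) e := by
  filter_upwards [(tendsto_chartAt_symm x).eventually h,
    (chartAt E x).open_target.mem_nhds (mem_chart_target E x)] with e he het
  exact contMDiffAt_iff_contDiffAt.mp (he.comp e (contMDiffAt_chartAt_symm_real het))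

theorem germSmooth_comp_chartAt {h : E → M} {x : S}
    (hh : ∀ᶠ e in 𝓝 (chartAt E x x), ContDiffAt ℝ ∞ h e) :
    GermSmooth E (fun y => h (chartAt E x y)) x := by
  filter_upwards [((chartAt E x).continuousAt (mem_chart_source E x)).eventually hh,
    (chartAt E x).open_source.mem_nhds (mem_chart_source E x)] with y hy hys
  exact ContMDiffAt.comp y hy.contMDiffAt (contMDiffAt_chartAt_real hys)

theorem dAt_comp_chartAt {h : E → M} {x : S}
    (hh : ∀ᶠ e in 𝓝 (chartAt E x x), ContDiffAt ℝ ∞ h e) :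
    dAt E (fun y => h (chartAt E x y)) x = fderiv ℝ h (chartAt E x x) := by
  refine dAt_eq_of_hasFDerivAt (germSmooth_comp_chartAt hh).at_self ?_
  refine (hh.self_of_nhds.differentiableAt (by simp)).hasFDerivAt.congr_of_eventuallyEq ?_
  filter_upwards [(chartAt E x).open_target.mem_nhds (mem_chart_target E x)] with e he
  simp [inChart, (chartAt E x).right_inv he]

theorem coordField_self (x : S) (v : E) : coordField E x v x = v :=
  tangentCoordChange_self (mem_extChartAt_source x)

theorem coordField_smul (x y : S) (c : ℂ) (v : E) :
    coordField E x (c • v) y = c • coordField E x v y :=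
  map_smul (tangentCoordChange 𝓘(ℂ, E) x y y) c v

/-- Differentials at y are expressed in the chart at y. Along a coordinate field of the chart at x,
the chain rule through the change of charts turns them into an ordinary directional derivative, as
needed to differentiate twice. -/
theorem dAt_coordField {g : S → M} {x y : S} (hy : y ∈ (chartAt E x).source)
    (hg : ContMDiffAt 𝓘(ℝ, E) 𝓘(ℝ, M) ∞ g y) (v : E) :
    dAt E g y (coordField E x v y) = fderiv ℝ (inChart E x g) (chartAt E x y) v := by
  have h1 : HasFDerivWithinAt ((extChartAt 𝓘(ℂ, E) y) ∘ (extChartAt 𝓘(ℂ, E) x).symm)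
      (tangentCoordChange 𝓘(ℂ, E) x y y) (Set.range 𝓘(ℂ, E)) (extChartAt 𝓘(ℂ, E) x y) :=
    hasFDerivWithinAt_tangentCoordChange (by simp [hy])
  simp only [mfld_simps] at h1
  have h2 : HasFDerivAt (chartAt E y ∘ (chartAt E x).symm) (tangentCoordChange 𝓘(ℂ, E) x y y)
      (chartAt E x y) := hasFDerivWithinAt_univ.mp h1
  have hpt : (chartAt E y ∘ (chartAt E x).symm) (chartAt E x y) = chartAt E y y := by
    simp [(chartAt E x).left_inv hy]
  have h3 : HasFDerivAt (inChart E y g) (dAt E g y)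
      ((chartAt E y ∘ (chartAt E x).symm) (chartAt E x y)) := by
    rw [hpt]
    exact hg.hasFDerivAt_inChart
  have h4 := h3.comp (chartAt E x y) (h2.restrictScalars ℝ)
  have h5 : inChart E x g =ᶠ[𝓝 (chartAt E x y)]
      inChart E y g ∘ (chartAt E y ∘ (chartAt E x).symm) := by
    have ht : Filter.Tendsto (chartAt E x).symm (𝓝 (chartAt E x y)) (𝓝 y) := by
      have h := (chartAt E x).continuousAt_symm ((chartAt E x).map_source hy)
      rwa [ContinuousAt, (chartAt E x).left_inv hy] at h
    filter_upwards [ht.eventually ((chartAt E y).open_source.mem_nhds (mem_chart_source E y))]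
      with e he
    simp only [inChart, Function.comp_apply]
    rw [(chartAt E y).left_inv he]
  rw [(h4.congr_of_eventuallyEq h5).fderiv]
  rfl

end Charts

/-! ### The Higgs bundle of a complex variation of Hodge structure -/

section Higgs

variable {E : Type*} [NormedAddCommGroup E] [NormedSpace ℂ E]
  {S : Type u} [TopologicalSpace S] [ChartedSpace E S] {L : LocalSystem.{u, w} ℂ S}

open LocalSystem

theorem nabla_const_smul {σ : L.Sec} {x : S} (h : SmoothNear E σ x) (c : ℂ) (v : E) :
    nabla E (fun y => c • σ y) x v = c • nabla E σ x v := by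
  rw [nabla_smul (GermSmooth.const c x) h, dAt_const]
  simp

theorem nabla10_const_smul {σ : L.Sec} {x : S} (h : SmoothNear E σ x) (c : ℂ) (v : E) :
    nabla10 E (fun y => c • σ y) x v = c • nabla10 E σ x v := by
  simp only [nabla10_apply, nabla_const_smul h]
  module

theorem nabla01_const_smul {σ : L.Sec} {x : S} (h : SmoothNear E σ x) (c : ℂ) (v : E) :
    nabla01 E (fun y => c • σ y) x v = c • nabla01 E σ x v := by
  simp only [nabla01_apply, nabla_const_smul h]
  module

theorem nabla10_congr {σ σ' : L.Sec} {x : S} (e : ∀ᶠ y in 𝓝 x, σ' y = σ y) :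
    nabla10 E σ' x = nabla10 E σ x := by
  rw [nabla10, nabla10, nabla_congr e]

theorem nabla01_congr {σ σ' : L.Sec} {x : S} (e : ∀ᶠ y in 𝓝 x, σ' y = σ y) :
    nabla01 E σ' x = nabla01 E σ x := by
  rw [nabla01, nabla01, nabla_congr e]

theorem LocalSystem.finrank_fiber (L : LocalSystem.{u, w} ℂ S) {x y : S}
    (hy : y ∈ L.baseSet x) : Module.finrank ℂ (L.Fiber y) = L.rank x :=
  ((LinearEquiv.ofBijective _ (L.triv_bijective x y hy)).finrank_eq).trans
    (Module.finrank_fin_fun ℂ)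

theorem IsSmoothSubbundle.isSubbundleAt {A : ∀ s, Submodule ℂ (L.Fiber s)}
    (hA : IsSmoothSubbundle E A) (x : S) : IsSubbundleAt E A x := by
  obtain ⟨m, f, hf, hev⟩ := hA x
  refine ⟨fun a ha => ?_, eventually_finrank_eq_of_frame hev⟩
  rw [← hev.self_of_nhds.2] at ha
  obtain ⟨c, hc⟩ := (Submodule.mem_span_range_iff_exists_fun ℂ).mp ha
  refine ⟨∑ j, fun y => c j • f j y, SmoothNear.sum fun j _ => (hf j).const_smul (c j), ?_, ?_⟩
  · rw [← hc, Finset.sum_apply]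
  · filter_upwards [hev] with y hy
    rw [← hy.2, Finset.sum_apply]
    exact Submodule.sum_mem _ fun j _ => Submodule.smul_mem _ _ (Submodule.subset_span ⟨j, rfl⟩)

namespace ComplexVHS

variable (C : ComplexVHS E L)

/-- The endomorphism which is multiplication by `c p` on `U^p`. -/
def diag (c : ℤ → ℂ) : EndSec L := fun s => diagOp (C.directSum s) c

theorem diag_apply (c : ℤ → ℂ) {p : ℤ} {s : S} {a : L.Fiber s} (ha : a ∈ C.U p s) :
    C.diag c s a = c p • a :=
  diagOp_apply (C.directSum s) c ha

theorem smoothEnd_diag (c : ℤ → ℂ) (x : S) : SmoothEnd E (C.diag c) x :=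
  smoothEnd_diagOp (fun p => (C.smooth p).isSubbundleAt x) C.directSum c

theorem diag_diag (c d : ℤ → ℂ) (h : ∀ p, c p * d p = 1) (s : S) (a : L.Fiber s) :
    C.diag c s (C.diag d s a) = a := by
  have h1 := diagOp_comp (C.directSum s) c d
  have h2 : (fun p => c p * d p) = fun _ => 1 := funext h
  rw [h2, diagOp_one] at h1
  exact LinearMap.congr_fun h1 a

/-- The grading operator, which is multiplication by `p` on `U^p`. -/
def grading : EndSec L := C.diag fun p => p

theorem grading_apply {p : ℤ} {s : S} {a : L.Fiber s} (ha : a ∈ C.U p s) :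
    C.grading s a = (p : ℂ) • a :=
  C.diag_apply _ ha

theorem smoothEnd_grading (x : S) : SmoothEnd E C.grading x := C.smoothEnd_diag _ x

theorem hom_ext {s : S} {M : Type*} [AddCommGroup M] [Module ℂ M] {f g : L.Fiber s →ₗ[ℂ] M}
    (h : ∀ p, ∀ a ∈ C.U p s, f a = g a) : f = g :=
  linearMap_ext_of_isInternal (C.directSum s) h

/-- The Higgs field: the `(1,0)`-part of the derivative of the grading operator. -/
def higgsField (x : S) : E →ₗ[ℂ] Module.End ℂ (L.Fiber x) := part10 (nablaEnd E C.grading x)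

/-- The negative of `τ`: the `(0,1)`-part of the derivative of the grading operator. -/
def tauField (x : S) : E →ₗ⋆[ℂ] Module.End ℂ (L.Fiber x) := part01 (nablaEnd E C.grading x)

/-- The operator `∂̄ = ∇^{0,1} - τ`. -/
def dbarOp (σ : L.Sec) (x : S) : E →ₗ⋆[ℂ] L.Fiber x where
  toFun w := nabla01 E σ x w + C.tauField x w (σ x)
  map_add' u v := by
    simp only [map_add, LinearMap.add_apply]
    abel
  map_smul' c v := by
    simp only [LinearMap.map_smulₛₗ, LinearMap.smul_apply, smul_add]

theorem dbarOp_apply (σ : L.Sec) (x : S) (w : E) :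
    C.dbarOp σ x w = nabla01 E σ x w + C.tauField x w (σ x) := rfl

variable {C}

theorem eventually_grading_eq {p : ℤ} {x : S} {σ : L.Sec} (hσU : ∀ᶠ y in 𝓝 x, σ y ∈ C.U p y) :
    ∀ᶠ y in 𝓝 x, C.grading y (σ y) = (p : ℂ) • σ y := by
  filter_upwards [hσU] with y hy using C.grading_apply hy

/-- Apply the Leibniz rule to Yσ = pσ. If ∇^{1,0}σ = a + b with a in U^p and b in U^{p-1}, then
(∇^{1,0}Y)σ = p(a + b) - (pa + (p - 1)b) = b. -/
theorem higgsField_section {p : ℤ} {x : S} {σ : L.Sec} (hσ : SmoothNear E σ x)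
    (hσU : ∀ᶠ y in 𝓝 x, σ y ∈ C.U p y) (v : E) : C.higgsField x v (σ x) ∈ C.U (p - 1) x ∧
      nabla10 E σ x v - C.higgsField x v (σ x) ∈ C.U p x := by
  obtain ⟨a, ha, b, hb, hab⟩ := Submodule.mem_sup.mp (C.horizontal p x σ hσ hσU v).2
  have h1 := nabla10_end_apply (C.smoothEnd_grading x) hσ v
  rw [nabla10_congr (eventually_grading_eq hσU), nabla10_const_smul hσ, ← hab, map_add,
    C.grading_apply ha, C.grading_apply hb] at h1
  have h2 : C.higgsField x v (σ x) = b := by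
    change part10 (nablaEnd E C.grading x) v (σ x) = b
    rw [eq_sub_of_add_eq h1.symm]
    push_cast
    module
  rw [h2, ← hab]
  exact ⟨hb, by simpa using ha⟩

/-- As for the Higgs field, but the off-diagonal part b of ∇^{0,1}σ now has degree p + 1, so
(∇^{0,1}Y)σ = -b. Adding it to ∇^{0,1}σ removes b. -/
theorem tauField_section {p : ℤ} {x : S} {σ : L.Sec} (hσ : SmoothNear E σ x)
    (hσU : ∀ᶠ y in 𝓝 x, σ y ∈ C.U p y) (w : E) : C.tauField x w (σ x) ∈ C.U (p + 1) x ∧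
      C.dbarOp σ x w ∈ C.U p x := by
  obtain ⟨b, hb, a, ha, hab⟩ := Submodule.mem_sup.mp (C.horizontal p x σ hσ hσU w).1
  have h1 := nabla01_end_apply (C.smoothEnd_grading x) hσ w
  rw [nabla01_congr (eventually_grading_eq hσU), nabla01_const_smul hσ, ← hab, map_add,
    C.grading_apply ha, C.grading_apply hb] at h1
  have h2 : C.tauField x w (σ x) = -b := by
    change part01 (nablaEnd E C.grading x) w (σ x) = -b
    rw [eq_sub_of_add_eq h1.symm]
    push_cast
    module
  rw [dbarOp_apply, h2, ← hab]
  refine ⟨Submodule.neg_mem _ hb, ?_⟩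
  have e : b + a + -b = a := by abel
  rwa [e]

theorem higgsField_mem {p : ℤ} {x : S} {a : L.Fiber x} (ha : a ∈ C.U p x) (v : E) :
    C.higgsField x v a ∈ C.U (p - 1) x := by
  obtain ⟨σ, hσ, hσx, hσU⟩ := ((C.smooth p).isSubbundleAt x).1 a ha
  rw [← hσx]
  exact (higgsField_section hσ hσU v).1

theorem tauField_mem {p : ℤ} {x : S} {a : L.Fiber x} (ha : a ∈ C.U p x) (w : E) :
    C.tauField x w a ∈ C.U (p + 1) x := by
  obtain ⟨σ, hσ, hσx, hσU⟩ := ((C.smooth p).isSubbundleAt x).1 a ha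
  rw [← hσx]
  exact (tauField_section hσ hσU w).1

theorem grading_higgsField (x : S) (v : E) (a : L.Fiber x) :
    C.grading x (C.higgsField x v a) - C.higgsField x v (C.grading x a) =
      -C.higgsField x v a := by
  have h : C.grading x ∘ₗ C.higgsField x v - C.higgsField x v ∘ₗ C.grading x =
      -C.higgsField x v := by
    refine C.hom_ext fun p a ha => ?_
    simp only [LinearMap.sub_apply, LinearMap.comp_apply, LinearMap.neg_apply]
    rw [C.grading_apply ha, map_smul, C.grading_apply (higgsField_mem ha v)]
    push_cast
    module
  exact LinearMap.congr_fun h a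

theorem grading_tauField (x : S) (w : E) (a : L.Fiber x) :
    C.grading x (C.tauField x w a) - C.tauField x w (C.grading x a) = C.tauField x w a := by
  have h : C.grading x ∘ₗ C.tauField x w - C.tauField x w ∘ₗ C.grading x = C.tauField x w := by
    refine C.hom_ext fun p a ha => ?_
    simp only [LinearMap.sub_apply, LinearMap.comp_apply]
    rw [C.grading_apply ha, map_smul, C.grading_apply (tauField_mem ha w)]
    push_cast
    module
  exact LinearMap.congr_fun h a

theorem dbarOp_add {σ σ' : L.Sec} {x : S} (h : SmoothNear E σ x) (h' : SmoothNear E σ' x) :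
    C.dbarOp (σ + σ') x = C.dbarOp σ x + C.dbarOp σ' x := by
  ext w
  rw [LinearMap.add_apply, dbarOp_apply, dbarOp_apply, dbarOp_apply, nabla01_add h h',
    Pi.add_apply, map_add]
  abel

theorem dbarOp_leibniz {g : S → ℂ} {σ : L.Sec} {x : S} (hg : FunSmoothNear E g x)
    (h : SmoothNear E σ x) (w : E) :
    C.dbarOp (fun y => g y • σ y) x w = dbarFun E g x w • σ x + g x • C.dbarOp σ x w := by
  have e : dbarFun E g x w =
      (2⁻¹ : ℂ) • (dAt E g x w + Complex.I • dAt E g x (Complex.I • w)) := rfl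
  rw [dbarOp_apply, dbarOp_apply, e]
  simp only [nabla01_apply, nabla_smul hg h, map_smul]
  module

/-- `∂̄` commutes with the operators which are diagonal for the grading. -/
theorem dbarOp_diag (c : ℤ → ℂ) {σ : L.Sec} {x : S} (hσ : SmoothNear E σ x) (w : E) :
    C.dbarOp (fun y => C.diag c y (σ y)) x w = C.diag c x (C.dbarOp σ x w) := by
  have := L.finiteDimensional_fiber x
  have hΦ := C.smoothEnd_diag c x
  -- This identity of endomorphisms of the fibre says that ∂̄ annihilates the diagonal operator. It
  -- is checked on vectors of one U^p, extended to sections of U^p, where the operator is the scalar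
  -- c p and ∂̄ preserves U^p.
  have hcomm : part01 (nablaEnd E (C.diag c) x) w + C.tauField x w ∘ₗ C.diag c x =
      C.diag c x ∘ₗ C.tauField x w := by
    refine C.hom_ext fun p a ha => ?_
    obtain ⟨g, hg, hgx, hgU⟩ := ((C.smooth p).isSubbundleAt x).1 a ha
    have he : ∀ᶠ y in 𝓝 x, C.diag c y (g y) = c p • g y := by
      filter_upwards [hgU] with y hy using C.diag_apply c hy
    have h1 := nabla01_end_apply hΦ hg w
    rw [nabla01_congr he, nabla01_const_smul hg, hgx] at h1
    have h2 := (tauField_section hg hgU w).2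
    have h3 := C.diag_apply c h2
    rw [dbarOp_apply, map_add, hgx, smul_add] at h3
    rw [LinearMap.add_apply, LinearMap.comp_apply, LinearMap.comp_apply, C.diag_apply c ha,
      map_smul, eq_sub_of_add_eq h1.symm, eq_sub_of_add_eq' h3]
    abel
  have h := LinearMap.congr_fun hcomm (σ x)
  simp only [LinearMap.add_apply, LinearMap.comp_apply] at h
  rw [dbarOp_apply, dbarOp_apply, map_add, nabla01_end_apply hΦ hσ, ← h]
  abel

variable (C) in
theorem exists_frame_of_extension {x : S}
    (h : ∀ p, ∀ a ∈ C.U p x, ∃ σ : L.Sec, SmoothNear E σ x ∧ σ x = a ∧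
      ∀ᶠ y in 𝓝 x, C.dbarOp σ y = 0) :
    ∃ (m : ℕ) (f : Fin m → L.Sec), (∀ j, SmoothNear E (f j) x) ∧
      ∀ᶠ y in 𝓝 x, LinearIndependent ℂ (fun j => f j y) ∧
        Submodule.span ℂ (Set.range fun j => f j y) = ⊤ ∧ ∀ j, C.dbarOp (f j) y = 0 := by
  have := fun y => L.finiteDimensional_fiber y
  -- A basis adapted to the decomposition at x suffices: the extended sections remain independent
  -- nearby, and then span since the rank is locally constant.
  let b := (C.directSum x).collectedBasis fun p => Module.finBasis ℂ (C.U p x)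
  have hbfin := Module.Finite.finite_basis b
  let e := Finite.equivFin (Σ p, Fin (Module.finrank ℂ (C.U p x)))
  choose f hf hfx hfd using fun i =>
    h i.1 (b i) (DirectSum.IsInternal.collectedBasis_mem (C.directSum x) _ i)
  refine ⟨_, fun j => f (e.symm j), fun j => hf _, ?_⟩
  have hli : LinearIndependent ℂ fun j => f (e.symm j) x := by
    simp only [hfx]
    exact b.linearIndependent.comp _ e.symm.injective
  filter_upwards [eventually_linearIndependent (fun j => hf (e.symm j)) hli,
    eventually_mem_baseSet (L := L) x, Filter.eventually_all.mpr hfd] with y hy hyx hyd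
  refine ⟨hy, hy.span_eq_top_of_card_eq_finrank' ?_, fun j => hyd _⟩
  rw [L.finrank_fiber hyx, ← L.finrank_fiber (L.mem_baseSet x), Fintype.card_fin,
    Module.finrank_eq_nat_card_basis b]

end ComplexVHS

/-! ### The derivative of an endomorphism in coordinates -/

variable [IsManifold 𝓘(ℂ, E) ω S]

theorem eventually_triv_nablaEnd {Φ : EndSec L} (hΦ : ∀ y, SmoothEnd E Φ y) (x : S) :
    ∀ᶠ y in 𝓝 x, ∀ (v : E) (a : L.Fiber y),
      L.triv x y (nablaEnd E Φ y (coordField E x v y) a) =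
        fderiv ℝ (inChart E x (coordEnd x Φ)) (chartAt E x y) v (L.triv x y a) := by
  filter_upwards [(hΦ x).eventually, eventually_mem_baseSet (L := L) x,
    (chartAt E x).open_source.mem_nhds (mem_chart_source E x)] with y hy hyx hys v a
  rw [triv_nablaEnd hyx (hΦ y) hy, dAt_coordField hys hy.at_self]

theorem eventually_triv_part_nablaEnd {Φ : EndSec L} (hΦ : ∀ y, SmoothEnd E Φ y) (x : S) :
    ∀ᶠ y in 𝓝 x, ∀ (v : E) (a : L.Fiber y),
      L.triv x y (part10 (nablaEnd E Φ y) (coordField E x v y) a) =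
        del (inChart E x (coordEnd x Φ)) v (chartAt E x y) (L.triv x y a) ∧
      L.triv x y (part01 (nablaEnd E Φ y) (coordField E x v y) a) =
        delbar (inChart E x (coordEnd x Φ)) v (chartAt E x y) (L.triv x y a) := by
  filter_upwards [eventually_triv_nablaEnd hΦ x] with y hy v a
  constructor
  · rw [part10_apply, del_eq, ← coordField_smul]
    simp only [LinearMap.smul_apply, LinearMap.sub_apply, map_smul, map_sub, hy]
    rfl
  · rw [part01_apply, delbar_eq, ← coordField_smul]
    simp only [LinearMap.smul_apply, LinearMap.add_apply, map_smul, map_add, hy]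
    rfl

namespace ComplexVHS

variable (C : ComplexVHS E L)

/-- The grading operator in the chart and the flat trivialization at `x`. -/
def gradingCoord (x : S) : E → (Fin (L.rank x) → ℂ) →L[ℂ] (Fin (L.rank x) → ℂ) :=
  inChart E x (coordEnd x C.grading)

theorem contDiffAt_gradingCoord (x : S) :
    ∀ᶠ e in 𝓝 (chartAt E x x), ContDiffAt ℝ ∞ (C.gradingCoord x) e :=
  GermSmooth.contDiffAt_inChart (C.smoothEnd_grading x)

theorem eventually_triv_fields (x : S) : ∀ᶠ y in 𝓝 x, ∀ (v : E) (a : L.Fiber y),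
    L.triv x y (C.higgsField y (coordField E x v y) a) =
      del (C.gradingCoord x) v (chartAt E x y) (L.triv x y a) ∧
    L.triv x y (C.tauField y (coordField E x v y) a) =
      delbar (C.gradingCoord x) v (chartAt E x y) (L.triv x y a) :=
  eventually_triv_part_nablaEnd C.smoothEnd_grading x

theorem triv_higgsField (x : S) (v : E) (a : L.Fiber x) :
    L.triv x x (C.higgsField x v a) =
      del (C.gradingCoord x) v (chartAt E x x) (L.triv x x a) := by
  have h := ((C.eventually_triv_fields x).self_of_nhds v a).1
  rwa [coordField_self] at h

theorem triv_tauField (x : S) (v : E) (a : L.Fiber x) :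
    L.triv x x (C.tauField x v a) =
      delbar (C.gradingCoord x) v (chartAt E x x) (L.triv x x a) := by
  have h := ((C.eventually_triv_fields x).self_of_nhds v a).2
  rwa [coordField_self] at h

theorem eventually_gradingCoord_relations (x : S) : ∀ᶠ e in 𝓝 (chartAt E x x), ∀ v,
    C.gradingCoord x e * del (C.gradingCoord x) v e -
      del (C.gradingCoord x) v e * C.gradingCoord x e = -del (C.gradingCoord x) v e ∧
    C.gradingCoord x e * delbar (C.gradingCoord x) v e -
      delbar (C.gradingCoord x) v e * C.gradingCoord x e = delbar (C.gradingCoord x) v e := by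
  filter_upwards [(tendsto_chartAt_symm x).eventually (C.eventually_triv_fields x),
    (tendsto_chartAt_symm x).eventually (eventually_mem_baseSet (L := L) x),
    (chartAt E x).open_target.mem_nhds (mem_chart_target E x)] with e he heb het v
  set y := (chartAt E x).symm e with hy
  have hye : chartAt E x y = e := (chartAt E x).right_inv het
  have hg : C.gradingCoord x e = coordEnd x C.grading y := rfl
  rw [hye] at he
  constructor
  · ext1 z
    obtain ⟨a, rfl⟩ := (L.triv_bijective x y heb).2 z
    change C.gradingCoord x e (del (C.gradingCoord x) v e (L.triv x y a)) -
      del (C.gradingCoord x) v e (C.gradingCoord x e (L.triv x y a)) =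
        -(del (C.gradingCoord x) v e (L.triv x y a))
    rw [hg, ← (he v a).1, coordEnd_apply heb, coordEnd_apply heb, ← (he v _).1, ← map_sub,
      grading_higgsField, map_neg]
  · ext1 z
    obtain ⟨a, rfl⟩ := (L.triv_bijective x y heb).2 z
    change C.gradingCoord x e (delbar (C.gradingCoord x) v e (L.triv x y a)) -
      delbar (C.gradingCoord x) v e (C.gradingCoord x e (L.triv x y a)) =
        delbar (C.gradingCoord x) v e (L.triv x y a)
    rw [hg, ← (he v a).2, coordEnd_apply heb, coordEnd_apply heb, ← (he v _).2, ← map_sub,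
      grading_tauField]

theorem higgsField_comm (x : S) (u v : E) :
    C.higgsField x u ∘ₗ C.higgsField x v = C.higgsField x v ∘ₗ C.higgsField x u := by
  have h := del_mul_del_comm (C.contDiffAt_gradingCoord x).self_of_nhds
    ((C.eventually_gradingCoord_relations x).mono fun e he v => (he v).1) u v
  ext a
  refine (L.triv_bijective x x (L.mem_baseSet x)).1 ?_
  rw [LinearMap.comp_apply, LinearMap.comp_apply, triv_higgsField, triv_higgsField,
    triv_higgsField, triv_higgsField]
  exact congrArg (fun A : (Fin (L.rank x) → ℂ) →L[ℂ] (Fin (L.rank x) → ℂ) => A (L.triv x x a)) h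

theorem eventually_coord_higgsField (x : S) (v : E) (σ : L.Sec) :
    coord x (fun y => C.higgsField y (coordField E x v y) (σ y)) =ᶠ[𝓝 x]
      fun y => del (C.gradingCoord x) v (chartAt E x y) (coord x σ y) := by
  filter_upwards [C.eventually_triv_fields x] with y hy using (hy v (σ y)).1

theorem contDiffAt_del_gradingCoord (x : S) (v : E) :
    ∀ᶠ e in 𝓝 (chartAt E x x), ContDiffAt ℝ ∞ (del (C.gradingCoord x) v) e :=
  (C.contDiffAt_gradingCoord x).mono fun _ he => contDiffAt_del he v

theorem smoothNear_higgsField {x : S} (v : E) {σ : L.Sec} (hσ : SmoothNear E σ x) :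
    SmoothNear E (fun y => C.higgsField y (coordField E x v y) (σ y)) x :=
  GermSmooth.congr
    ((germSmooth_comp_chartAt (C.contDiffAt_del_gradingCoord x v)).clm_apply hσ)
    (C.eventually_coord_higgsField x v σ)

/-- In flat coordinates ∂̄ is the (0,1)-derivative plus multiplication by ∂̄Y, and θ_v is ∂_vY.
After the Leibniz rule, the claim is ∂̄_w∂_vY + [∂̄_wY, ∂_vY] = 0 applied to σ. -/
theorem dbarOp_higgsField {x : S} (v w : E) {σ : L.Sec} (hσ : SmoothNear E σ x) :
    C.dbarOp (fun y => C.higgsField y (coordField E x v y) (σ y)) x w =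
      C.higgsField x v (C.dbarOp σ x w) := by
  set Y := C.gradingCoord x
  set e := chartAt E x x
  have hD := C.contDiffAt_del_gradingCoord x v
  have h := delbar_del_add_comm (C.contDiffAt_gradingCoord x).self_of_nhds
    ((C.eventually_gradingCoord_relations x).mono fun e he v => (he v).1)
    ((C.eventually_gradingCoord_relations x).mono fun e he v => (he v).2) v w
  have hd : ∀ u, dAt E (coord x fun y => C.higgsField y (coordField E x v y) (σ y)) x u =
      fderiv ℝ (del Y v) e u (L.triv x x (σ x)) + del Y v e (dAt E (coord x σ) x u) := by
    intro u
    rw [dAt_congr (C.eventually_coord_higgsField x v σ),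
      dAt_clm_apply (germSmooth_comp_chartAt hD) hσ, dAt_comp_chartAt hD]
    rfl
  refine (L.triv_bijective x x (L.mem_baseSet x)).1 ?_
  have h1 : L.triv x x (nabla01 E (fun y => C.higgsField y (coordField E x v y) (σ y)) x w) =
      delbar (del Y v) w e (L.triv x x (σ x)) +
        del Y v e (L.triv x x (nabla01 E σ x w)) := by
    simp only [nabla01_apply, map_smul, map_add, triv_nabla_self, hd]
    rw [delbar_eq]
    change _ = (2⁻¹ : ℂ) • (fderiv ℝ (del Y v) e w (L.triv x x (σ x)) +
      Complex.I • fderiv ℝ (del Y v) e (Complex.I • w) (L.triv x x (σ x))) + _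
    module
  have h2 := congrArg (fun A : (Fin (L.rank x) → ℂ) →L[ℂ] (Fin (L.rank x) → ℂ) =>
    A (L.triv x x (σ x))) h
  change delbar (del Y v) w e (L.triv x x (σ x)) +
    delbar Y w e (del Y v e (L.triv x x (σ x))) =
      del Y v e (delbar Y w e (L.triv x x (σ x))) at h2
  have h3 : L.triv x x (C.tauField x w (C.higgsField x (coordField E x v x) (σ x))) =
      delbar Y w e (del Y v e (L.triv x x (σ x))) := by
    rw [coordField_self, triv_tauField, triv_higgsField]
  have h4 : L.triv x x (C.higgsField x v (nabla01 E σ x w + C.tauField x w (σ x))) =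
      del Y v e (L.triv x x (nabla01 E σ x w)) +
        del Y v e (delbar Y w e (L.triv x x (σ x))) := by
    rw [triv_higgsField, map_add, map_add, triv_tauField]
  rw [dbarOp_apply, dbarOp_apply, h4, map_add, h1, h3, ← h2]
  abel

/-- The Higgs bundle of a complex variation of Hodge structure for which `∂̄` has local
holomorphic frames. -/
def higgs (hframe : ∀ x : S, ∃ (m : ℕ) (f : Fin m → L.Sec), (∀ j, SmoothNear E (f j) x) ∧
    ∀ᶠ y in 𝓝 x, LinearIndependent ℂ (fun j => f j y) ∧
      Submodule.span ℂ (Set.range fun j => f j y) = ⊤ ∧ ∀ j, C.dbarOp (f j) y = 0) :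
    HiggsStructure E L where
  dbar := C.dbarOp
  theta := C.higgsField
  dbar_add _ _ _ h h' := dbarOp_add h h'
  dbar_leibniz _ _ _ hg h w := dbarOp_leibniz hg h w
  holomorphic_frame := hframe
  theta_smooth _ v _ h := C.smoothNear_higgsField v h
  dbar_theta _ v w _ h := C.dbarOp_higgsField v w h
  theta_theta := C.higgsField_comm

variable {C}

theorem induces_of_eq {B : HiggsStructure E L} (hd : B.dbar = C.dbarOp)
    (ht : B.theta = C.higgsField) : C.Induces B where
  dbar_mem p x σ hσ hσU w := by
    rw [hd]
    exact (tauField_section hσ hσU w).2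
  tau_mem p x σ hσ hσU w := by
    rw [hd, dbarOp_apply, sub_add_cancel_left]
    exact Submodule.neg_mem _ (tauField_section hσ hσU w).1
  theta_mem p x a ha v := by
    rw [ht]
    exact higgsField_mem ha v
  del_mem p x σ hσ hσU v := by
    rw [ht]
    exact (higgsField_section hσ hσU v).2

/-- The Higgs bundle of a complex variation of Hodge structure is isomorphic to all its
rescalings. -/
def higgsIso {B : HiggsStructure E L} (hd : B.dbar = C.dbarOp) (ht : B.theta = C.higgsField)
    (c : ℂˣ) : HiggsIso B (B.act c) where
  -- The exponent is -p because θ lowers p by one: c · c^{-p} = c^{-(p-1)} is what compatibility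
  -- with θ and cθ requires.
  map s := LinearEquiv.ofLinearMap (C.diag (fun p => (c : ℂ) ^ (-p)) s)
    (C.diag (fun p => (c : ℂ) ^ p) s)
    (LinearMap.ext fun a => C.diag_diag _ _ (fun p => by
      rw [← zpow_add₀ c.ne_zero, neg_add_cancel, zpow_zero]) s a)
    (LinearMap.ext fun a => C.diag_diag _ _ (fun p => by
      rw [← zpow_add₀ c.ne_zero, add_neg_cancel, zpow_zero]) s a)
  smooth σ x := by
    refine ⟨fun h => ?_, fun h => (C.smoothEnd_diag _ x).apply h⟩
    refine ((C.smoothEnd_diag (fun p => (c : ℂ) ^ p) x).apply h).congr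
      (.of_forall fun y => ?_)
    exact (C.diag_diag _ _ (fun p => by
      rw [← zpow_add₀ c.ne_zero, add_neg_cancel, zpow_zero]) y (σ y)).symm
  map_dbar σ x hσ w := by
    change B.dbar _ x w = _
    rw [hd]
    exact dbarOp_diag _ hσ w
  map_theta x v a := by
    change (c : ℂ) • B.theta x v (C.diag (fun p => (c : ℂ) ^ (-p)) x a) =
      C.diag (fun p => (c : ℂ) ^ (-p)) x (B.theta x v a)
    rw [ht]
    have h : (c : ℂ) • (C.higgsField x v ∘ₗ C.diag (fun p => (c : ℂ) ^ (-p)) x) =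
        C.diag (fun p => (c : ℂ) ^ (-p)) x ∘ₗ C.higgsField x v := by
      refine C.hom_ext fun p a ha => ?_
      rw [LinearMap.smul_apply, LinearMap.comp_apply, LinearMap.comp_apply, C.diag_apply _ ha,
        map_smul, C.diag_apply _ (higgsField_mem ha v), smul_smul]
      congr 1
      rw [show -(p - 1) = 1 + -p by ring, zpow_add₀ c.ne_zero, zpow_one]
    exact LinearMap.congr_fun h a

end ComplexVHS

end Higgs

/-! ### Holomorphic frames -/

namespace VGPMHS

variable {E : Type*} [NormedAddCommGroup E] [NormedSpace ℂ E]
  {S : Type u} [TopologicalSpace S] [ChartedSpace E S] (X : VGPMHS.{u, w} E S)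

open LocalSystem

theorem F_eq_sup (p : ℤ) (s : S) :
    (show Submodule ℂ (X.V.complexify.Fiber s) from X.F s p) = X.U p s ⊔ X.F s (p + 1) :=
  (X.mixed s).F_eq_sup p

theorem F_eq_iSup (p : ℤ) (s : S) :
    (show Submodule ℂ (X.V.complexify.Fiber s) from X.F s p) =
      ⨆ (r : ℤ) (_ : p ≤ r), X.U r s :=
  (X.mixed s).isDeligneBigrading.F_eq p

theorem projOp_eq_zero_of_mem_F {p : ℤ} {s : S} {a : X.V.complexify.Fiber s}
    (ha : a ∈ X.F s (p + 1)) : projOp (X.isInternal_U s) p a = 0 := by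
  have h : (⨆ (r : ℤ) (_ : p + 1 ≤ r), X.U r s) ≤ LinearMap.ker (projOp (X.isInternal_U s) p) :=
    iSup₂_le fun r hr b hb => projOp_of_mem_ne _ (by omega) hb
  rw [← X.F_eq_iSup] at h
  exact h ha

theorem sub_projOp_mem_F {p : ℤ} {s : S} {a : X.V.complexify.Fiber s} (ha : a ∈ X.F s p) :
    a - projOp (X.isInternal_U s) p a ∈
      (show Submodule ℂ (X.V.complexify.Fiber s) from X.F s (p + 1)) := by
  have ha' : a ∈ (show Submodule ℂ (X.V.complexify.Fiber s) from X.F s p) := ha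
  rw [F_eq_sup] at ha'
  obtain ⟨u, hu, f, hf, rfl⟩ := Submodule.mem_sup.mp ha'
  have e : u + f - projOp (X.isInternal_U s) p (u + f) = f := by
    have e1 : projOp (X.isInternal_U s) p u = u := projOp_of_mem _ hu
    rw [map_add, X.projOp_eq_zero_of_mem_F hf, add_zero, add_sub_assoc, ← eq_sub_iff_add_eq']
    rw [e1]
  rw [e]
  exact hf

theorem smoothNear_projOp {p : ℤ} {x : S} {g : X.V.complexify.Sec} (hg : SmoothNear E g x) :
    SmoothNear E (fun y => projOp (X.isInternal_U y) p (g y)) x :=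
  (X.complexVHS.smoothEnd_diag (Pi.single p 1) x).apply hg

/-- The projection to `U^p` of a holomorphic section of `F^p` is annihilated by `∂̄`. -/
theorem dbarOp_projOp_eq_zero {p : ℤ} {x : S} {g : X.V.complexify.Sec} (hg : HolNear E g x)
    (hgF : ∀ᶠ y in 𝓝 x, g y ∈ X.F y p) :
    X.complexVHS.dbarOp (fun y => projOp (X.isInternal_U y) p (g y)) x = 0 := by
  ext w
  set σ : X.V.complexify.Sec := fun y => projOp (X.isInternal_U y) p (g y) with hσd
  have hσ : SmoothNear E σ x := X.smoothNear_projOp hg.smoothNear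
  have hσU : ∀ᶠ y in 𝓝 x, σ y ∈ X.U p y := .of_forall fun y => projOp_mem _ p _
  have h1 := ComplexVHS.tauField_section (C := X.complexVHS) hσ hσU w
  -- Since g - σ is a section of F^{p+1} and ∇^{0,1}g = 0, also ∇^{0,1}σ lies in F^{p+1}; so does
  -- the τ-term, which is in U^{p+1}. Hence ∂̄σ lies in U^p ∩ F^{p+1} = 0.
  have hsub : ∀ᶠ y in 𝓝 x, (g - σ) y ∈ X.F y (p + 1) := by
    filter_upwards [hgF] with y hy using X.sub_projOp_mem_F hy
  have h2 := X.nabla01_mem_F (hg.smoothNear.sub hσ) hsub w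
  rw [nabla01_sub hg.smoothNear hσ, hg.nabla01_eq_zero, zero_sub] at h2
  have h3 : nabla01 E σ x w ∈
      (show Submodule ℂ (X.V.complexify.Fiber x) from X.F x (p + 1)) :=
    (Submodule.neg_mem_iff _).mp h2
  have h4 : X.complexVHS.tauField x w (σ x) ∈
      (show Submodule ℂ (X.V.complexify.Fiber x) from X.F x (p + 1)) :=
    X.U_le_F (p + 1) x h1.1
  have h5 : X.complexVHS.dbarOp σ x w ∈
      (show Submodule ℂ (X.V.complexify.Fiber x) from X.F x (p + 1)) :=
    Submodule.add_mem _ h3 h4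
  have h6 : X.complexVHS.dbarOp σ x w ∈ X.U p x ⊓
      (show Submodule ℂ (X.V.complexify.Fiber x) from X.F x (p + 1)) := ⟨h1.2, h5⟩
  have h7 : X.U p x ⊓ (show Submodule ℂ (X.V.complexify.Fiber x) from X.F x (p + 1)) = ⊥ :=
    (X.mixed x).deligneU_inf_F p
  rw [h7] at h6
  exact (Submodule.mem_bot ℂ).mp h6

/-- Each vector of U^p at x extends to a holomorphic section of F^p, and projecting that section to
U^p keeps its value at x and makes it ∂̄-closed. -/
theorem exists_holomorphic_frame (x : S) :
    ∃ (m : ℕ) (f : Fin m → X.V.complexify.Sec), (∀ j, SmoothNear E (f j) x) ∧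
      ∀ᶠ y in 𝓝 x, LinearIndependent ℂ (fun j => f j y) ∧
        Submodule.span ℂ (Set.range fun j => f j y) = ⊤ ∧
        ∀ j, X.complexVHS.dbarOp (f j) y = 0 := by
  refine X.complexVHS.exists_frame_of_extension (fun p a ha => ?_)
  obtain ⟨g, hg, hgx, hgF⟩ := (X.F_hol p).exists_holNear (X.U_le_F p x ha)
  refine ⟨fun y => projOp (X.isInternal_U y) p (g y), X.smoothNear_projOp hg.smoothNear, ?_, ?_⟩
  · beta_reduce
    rw [hgx]
    exact projOp_of_mem _ ha
  · filter_upwards [hg.eventually, eventually_eventually_nhds.mpr hgF] with y hy hyF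
    exact X.dbarOp_projOp_eq_zero hy hyF

end VGPMHS

end MHS

end

/-! ### The main theorem -/

theorem corollary5p3 {E : Type*} [NormedAddCommGroup E] [NormedSpace ℂ E] [FiniteDimensional ℂ E]
    {S : Type*} [TopologicalSpace S] [ChartedSpace E S] [IsManifold 𝓘(ℂ, E) ω S]
    (X : MHS.VGPMHS E S) :
    ∃ I : ∀ s, ℤ → ℤ → Submodule ℂ (ℂ ⊗[ℚ] X.V.Fiber s),
      (∀ s, MHS.IsDeligneBigrading (X.F s) (X.W s) (I s) ∧
        ∀ J, MHS.IsDeligneBigrading (X.F s) (X.W s) J → J = I s) ∧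
      ∃ C : MHS.ComplexVHS E X.V.complexify,
        (∀ p s, C.U p s = ⨆ q : ℤ, I s p q) ∧
        ∃ B : MHS.HiggsStructure E X.V.complexify,
          C.Induces B ∧
          ∀ c : ℂˣ, Nonempty (MHS.HiggsIso B (B.act c)) := by
  refine ⟨fun s => MHS.deligne (X.F s) (X.W s), fun s => ⟨(X.mixed s).isDeligneBigrading,
    fun J hJ => (X.mixed s).eq_deligne hJ⟩, X.complexVHS, fun p s => rfl,
    X.complexVHS.higgs X.exists_holomorphic_frame, MHS.ComplexVHS.induces_of_eq rfl rfl,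
    fun c => ⟨MHS.ComplexVHS.higgsIso rfl rfl c⟩⟩
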